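/- Let $\mathbb N=\{1,2,3,\dots\}$, let $h>0$ be a mesh size, and write $\mathbf i=ih$. For $n\in\{1,2,3\}$ let $\alpha_n,\beta_n\ge 0$ and $$K_n(\mathbf i,\mathbf j)=\mathbf i^{\alpha_n}\,\mathbf j^{\alpha_n}\,(\mathbf i+\mathbf j)^{\beta_n},$$ and let $\delta$ satisfy $\delta>\max_{n\in\{1,2,3\}}(\alpha_n+\beta_n)$ and $\delta>2\alpha_1+\beta_1-1$. For $f:\mathbb N\to\mathbb R$ put $$S^{(1)}_i[f]=\sum_{j=1}^{i-1}K_1(\mathbf j,\mathbf i-\mathbf j)f_jf_{i-j}-2\sum_{j=1}^{\infty}K_1(\mathbf i,\mathbf j)f_if_j,$$ $$S^{(n)}_i[f]=-\sum_{j=1}^{i-1}K_n(\mathbf i-\mathbf j,\mathbf j)f_if_j+\sum_{j=i+1}^{\infty}K_n(\mathbf j-\mathbf i,\mathbf i)f_if_j+\sum_{j=i+1}^{\infty}K_n(\mathbf i,\mathbf j-\mathbf i)f_jf_{j-i}\qquad(n=2,3),$$ $$O_i[f]=S^{(1)}_i[f]+S^{(2)}_i[f]+S^{(3)}_i[f]-\mathbf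 i^{\delta}f_i .$$ For $f\ge 0$ and $k\ge 0$ let $m_k\langle f\rangle=\sum_{i=1}^\infty f_i\,\mathbf i^{k}\in[0,\infty]$. For $k>\max\{1,2-\alpha_1-\beta_1\}$ and $x\ge 0$ let $$\mathcal C_k=\frac{\delta-2\alpha_1-\beta_1+1}{\delta+k-1}\,\bigl[2^{\beta_1+1}(2^k-2)\bigr]^{\frac{\delta+k-1}{\delta-2\alpha_1-\beta_1+1}}\left(\frac{2(2\alpha_1+\beta_1+k-2)}{\delta+k-1}\right)^{\frac{2\alpha_1+\beta_1+k-2}{\delta-2\alpha_1-\beta_1+1}},$$ $$\mathcal B_k(x)=\left(2\,\mathcal C_k\,x^{\,1+\frac{\delta+k-1}{\delta-2\alpha_1-\beta_1+1}+\frac{\delta}{k-1}}\right)^{\frac{k-1}{\delta+k-1}}.$$ **Theorem (existence and uniqueness).** Let $\kappa>\max\{\delta,1,2-\alpha_1-\beta_1\}$ and let $f_0:\mathbb N\to[0,\infty)$ satisfy $m_\kappa\langle f_0\rangle<\infty$ (hence also $m_1\langle f_0\rangle<\infty$). Then there is exactly one nonnegative function $f\in C^1([0,\infty);\ell^1(\mathbb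 N))$ such that $f(0)=f_0$ and, for all $t\ge 0$, all series in $O[f(t)]$ converge and $\frac{\mathrm d}{\mathrm dt}f(t)=O[f(t)]$. Moreover, for all $t\ge0$, $$m_1\langle f(t)\rangle\le m_1\langle f_0\rangle,\qquad m_\kappa\langle f(t)\rangle\le\max\bigl\{m_\kappa\langle f_0\rangle,\;2\,\mathcal B_\kappa(m_1\langle f_0\rangle)\bigr\}.$$ -/

import Mathlib

open scoped ENNReal

noncomputable section

namespace CoagFrag

/-- The space `ℓ¹(ℕ)` of absolutely summable real sequences, with `ℕ = {1, 2, 3, …}`. -/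
abbrev Ell1 : Type := lp (fun _ : ℕ+ => ℝ) 1

/-- The physical location `𝐢 = i h` of the index `i` on the uniform mesh of size `h`. -/
def loc (h : ℝ) (i : ℕ+) : ℝ := (i : ℝ) * h

/-- The symmetric kernel `K(𝐢, 𝐣) = 𝐢^a 𝐣^a (𝐢 + 𝐣)^b`. -/
def kernel (h a b : ℝ) (i j : ℕ+) : ℝ :=
  loc h i ^ a * loc h j ^ a * (loc h i + loc h j) ^ b

/-- The coagulation operator
`S⁽¹⁾_i[f] = ∑_{j=1}^{i-1} K(𝐣, 𝐢 - 𝐣) f_j f_{i-j} - 2 ∑_{j=1}^∞ K(𝐢, 𝐣) f_i f_j`. -/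
def coag (h a b : ℝ) (f : ℕ+ → ℝ) (i : ℕ+) : ℝ :=
  ∑ j ∈ Finset.Iio i, kernel h a b j (i - j) * f j * f (i - j)
    - 2 * ∑' j : ℕ+, kernel h a b i j * f i * f j

/-- The fragmentation type operator (`S⁽²⁾` and `S⁽³⁾`)
`S_i[f] = - ∑_{j=1}^{i-1} K(𝐢 - 𝐣, 𝐣) f_i f_j
  + ∑_{j=i+1}^∞ K(𝐣 - 𝐢, 𝐢) f_i f_j + ∑_{j=i+1}^∞ K(𝐢, 𝐣 - 𝐢) f_j f_{j-i}`;
the two infinite sums are indexed by `l = j - i ≥ 1`. -/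
def frag (h a b : ℝ) (f : ℕ+ → ℝ) (i : ℕ+) : ℝ :=
  -(∑ j ∈ Finset.Iio i, kernel h a b (i - j) j * f i * f j)
    + ∑' l : ℕ+, kernel h a b l i * f i * f (i + l)
    + ∑' l : ℕ+, kernel h a b i l * f (i + l) * f l

/-- The full operator `O[f] = S⁽¹⁾[f] + S⁽²⁾[f] + S⁽³⁾[f] - V[f]` with `V_i[f] = 𝐢^δ f_i`.
The kernel `K_n` has the exponents `α (n-1)`, `β (n-1)` for `n = 1, 2, 3`. -/
def fullOp (h : ℝ) (α β : Fin 3 → ℝ) (δ : ℝ) (f : ℕ+ → ℝ) (i : ℕ+) : ℝ :=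
  coag h (α 0) (β 0) f i + frag h (α 1) (β 1) f i + frag h (α 2) (β 2) f i
    - loc h i ^ δ * f i

/-- All the infinite series that occur in `fullOp h α β δ f` converge. -/
structure SeriesConverge (h : ℝ) (α β : Fin 3 → ℝ) (f : ℕ+ → ℝ) : Prop where
  coag_loss : ∀ i, Summable fun j : ℕ+ => kernel h (α 0) (β 0) i j * f i * f j
  frag_gain_left : ∀ n : Fin 3, n ≠ 0 → ∀ i,
    Summable fun l : ℕ+ => kernel h (α n) (β n) l i * f i * f (i + l)
  frag_gain_right : ∀ n : Fin 3, n ≠ 0 → ∀ i,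
    Summable fun l : ℕ+ => kernel h (α n) (β n) i l * f (i + l) * f l

/-- `f` is a nonnegative global classical solution with initial data `f₀`:
`f ∈ C¹([0,∞); ℓ¹(ℕ))`, `f(t) ≥ 0`, `f(0) = f₀`, and `f'(t) = O[f(t)]` for all `t ≥ 0`
(one-sided derivative at `t = 0`), all series in `O[f(t)]` being convergent.
The values of `f` at negative times are irrelevant. -/
structure IsSolution (h : ℝ) (α β : Fin 3 → ℝ) (δ : ℝ) (f₀ : ℕ+ → ℝ) (f : ℝ → Ell1) :
    Prop where
  contDiffOn : ContDiffOn ℝ 1 f (Set.Ici 0)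
  nonneg : ∀ t, 0 ≤ t → ∀ i, 0 ≤ f t i
  initial : ∀ i, f 0 i = f₀ i
  converge : ∀ t, 0 ≤ t → SeriesConverge h α β (f t)
  equation : ∀ t, 0 ≤ t → ∀ i, derivWithin f (Set.Ici 0) t i = fullOp h α β δ (f t) i

/-- The `k`-th moment of `f` is finite (for nonnegative `f`). -/
def FiniteMoment (h k : ℝ) (f : ℕ+ → ℝ) : Prop :=
  Summable fun i : ℕ+ => f i * loc h i ^ k

/-- The `k`-th moment `m_k⟨f⟩ = ∑_i f_i 𝐢^k`, meaningful if `FiniteMoment h k f`. -/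
def moment (h k : ℝ) (f : ℕ+ → ℝ) : ℝ :=
  ∑' i : ℕ+, f i * loc h i ^ k

/-- The constant `𝒞_k`, depending on `α₁, β₁, δ, k`. -/
def constC (α₁ β₁ δ k : ℝ) : ℝ :=
  (δ - 2 * α₁ - β₁ + 1) / (δ + k - 1)
    * ((2 : ℝ) ^ (β₁ + 1) * ((2 : ℝ) ^ k - 2)) ^ ((δ + k - 1) / (δ - 2 * α₁ - β₁ + 1))
    * (2 * (2 * α₁ + β₁ + k - 2) / (δ + k - 1))
        ^ ((2 * α₁ + β₁ + k - 2) / (δ - 2 * α₁ - β₁ + 1))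

/-- The bound function `ℬ_k(x)`, for `k > 1` and `x ≥ 0`. -/
def boundB (α₁ β₁ δ k x : ℝ) : ℝ :=
  (2 * constC α₁ β₁ δ k
      * x ^ (1 + (δ + k - 1) / (δ - 2 * α₁ - β₁ + 1) + δ / (k - 1)))
    ^ ((k - 1) / (δ + k - 1))

end CoagFrag

end

/-!
Write `O_i[f] = transfer A i - 𝐢^δ f_i`, where `A (j, l)` is the net rate at which clusters of sizes
`j` and `l` merge: coagulation contributes positively, and each fragmentation type operator is the
reverse process `j + l → j, l`, triggered by a cluster of size `l` (`fullOp_eq`). Hence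
`∑ φ_i O_i[f] = ∑ A (j, l) (φ (j + l) - φ j - φ l) - ∑ φ_i 𝐢^δ f_i` for a test sequence `φ`, and the
proof consists in choosing `φ`. Two facts about `A` are used throughout: it is quadratic in `f`, and
as a map to `ℓ¹(ℕ × ℕ)` it is bounded in terms of the weighted norm `∑ |f_i| i ^ p` with
`p = max (α_n + β_n)` (`flux_sub_bound`), which is lower than the order `δ` of the damping.

*Stability.* For two solutions with bounded norms of order `p`, the sign of the difference as test
sequence gives `d/dt ‖f - g‖ ≤ K ∑ |f_i - g_i| i ^ p - c ∑ |f_i - g_i| i ^ δ`. Since `p < δ`, the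
damping absorbs the first term up to a multiple of `‖f - g‖`, and Grönwall's inequality applies
(`exists_stability`, which also allows for an error in the kernels).

*Uniqueness* holds without any assumption on moments. If the series in `O[f]` converge, the norm of
order `p` is finite at each time (`wsummable_of_seriesConverge`). As `f` is `C¹` in `ℓ¹`, the `ℓ¹`
norm of `O[f]` is bounded on compact time intervals, and this already bounds the norm of order `δ`
(`exists_wnorm_bound`): with `φ = min (i / N) 1`, coagulation only yields a loss and splitting
only contributes through clusters larger than `N`, which bounds the tested damping at `N` in terms
of the one at `N + 1`. These tend to zero as `N → ∞` by dominated convergence, so a bound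
propagates downwards from large `N` to a fixed one.

*Existence.* Systems with kernels cut off at size `N` are solved by the Picard–Lindelöf theorem.
The first moment does not increase. For the moment of order `κ`, splitting has a favourable sign,
the gain by coagulation is bounded by a product of moments (`kernel_gain_le`), and interpolation
between the moments of orders `1` and `δ + κ` shows that the damping wins once the moment exceeds
`2 ℬ_κ` (`gain_le_damping`). The factor `2` leaves room for replacing the constant `2 ^ κ - 2` in
`𝒞_κ`, which can be too small for the gain if `κ < 2` and `α₁ < 1`, by a larger one (`gainConst_le`).
By stability the truncated solutions are Cauchy in `ℓ¹`, locally uniformly in time, and the bound of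
order `κ > δ` gives convergence of the right-hand sides by interpolation
(`IsTruncatedFamily.exists_limit`).
-/

noncomputable section

namespace CoagFrag

/-! ### The transfer operator -/

/-- The net gain of clusters of size `i` when, for every pair `(j, l)`, clusters of sizes `j` and
`l` merge into one of size `j + l` at rate `A (j, l)`; negative rates describe splitting. -/
def transfer (A : ℕ+ × ℕ+ → ℝ) (i : ℕ+) : ℝ :=
  ∑ j ∈ Finset.Iio i, A (j, i - j) - ∑' j, A (i, j) - ∑' j, A (j, i)

/-- Summation over pairs, grouped by the sum of the two entries. -/
theorem hasSum_sum_Iio {B : ℕ+ × ℕ+ → ℝ} (hB : Summable B) :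
    HasSum (fun i => ∑ j ∈ Finset.Iio i, B (j, i - j)) (∑' x, B x) := by
  have h := hB.hasSum.tsum_fiberwise (fun x : ℕ+ × ℕ+ => x.1 + x.2)
  refine h.congr_fun fun i => ?_
  let e : ℕ+ ↪ ℕ+ × ℕ+ := ⟨fun j => (j, i - j), fun a b hab => (Prod.ext_iff.1 hab).1⟩
  have he : ∀ j, e j = (j, i - j) := fun _ => rfl
  have hs : ((fun x : ℕ+ × ℕ+ => x.1 + x.2) ⁻¹' {i}) = ((Finset.Iio i).map e : Set (ℕ+ × ℕ+)) := by
    ext ⟨a, b⟩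
    simp only [Set.mem_preimage, Set.mem_singleton_iff, Finset.coe_map, Set.mem_image,
      Finset.coe_Iio, Set.mem_Iio, he, Prod.mk.injEq]
    constructor
    · intro hab
      refine ⟨a, ?_, rfl, ?_⟩
      · rw [← hab]; exact PNat.lt_add_right a b
      · apply PNat.eq
        rw [PNat.sub_coe, if_pos (by rw [← hab]; exact PNat.lt_add_right a b), ← hab]
        simp
    · rintro ⟨c, hc, rfl, rfl⟩
      exact PNat.add_sub_of_lt hc
  rw [hs, Finset.tsum_subtype' , Finset.sum_map]
  rfl

/-- Weak formulation of the transfer operator: a merging event `(j, l)` changes the total of the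
test sequence `φ` by `φ (j + l) - φ j - φ l`. -/
theorem hasSum_mul_transfer {A : ℕ+ × ℕ+ → ℝ} {φ : ℕ+ → ℝ}
    (h₀ : Summable fun x : ℕ+ × ℕ+ => A x * φ (x.1 + x.2))
    (h₁ : Summable fun x : ℕ+ × ℕ+ => A x * φ x.1)
    (h₂ : Summable fun x : ℕ+ × ℕ+ => A x * φ x.2) :
    HasSum (fun i => φ i * transfer A i)
      (∑' x : ℕ+ × ℕ+, A x * (φ (x.1 + x.2) - φ x.1 - φ x.2)) := by
  have e₀ := hasSum_sum_Iio h₀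
  have e₁ := h₁.hasSum.prod_fiberwise (fun b => (h₁.prod_factor b).hasSum)
  have h₂' := h₂.prod_symm
  have e₂ := h₂'.hasSum.prod_fiberwise (fun b => (h₂'.prod_factor b).hasSum)
  have : ∑' x : ℕ+ × ℕ+, A x.swap * φ x.swap.2 = ∑' x : ℕ+ × ℕ+, A x * φ x.2 :=
    (Equiv.prodComm ℕ+ ℕ+).tsum_eq (fun x : ℕ+ × ℕ+ => A x * φ x.2)
  rw [this] at e₂
  have e := (e₀.sub e₁).sub e₂
  rw [← h₀.tsum_sub h₁, ← (h₀.sub h₁).tsum_sub h₂] at e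
  have e3 : ∑' x : ℕ+ × ℕ+, A x * (φ (x.1 + x.2) - φ x.1 - φ x.2)
      = ∑' x : ℕ+ × ℕ+, (A x * φ (x.1 + x.2) - A x * φ x.1 - A x * φ x.2) :=
    tsum_congr fun x => by ring
  rw [e3]
  refine e.congr_fun fun i => ?_
  · simp only [transfer, Prod.swap_prod_mk, tsum_mul_right]
    have : ∑ j ∈ Finset.Iio i, A (j, i - j) * φ (j + (i - j))
        = (∑ j ∈ Finset.Iio i, A (j, i - j)) * φ i := by
      rw [Finset.sum_mul]
      refine Finset.sum_congr rfl fun j hj => ?_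
      rw [PNat.add_sub_of_lt (Finset.mem_Iio.1 hj)]
    rw [this]; ring

theorem summable_mul_of_bounded {ι : Type*} {A φ : ι → ℝ} (hA : Summable A) {b : ℝ}
    (hφ : ∀ i, |φ i| ≤ b) : Summable fun i => A i * φ i := by
  refine Summable.of_norm_bounded (hA.abs.mul_right b) fun i => ?_
  rw [Real.norm_eq_abs, abs_mul]
  exact mul_le_mul_of_nonneg_left (hφ i) (abs_nonneg _)

theorem hasSum_mul_transfer_of_bounded {A : ℕ+ × ℕ+ → ℝ} (hA : Summable A) {φ : ℕ+ → ℝ} {b : ℝ}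
    (hφ : ∀ i, |φ i| ≤ b) :
    HasSum (fun i => φ i * transfer A i)
      (∑' x : ℕ+ × ℕ+, A x * (φ (x.1 + x.2) - φ x.1 - φ x.2)) :=
  hasSum_mul_transfer (summable_mul_of_bounded hA fun _ => hφ _)
    (summable_mul_of_bounded hA fun _ => hφ _) (summable_mul_of_bounded hA fun _ => hφ _)

theorem abs_sign_le_one (x : ℝ) : |((SignType.sign x : SignType) : ℝ)| ≤ 1 := by
  rcases lt_trichotomy x 0 with h | h | h <;> simp [h]

theorem hasSum_abs_transfer {A : ℕ+ × ℕ+ → ℝ} (hA : Summable A) :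
    Summable (fun i => |transfer A i|) ∧ ∑' i, |transfer A i| ≤ 3 * ∑' x, |A x| := by
  have hφ : ∀ i, |(SignType.sign (transfer A i) : ℝ)| ≤ 1 := fun i => abs_sign_le_one _
  have h := hasSum_mul_transfer_of_bounded hA hφ
  simp only [sign_mul_self] at h
  refine ⟨h.summable, ?_⟩
  rw [h.tsum_eq, ← tsum_mul_left]
  have hb : ∀ x : ℕ+ × ℕ+, |A x * ((SignType.sign (transfer A (x.1 + x.2)) : ℝ)
      - SignType.sign (transfer A x.1) - SignType.sign (transfer A x.2))| ≤ 3 * |A x| := by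
    intro x
    rw [abs_mul, mul_comm]
    refine mul_le_mul_of_nonneg_right ?_ (abs_nonneg _)
    have h1 := abs_le.1 (hφ (x.1 + x.2))
    have h2 := abs_le.1 (hφ x.1)
    have h3 := abs_le.1 (hφ x.2)
    rw [abs_le]; constructor <;> linarith
  have hs := hA.abs.mul_left 3
  exact (Summable.of_norm_bounded hs hb).tsum_le_tsum (fun x => (le_abs_self _).trans (hb x)) hs

theorem transfer_sub {A B : ℕ+ × ℕ+ → ℝ} (hA : Summable A) (hB : Summable B) (i : ℕ+) :
    transfer A i - transfer B i = transfer (fun x => A x - B x) i := by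
  simp only [transfer, Finset.sum_sub_distrib]
  have h := (hA.prod_symm.prod_factor i).tsum_sub (hB.prod_symm.prod_factor i)
  simp only [Prod.swap_prod_mk] at h
  rw [(hA.prod_factor i).tsum_sub (hB.prod_factor i), h]
  ring

/-! ### The space `ℓ¹` -/

theorem Ell1.summable_abs (f : Ell1) : Summable fun i => |f i| := by
  have := lp.memℓp f
  rw [memℓp_gen_iff (by simp)] at this
  simpa using this

theorem Ell1.norm_eq (f : Ell1) : ‖f‖ = ∑' i, |f i| := by
  rw [lp.norm_eq_tsum_rpow (by simp)]
  simp

/-- An absolutely summable sequence as an element of `ℓ¹`. -/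
def Ell1.mk (f : ℕ+ → ℝ) (hf : Summable fun i => |f i|) : Ell1 :=
  ⟨f, memℓp_gen (by simpa using hf)⟩

theorem Ell1.abs_apply_le (f : Ell1) (i : ℕ+) : |f i| ≤ ‖f‖ := by
  rw [f.norm_eq]
  exact f.summable_abs.le_tsum i fun _ _ => abs_nonneg _

/-- The pairing of `ℓ¹` with a bounded sequence. -/
def pairing (φ : ℕ+ → ℝ) (b : ℝ) (hφ : ∀ i, |φ i| ≤ b) : Ell1 →L[ℝ] ℝ :=
  LinearMap.mkContinuous
    { toFun := fun f => ∑' i, f i * φ i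
      map_add' := fun f g => by
        rw [← (summable_mul_of_bounded f.summable_abs.of_abs hφ).tsum_add
          (summable_mul_of_bounded g.summable_abs.of_abs hφ)]
        congr 1; funext i; simp [add_mul]
      map_smul' := fun c f => by
        simp only [lp.coeFn_smul, Pi.smul_apply, smul_eq_mul, RingHom.id_apply, mul_assoc]
        rw [tsum_mul_left] }
    b (fun f => by
      have h : ∀ i, |f i * φ i| ≤ b * |f i| := fun i => by
        rw [abs_mul, mul_comm]
        exact mul_le_mul_of_nonneg_right (hφ i) (abs_nonneg _)
      rw [Ell1.norm_eq, ← tsum_mul_left]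
      exact tsum_of_norm_bounded (f.summable_abs.mul_left b).hasSum h)

theorem pairing_apply (φ : ℕ+ → ℝ) (b : ℝ) (hφ : ∀ i, |φ i| ≤ b) (f : Ell1) :
    pairing φ b hφ f = ∑' i, f i * φ i := rfl

/-- The evaluation of a sequence at an index. -/
def evalCLM (i : ℕ+) : Ell1 →L[ℝ] ℝ :=
  LinearMap.mkContinuous
    { toFun := fun f => f i
      map_add' := fun f g => by simp
      map_smul' := fun c f => by simp }
    1 (fun f => by rw [one_mul]; exact f.abs_apply_le i)

/-- Grönwall's inequality in `ℓ¹`, from a one-sided bound on the derivative. -/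
theorem Ell1.norm_le_of_dissipative {u u' : ℝ → Ell1} {T C ε : ℝ} (hC : 0 < C)
    (hu : ∀ t ∈ Set.Icc 0 T, HasDerivWithinAt u (u' t) (Set.Icc 0 T) t)
    (hd : ∀ t ∈ Set.Icc 0 T,
      ∑' i, u' t i * (SignType.sign (u t i) : ℝ) ≤ C * ‖u t‖ + ε) :
    ∀ t ∈ Set.Icc 0 T, ‖u t‖ ≤ Real.exp (C * t) * (‖u 0‖ + ε / C) - ε / C := by
  intro τ hτ
  have hcont : ContinuousOn u (Set.Icc 0 T) := fun t ht => (hu t ht).continuousWithinAt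
  have hmap : ∀ s ∈ Set.Icc (0 : ℝ) τ, τ - s ∈ Set.Icc 0 T := fun s hs =>
    ⟨by linarith [hs.2], by linarith [hs.1, hτ.2]⟩
  -- Duality with the sign of `u t` controls the backward slope of the norm, hence time reversal.
  have key := le_gronwallBound_of_liminf_deriv_right_le
    (f := fun s => -‖u (τ - s)‖)
    (f' := fun s => ∑' i, u' (τ - s) i * (SignType.sign (u (τ - s) i) : ℝ))
    (δ := -‖u τ‖) (K := -C) (ε := ε) (a := 0) (b := τ)
    ((hcont.comp (by fun_prop) hmap).norm.neg) ?_ (by simp) ?_ τ ⟨hτ.1, le_rfl⟩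
  · rw [gronwallBound_of_K_ne_0 (by linarith)] at key
    simp only [sub_self, sub_zero] at key
    have he : Real.exp (C * τ) * Real.exp (-C * τ) = 1 := by
      rw [← Real.exp_add]; simp
    have := mul_le_mul_of_nonneg_left key (Real.exp_pos (C * τ)).le
    have e2 : Real.exp (C * τ) * (-‖u τ‖ * Real.exp (-C * τ)
        + ε / -C * (Real.exp (-C * τ) - 1))
        = (Real.exp (C * τ) * Real.exp (-C * τ)) * (-‖u τ‖ - ε / C)
          + ε / C * Real.exp (C * τ) := by
      rw [div_neg]; ring
    rw [e2, he] at this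
    linarith
  · intro s hs r hr
    have ht : τ - s ∈ Set.Icc 0 T := hmap s ⟨hs.1, hs.2.le⟩
    set t := τ - s with ht_def
    have hφ : ∀ i, |(SignType.sign (u t i) : ℝ)| ≤ 1 := fun i => abs_sign_le_one _
    let P := pairing (fun i => (SignType.sign (u t i) : ℝ)) 1 hφ
    have hPle : ∀ f, P f ≤ ‖f‖ := fun f => by
      have h1 : ‖P f‖ ≤ ‖f‖ := by
        have := (LinearMap.mkContinuous_norm_le _ zero_le_one _ : ‖P‖ ≤ 1)
        simpa using P.le_of_opNorm_le this f
      exact (le_abs_self _).trans h1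
    have hPu : P (u t) = ‖u t‖ := by
      rw [pairing_apply, Ell1.norm_eq]
      congr 1; funext i; exact self_mul_sign _
    have hder : HasDerivWithinAt (fun z => P (u (τ - z))) (-(P (u' t))) (Set.Icc 0 τ) s := by
      have h1 : HasDerivWithinAt (fun z => P (u z)) (P (u' t)) (Set.Icc 0 T) (τ - s) :=
        P.hasFDerivAt.comp_hasDerivWithinAt (τ - s) (hu t ht)
      have h2 : HasDerivWithinAt (fun z : ℝ => τ - z) (-1) (Set.Icc 0 τ) s := by
        simpa using ((hasDerivAt_id s).const_sub τ).hasDerivWithinAt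
      have := h1.scomp s h2 hmap
      rw [neg_one_smul] at this
      exact this
    have hder' := hder.mono_of_mem_nhdsWithin (Icc_mem_nhdsGT_of_mem hs)
    have hlim := (hasDerivWithinAt_iff_tendsto_slope' (by simp)).1 hder'
    have hneg := hlim.neg
    rw [neg_neg] at hneg
    have hev := hneg.eventually (gt_mem_nhds (show P (u' t) < r from hr))
    refine (hev.and self_mem_nhdsWithin).frequently.mono ?_
    rintro z ⟨hz, hzs⟩
    refine lt_of_le_of_lt ?_ hz
    rw [slope_def_field, ← ht_def, hPu, ← neg_div, div_eq_inv_mul]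
    have : (0 : ℝ) ≤ (z - s)⁻¹ := inv_nonneg.2 (sub_nonneg.2 (le_of_lt hzs))
    refine mul_le_mul_of_nonneg_left ?_ this
    linarith [hPle (u (τ - z))]
  · intro s hs
    have := hd (τ - s) (hmap s ⟨hs.1, hs.2.le⟩)
    simp only
    linarith

/-- A function that does not increase while it is above the level `c` stays below `c`. -/
theorem le_of_deriv_nonpos_above {m m' : ℝ → ℝ} {T c : ℝ}
    (hm : ∀ t ∈ Set.Icc 0 T, HasDerivWithinAt m (m' t) (Set.Icc 0 T) t)
    (h0 : m 0 ≤ c) (hd : ∀ t ∈ Set.Icc 0 T, c < m t → m' t ≤ 0) :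
    ∀ t ∈ Set.Icc 0 T, m t ≤ c := by
  intro t ht
  have hcont : ContinuousOn m (Set.Icc 0 T) := fun t ht => (hm t ht).continuousWithinAt
  refine le_of_forall_pos_le_add fun ε hε => ?_
  -- compare with the strictly increasing barrier `c + η (1 + s)`
  obtain ⟨η, hη, hη'⟩ : ∃ η : ℝ, 0 < η ∧ η * (1 + t) ≤ ε :=
    ⟨ε / (1 + t), div_pos hε (by linarith [ht.1]),
      by rw [div_mul_cancel₀ _ (by linarith [ht.1] : 1 + t ≠ 0)]⟩
  have := image_le_of_deriv_right_lt_deriv_boundary (f := m) (f' := m') (a := 0) (b := T)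
    (B := fun s => c + η * (1 + s)) (B' := fun _ => η) hcont
    (fun x hx => (hm x ⟨hx.1, hx.2.le⟩).mono_of_mem_nhdsWithin (Icc_mem_nhdsGE_of_mem hx))
    (by linarith)
    (fun x => by simpa using (((hasDerivAt_id x).const_add 1).const_mul η).const_add c)
    (fun x hx he => by
      have : c < m x := by rw [he]; nlinarith [hx.1]
      linarith [hd x ⟨hx.1, hx.2.le⟩ this]) ht
  linarith

/-! ### Weighted sums -/

/-- Finiteness of `∑ |f_i| i ^ p`. -/
def WSummable (p : ℝ) (f : ℕ+ → ℝ) : Prop := Summable fun i : ℕ+ => |f i| * (i : ℝ) ^ p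

/-- The weighted norm `∑ |f_i| i ^ p`; unlike `moment`, it does not involve the mesh size. -/
def wnorm (p : ℝ) (f : ℕ+ → ℝ) : ℝ := ∑' i : ℕ+, |f i| * (i : ℝ) ^ p

theorem one_le_cast (i : ℕ+) : (1 : ℝ) ≤ (i : ℝ) := by exact_mod_cast one_le

theorem cast_pos (i : ℕ+) : (0 : ℝ) < (i : ℝ) := by exact_mod_cast i.pos

theorem wterm_nonneg (p : ℝ) (f : ℕ+ → ℝ) (i : ℕ+) : 0 ≤ |f i| * (i : ℝ) ^ p := by
  have := cast_pos i
  positivity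

theorem wnorm_nonneg (p : ℝ) (f : ℕ+ → ℝ) : 0 ≤ wnorm p f := tsum_nonneg (wterm_nonneg p f)

theorem WSummable.mono {p q : ℝ} {f : ℕ+ → ℝ} (h : WSummable q f) (hpq : p ≤ q) :
    WSummable p f :=
  Summable.of_nonneg_of_le (wterm_nonneg p f) (fun i => mul_le_mul_of_nonneg_left
    (Real.rpow_le_rpow_of_exponent_le (one_le_cast i) hpq) (abs_nonneg _)) h

theorem wnorm_mono {p q : ℝ} {f : ℕ+ → ℝ} (h : WSummable q f) (hpq : p ≤ q) :
    wnorm p f ≤ wnorm q f :=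
  (h.mono hpq).tsum_le_tsum (fun i => mul_le_mul_of_nonneg_left
    (Real.rpow_le_rpow_of_exponent_le (one_le_cast i) hpq) (abs_nonneg _)) h

theorem wterm_sub_le (p : ℝ) (f g : ℕ+ → ℝ) (i : ℕ+) :
    |(f - g) i| * (i : ℝ) ^ p ≤ |f i| * (i : ℝ) ^ p + |g i| * (i : ℝ) ^ p := by
  rw [← add_mul]
  have := cast_pos i
  exact mul_le_mul_of_nonneg_right (abs_sub _ _) (by positivity)

theorem WSummable.sub {p : ℝ} {f g : ℕ+ → ℝ} (hf : WSummable p f) (hg : WSummable p g) :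
    WSummable p (f - g) :=
  Summable.of_nonneg_of_le (wterm_nonneg p _) (wterm_sub_le p f g) (hf.add hg)

theorem wnorm_sub_le {p : ℝ} {f g : ℕ+ → ℝ} (hf : WSummable p f) (hg : WSummable p g) :
    wnorm p (f - g) ≤ wnorm p f + wnorm p g :=
  ((hf.sub hg).tsum_le_tsum (wterm_sub_le p f g) (hf.add hg)).trans_eq (hf.tsum_add hg)

theorem Ell1.wsummable_zero (f : Ell1) : WSummable 0 f := by
  simpa [WSummable] using f.summable_abs

theorem Ell1.wnorm_zero (f : Ell1) : wnorm 0 f = ‖f‖ := by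
  simp [wnorm, Ell1.norm_eq]

/-- Interpolation: an intermediate weighted norm is controlled by the `ℓ¹` norm and a small
multiple of a norm with a larger weight. -/
theorem wnorm_interpolation {δ κ R : ℝ} (hδ : 0 ≤ δ) (hδκ : δ ≤ κ) (hR : 0 < R) {u : ℕ+ → ℝ}
    (hu : WSummable κ u) :
    wnorm δ u ≤ R ^ δ * wnorm 0 u + R ^ (δ - κ) * wnorm κ u := by
  have h0 : WSummable 0 u := hu.mono (hδ.trans hδκ)
  unfold wnorm
  rw [← tsum_mul_left, ← tsum_mul_left, ← (h0.mul_left _).tsum_add (hu.mul_left _)]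
  refine (hu.mono hδκ).tsum_le_tsum (fun i => ?_) ((h0.mul_left _).add (hu.mul_left _))
  have hi := cast_pos i
  have key : (i : ℝ) ^ δ ≤ R ^ δ + R ^ (δ - κ) * (i : ℝ) ^ κ := by
    rcases le_total (i : ℝ) R with h | h
    · have := Real.rpow_le_rpow hi.le h hδ
      have : 0 ≤ R ^ (δ - κ) * (i : ℝ) ^ κ := by positivity
      linarith
    · have h1 : (i : ℝ) ^ (δ - κ) ≤ R ^ (δ - κ) :=
        Real.rpow_le_rpow_of_nonpos hR h (by linarith)
      have h2 : (i : ℝ) ^ δ = (i : ℝ) ^ (δ - κ) * (i : ℝ) ^ κ := by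
        rw [← Real.rpow_add hi]; ring_nf
      have h3 : (i : ℝ) ^ (δ - κ) * (i : ℝ) ^ κ ≤ R ^ (δ - κ) * (i : ℝ) ^ κ :=
        mul_le_mul_of_nonneg_right h1 (by positivity)
      have : 0 ≤ R ^ δ := by positivity
      linarith
  calc |u i| * (i : ℝ) ^ δ ≤ |u i| * (R ^ δ + R ^ (δ - κ) * (i : ℝ) ^ κ) :=
        mul_le_mul_of_nonneg_left key (abs_nonneg _)
    _ = _ := by rw [Real.rpow_zero]; ring

/-- A lower order weighted norm is absorbed by the damping up to a multiple of the `ℓ¹` norm. -/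
theorem exists_absorption {p δ cd : ℝ} (hp : 0 ≤ p) (hpδ : p < δ) (hcd : 0 < cd) {K : ℝ}
    (hK : 0 ≤ K) :
    ∃ C > 0, ∀ u, WSummable δ u → K * wnorm p u ≤ cd * wnorm δ u + C * wnorm 0 u := by
  set R : ℝ := (K / cd) ^ (1 / (δ - p))
  have hR : 0 ≤ R := by positivity
  refine ⟨K * R ^ p + 1, by positivity, fun u hu => ?_⟩
  have h0 : WSummable 0 u := hu.mono (hp.trans hpδ.le)
  have hup : WSummable p u := hu.mono hpδ.le
  unfold wnorm
  rw [← tsum_mul_left, ← tsum_mul_left, ← tsum_mul_left,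
    ← (hu.mul_left _).tsum_add (h0.mul_left _)]
  refine (hup.mul_left _).tsum_le_tsum (fun i => ?_) ((hu.mul_left _).add (h0.mul_left _))
  have hi := cast_pos i
  have key : K * (i : ℝ) ^ p ≤ cd * (i : ℝ) ^ δ + (K * R ^ p + 1) := by
    rcases le_total (i : ℝ) R with h | h
    · have h1 := mul_le_mul_of_nonneg_left (Real.rpow_le_rpow hi.le h hp) hK
      have : 0 ≤ cd * (i : ℝ) ^ δ := by positivity
      linarith
    · have h1 : K / cd ≤ (i : ℝ) ^ (δ - p) := by
        have h2 := Real.rpow_le_rpow hR h (sub_nonneg.2 hpδ.le)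
        rw [← Real.rpow_mul (by positivity), one_div,
          inv_mul_cancel₀ (sub_pos.2 hpδ).ne', Real.rpow_one] at h2
        exact h2
      rw [div_le_iff₀ hcd] at h1
      have h2 : (i : ℝ) ^ δ = (i : ℝ) ^ (δ - p) * (i : ℝ) ^ p := by
        rw [← Real.rpow_add hi]; ring_nf
      have h3 := mul_le_mul_of_nonneg_right h1 (by positivity : 0 ≤ (i : ℝ) ^ p)
      have : 0 ≤ K * R ^ p := by positivity
      rw [h2]; linarith
  calc K * (|u i| * (i : ℝ) ^ p) = |u i| * (K * (i : ℝ) ^ p) := by ring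
    _ ≤ |u i| * (cd * (i : ℝ) ^ δ + (K * R ^ p + 1)) :=
        mul_le_mul_of_nonneg_left key (abs_nonneg _)
    _ = _ := by rw [Real.rpow_zero]; ring

/-! ### Interaction rates -/

/-- The net rate at which the pair `(i, j)` merges: coagulation of `i` and `j` with the kernel
`k₁`, minus splitting of `i + j` into `i` and `j` induced by a cluster of size `j`, with the
kernel `k₂`. -/
def flux (k₁ k₂ : ℕ+ → ℕ+ → ℝ) (f : ℕ+ → ℝ) (x : ℕ+ × ℕ+) : ℝ :=
  k₁ x.1 x.2 * f x.1 * f x.2 - k₂ x.1 x.2 * f (x.1 + x.2) * f x.2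

/-- Growth conditions on a coagulation kernel `k₁` and a splitting kernel `k₂`. -/
structure KernelBound (c p : ℝ) (k₁ k₂ : ℕ+ → ℕ+ → ℝ) : Prop where
  nonneg₁ : ∀ i j, 0 ≤ k₁ i j
  nonneg₂ : ∀ i j, 0 ≤ k₂ i j
  le₁ : ∀ i j : ℕ+, k₁ i j ≤ c * ((i : ℝ) ^ p * (j : ℝ) ^ p)
  le₂ : ∀ i j : ℕ+, k₂ i j ≤ c * (((i + j : ℕ+) : ℝ) ^ p * (j : ℝ) ^ p)

theorem KernelBound.const_nonneg {c p : ℝ} {k₁ k₂ : ℕ+ → ℕ+ → ℝ} (h : KernelBound c p k₁ k₂) :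
    0 ≤ c := by
  simpa using (h.nonneg₁ 1 1).trans (h.le₁ 1 1)

/-- The kernel cut off to pairs of total size at most `N`. -/
def trunc (N : ℕ) (k : ℕ+ → ℕ+ → ℝ) (i j : ℕ+) : ℝ := if ((i + j : ℕ+) : ℕ) ≤ N then k i j else 0

theorem KernelBound.trunc {c p : ℝ} {k₁ k₂ : ℕ+ → ℕ+ → ℝ} (h : KernelBound c p k₁ k₂) (N : ℕ) :
    KernelBound c p (trunc N k₁) (trunc N k₂) where
  nonneg₁ i j := by unfold CoagFrag.trunc; split_ifs; exacts [h.nonneg₁ i j, le_rfl]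
  nonneg₂ i j := by unfold CoagFrag.trunc; split_ifs; exacts [h.nonneg₂ i j, le_rfl]
  le₁ i j := by
    have := h.const_nonneg
    unfold CoagFrag.trunc; split_ifs; exacts [h.le₁ i j, by positivity]
  le₂ i j := by
    have := h.const_nonneg
    unfold CoagFrag.trunc; split_ifs; exacts [h.le₂ i j, by positivity]

/-- Truncated kernels are bounded. -/
theorem KernelBound.trunc_zero {c p : ℝ} {k₁ k₂ : ℕ+ → ℕ+ → ℝ} (h : KernelBound c p k₁ k₂)
    (hp : 0 ≤ p) (N : ℕ) :
    KernelBound (c * ((N : ℝ) ^ p * (N : ℝ) ^ p)) 0 (CoagFrag.trunc N k₁) (CoagFrag.trunc N k₂) where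
  nonneg₁ := (h.trunc N).nonneg₁
  nonneg₂ := (h.trunc N).nonneg₂
  le₁ i j := by
    have hc := h.const_nonneg
    simp only [Real.rpow_zero, mul_one]
    unfold CoagFrag.trunc; split_ifs with hN
    · refine (h.le₁ i j).trans (mul_le_mul_of_nonneg_left ?_ hc)
      have h1 : (i : ℝ) ≤ N := by rw [PNat.add_coe] at hN; exact_mod_cast by omega
      have h2 : (j : ℝ) ≤ N := by rw [PNat.add_coe] at hN; exact_mod_cast by omega
      gcongr
    · positivity
  le₂ i j := by
    have hc := h.const_nonneg
    simp only [Real.rpow_zero, mul_one]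
    unfold CoagFrag.trunc; split_ifs with hN
    · refine (h.le₂ i j).trans (mul_le_mul_of_nonneg_left ?_ hc)
      have h1 : ((i + j : ℕ+) : ℝ) ≤ N := by exact_mod_cast hN
      have h2 : (j : ℝ) ≤ N := by rw [PNat.add_coe] at hN; exact_mod_cast by omega
      gcongr
    · positivity

theorem summable_prod_mul {a b : ℕ+ → ℝ} (ha : Summable a) (hb : Summable b)
    (ha0 : ∀ i, 0 ≤ a i) (hb0 : ∀ i, 0 ≤ b i) :
    Summable (fun x : ℕ+ × ℕ+ => a x.1 * b x.2) ∧
      ∑' x : ℕ+ × ℕ+, a x.1 * b x.2 = (∑' i, a i) * ∑' i, b i := by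
  have h := ha.mul_of_nonneg hb ha0 hb0
  exact ⟨h, (ha.tsum_mul_tsum hb h).symm⟩

theorem injective_shift : Function.Injective fun x : ℕ+ × ℕ+ => (x.1 + x.2, x.2) := by
  intro x z hab
  have h1 : x.1 + x.2 = z.1 + z.2 := (Prod.ext_iff.1 hab).1
  have h2 : x.2 = z.2 := (Prod.ext_iff.1 hab).2
  rw [h2] at h1
  exact Prod.ext (add_right_cancel h1) h2

theorem summable_shift {F : ℕ+ × ℕ+ → ℝ} (h : Summable F) (h0 : ∀ x, 0 ≤ F x) :
    Summable (fun x : ℕ+ × ℕ+ => F (x.1 + x.2, x.2)) ∧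
      ∑' x : ℕ+ × ℕ+, F (x.1 + x.2, x.2) ≤ ∑' x, F x := by
  have hs := h.comp_injective injective_shift
  exact ⟨hs, hs.tsum_le_tsum_of_inj _ injective_shift (fun x _ => h0 x) (fun _ => le_rfl) h⟩

theorem summable_shift_mul {a b : ℕ+ → ℝ} (ha : Summable a) (hb : Summable b)
    (ha0 : ∀ i, 0 ≤ a i) (hb0 : ∀ i, 0 ≤ b i) :
    Summable (fun x : ℕ+ × ℕ+ => a (x.1 + x.2) * b x.2) ∧
      ∑' x : ℕ+ × ℕ+, a (x.1 + x.2) * b x.2 ≤ (∑' i, a i) * ∑' i, b i := by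
  obtain ⟨h, e⟩ := summable_prod_mul ha hb ha0 hb0
  have hs := summable_shift h fun x => mul_nonneg (ha0 x.1) (hb0 x.2)
  rw [e] at hs
  exact hs

/-- The bilinear estimate that underlies all bounds on the interaction rates. -/
theorem flux_bilinear_bound {c p : ℝ} {a b : ℕ+ → ℝ} (hc : 0 ≤ c)
    (ha : WSummable p a) (hb : WSummable p b) :
    Summable (fun x : ℕ+ × ℕ+ =>
      c * ((|a x.1| * (x.1 : ℝ) ^ p) * (|b x.2| * (x.2 : ℝ) ^ p))
      + c * ((|a (x.1 + x.2)| * ((x.1 + x.2 : ℕ+) : ℝ) ^ p) * (|b x.2| * (x.2 : ℝ) ^ p))) ∧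
    ∑' x : ℕ+ × ℕ+,
      (c * ((|a x.1| * (x.1 : ℝ) ^ p) * (|b x.2| * (x.2 : ℝ) ^ p))
      + c * ((|a (x.1 + x.2)| * ((x.1 + x.2 : ℕ+) : ℝ) ^ p) * (|b x.2| * (x.2 : ℝ) ^ p)))
      ≤ 2 * c * (wnorm p a * wnorm p b) := by
  obtain ⟨h1, e1⟩ := summable_prod_mul ha hb (wterm_nonneg p a) (wterm_nonneg p b)
  obtain ⟨h2, e2⟩ := summable_shift_mul ha hb (wterm_nonneg p a) (wterm_nonneg p b)
  refine ⟨(h1.mul_left c).add (h2.mul_left c), ?_⟩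
  rw [(h1.mul_left c).tsum_add (h2.mul_left c), tsum_mul_left, tsum_mul_left, e1]
  have := mul_le_mul_of_nonneg_left e2 hc
  unfold wnorm
  linarith

/-- The flux is quadratic; both differences of products are expanded as
`a b - a' b' = (a - a') b + a' (b - b')`. -/
theorem abs_flux_sub_le {c p : ℝ} {k₁ k₂ : ℕ+ → ℕ+ → ℝ} (hk : KernelBound c p k₁ k₂)
    (f g : ℕ+ → ℝ) (x : ℕ+ × ℕ+) :
    |flux k₁ k₂ f x - flux k₁ k₂ g x| ≤
      (c * ((|(f - g) x.1| * (x.1 : ℝ) ^ p) * (|f x.2| * (x.2 : ℝ) ^ p))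
      + c * ((|(f - g) (x.1 + x.2)| * ((x.1 + x.2 : ℕ+) : ℝ) ^ p) * (|f x.2| * (x.2 : ℝ) ^ p)))
      + (c * ((|g x.1| * (x.1 : ℝ) ^ p) * (|(f - g) x.2| * (x.2 : ℝ) ^ p))
      + c * ((|g (x.1 + x.2)| * ((x.1 + x.2 : ℕ+) : ℝ) ^ p) * (|(f - g) x.2| * (x.2 : ℝ) ^ p))) := by
  have h1 := mul_le_mul_of_nonneg_right (hk.le₁ x.1 x.2)
    (by positivity : 0 ≤ |(f - g) x.1| * |f x.2| + |g x.1| * |(f - g) x.2|)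
  have h2 := mul_le_mul_of_nonneg_right (hk.le₂ x.1 x.2)
    (by positivity : 0 ≤ |(f - g) (x.1 + x.2)| * |f x.2| + |g (x.1 + x.2)| * |(f - g) x.2|)
  have e : flux k₁ k₂ f x - flux k₁ k₂ g x
      = k₁ x.1 x.2 * ((f - g) x.1 * f x.2 + g x.1 * (f - g) x.2)
        - k₂ x.1 x.2 * ((f - g) (x.1 + x.2) * f x.2 + g (x.1 + x.2) * (f - g) x.2) := by
    simp only [flux, Pi.sub_apply]; ring
  have h3 : |k₁ x.1 x.2 * ((f - g) x.1 * f x.2 + g x.1 * (f - g) x.2)|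
      ≤ k₁ x.1 x.2 * (|(f - g) x.1| * |f x.2| + |g x.1| * |(f - g) x.2|) := by
    rw [abs_mul, abs_of_nonneg (hk.nonneg₁ _ _)]
    refine mul_le_mul_of_nonneg_left ((abs_add_le _ _).trans ?_) (hk.nonneg₁ _ _)
    rw [abs_mul, abs_mul]
  have h4 : |k₂ x.1 x.2 * ((f - g) (x.1 + x.2) * f x.2 + g (x.1 + x.2) * (f - g) x.2)|
      ≤ k₂ x.1 x.2 *
        (|(f - g) (x.1 + x.2)| * |f x.2| + |g (x.1 + x.2)| * |(f - g) x.2|) := by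
    rw [abs_mul, abs_of_nonneg (hk.nonneg₂ _ _)]
    refine mul_le_mul_of_nonneg_left ((abs_add_le _ _).trans ?_) (hk.nonneg₂ _ _)
    rw [abs_mul, abs_mul]
  rw [e]
  refine (abs_sub _ _).trans ((add_le_add (h3.trans h1) (h4.trans h2)).trans_eq ?_)
  ring

theorem flux_sub_bound {c p : ℝ} {k₁ k₂ : ℕ+ → ℕ+ → ℝ} (hk : KernelBound c p k₁ k₂)
    {f g : ℕ+ → ℝ} (hf : WSummable p f) (hg : WSummable p g) :
    Summable (fun x => |flux k₁ k₂ f x - flux k₁ k₂ g x|) ∧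
      ∑' x, |flux k₁ k₂ f x - flux k₁ k₂ g x|
        ≤ 2 * c * (wnorm p f + wnorm p g) * wnorm p (f - g) := by
  obtain ⟨s1, e1⟩ := flux_bilinear_bound hk.const_nonneg (hf.sub hg) hf
  obtain ⟨s2, e2⟩ := flux_bilinear_bound hk.const_nonneg hg (hf.sub hg)
  have hle := abs_flux_sub_le hk f g
  have hs := Summable.of_nonneg_of_le (fun x => abs_nonneg _) hle (s1.add s2)
  refine ⟨hs, (hs.tsum_le_tsum hle (s1.add s2)).trans ?_⟩
  rw [s1.tsum_add s2]
  linarith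

theorem summable_flux {c p : ℝ} {k₁ k₂ : ℕ+ → ℕ+ → ℝ} (hk : KernelBound c p k₁ k₂)
    {f : ℕ+ → ℝ} (hf : WSummable p f) : Summable (flux k₁ k₂ f) := by
  have h0 : WSummable p 0 := by simp [WSummable]
  have := (flux_sub_bound hk hf h0).1
  have e : flux k₁ k₂ f = fun x => flux k₁ k₂ f x - flux k₁ k₂ 0 x := by
    funext x; simp [flux]
  rw [e]
  exact this.of_abs

/-- The error made by cutting off the kernels is small if a higher weighted norm is bounded. -/
theorem flux_trunc_bound {c p δ : ℝ} {k₁ k₂ : ℕ+ → ℕ+ → ℝ} (hk : KernelBound c p k₁ k₂)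
    (hpδ : p ≤ δ) {f : ℕ+ → ℝ} (hf : WSummable δ f) {N : ℕ} (hN : 0 < N) :
    ∑' x, |flux k₁ k₂ f x - flux (trunc N k₁) (trunc N k₂) f x|
        ≤ 2 * c * (2 / N) ^ (δ - p) * wnorm δ f ^ 2 := by
  have hc := hk.const_nonneg
  have hN' : (0 : ℝ) < N := by exact_mod_cast hN
  have hε : 0 ≤ c * (2 / N : ℝ) ^ (δ - p) := by positivity
  obtain ⟨s, e⟩ := flux_bilinear_bound hε hf hf
  have hle : ∀ x : ℕ+ × ℕ+, |flux k₁ k₂ f x - flux (trunc N k₁) (trunc N k₂) f x| ≤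
      c * (2 / N : ℝ) ^ (δ - p) * ((|f x.1| * (x.1 : ℝ) ^ δ) * (|f x.2| * (x.2 : ℝ) ^ δ))
      + c * (2 / N : ℝ) ^ (δ - p) * ((|f (x.1 + x.2)| * ((x.1 + x.2 : ℕ+) : ℝ) ^ δ)
        * (|f x.2| * (x.2 : ℝ) ^ δ)) := by
    rintro ⟨i, j⟩
    have hi := one_le_cast i
    have hj := one_le_cast j
    have hi0 := cast_pos i
    have hj0 := cast_pos j
    have hij0 := cast_pos (i + j)
    simp only [flux, trunc]
    split_ifs with h
    · simp only [sub_self, abs_zero]; positivity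
    · have hlt : (N : ℝ) ≤ i + j := by
        rw [PNat.add_coe] at h; exact_mod_cast (by omega : N ≤ (i : ℕ) + j)
      have ecast : ((i + j : ℕ+) : ℝ) = i + j := by rw [PNat.add_coe]; push_cast; rfl
      have split : ∀ x : ℝ, 0 < x → x ^ δ = x ^ (δ - p) * x ^ p := fun x hx => by
        rw [← Real.rpow_add hx]; ring_nf
      have hd : 0 ≤ δ - p := by linarith
      -- `i + j ≤ 2 i j`, so that `1 ≤ (2 / N) i j` outside the cut-off region
      have g1 : (i : ℝ) ^ p * (j : ℝ) ^ p
          ≤ (2 / N : ℝ) ^ (δ - p) * ((i : ℝ) ^ δ * (j : ℝ) ^ δ) := by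
        have h1 : (1 : ℝ) ≤ (2 / N) * (i * j) := by
          rw [div_mul_eq_mul_div, le_div_iff₀ hN']; nlinarith
        have h2 := Real.one_le_rpow h1 hd
        rw [Real.mul_rpow (by positivity) (by positivity), Real.mul_rpow hi0.le hj0.le] at h2
        have h3 := mul_le_mul_of_nonneg_right h2 (by positivity : 0 ≤ (i : ℝ) ^ p * (j : ℝ) ^ p)
        rw [one_mul] at h3
        refine h3.trans_eq ?_
        rw [split _ hi0, split _ hj0]; ring
      have g2 : ((i + j : ℕ+) : ℝ) ^ p * (j : ℝ) ^ p
          ≤ (2 / N : ℝ) ^ (δ - p) * (((i + j : ℕ+) : ℝ) ^ δ * (j : ℝ) ^ δ) := by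
        have h1 : (1 : ℝ) ≤ (2 / N) * (((i + j : ℕ+) : ℝ) * j) := by
          rw [div_mul_eq_mul_div, le_div_iff₀ hN', ecast]; nlinarith
        have h2 := Real.one_le_rpow h1 hd
        rw [Real.mul_rpow (by positivity) (by positivity), Real.mul_rpow hij0.le hj0.le] at h2
        have h3 := mul_le_mul_of_nonneg_right h2
          (by positivity : 0 ≤ ((i + j : ℕ+) : ℝ) ^ p * (j : ℝ) ^ p)
        rw [one_mul] at h3
        refine h3.trans_eq ?_
        rw [split _ hij0, split _ hj0]; ring
      have h3 : |k₁ i j * f i * f j|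
          ≤ c * (2 / N : ℝ) ^ (δ - p) * ((|f i| * (i : ℝ) ^ δ) * (|f j| * (j : ℝ) ^ δ)) := by
        rw [abs_mul, abs_mul, abs_of_nonneg (hk.nonneg₁ _ _)]
        have := (hk.le₁ i j).trans (mul_le_mul_of_nonneg_left g1 hc)
        calc k₁ i j * |f i| * |f j| = k₁ i j * (|f i| * |f j|) := by ring
          _ ≤ _ := mul_le_mul_of_nonneg_right this (by positivity)
          _ = _ := by ring
      have h4 : |k₂ i j * f (i + j) * f j| ≤ c * (2 / N : ℝ) ^ (δ - p) *
          ((|f (i + j)| * ((i + j : ℕ+) : ℝ) ^ δ) * (|f j| * (j : ℝ) ^ δ)) := by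
        rw [abs_mul, abs_mul, abs_of_nonneg (hk.nonneg₂ _ _)]
        have := (hk.le₂ i j).trans (mul_le_mul_of_nonneg_left g2 hc)
        calc k₂ i j * |f (i + j)| * |f j| = k₂ i j * (|f (i + j)| * |f j|) := by ring
          _ ≤ _ := mul_le_mul_of_nonneg_right this (by positivity)
          _ = _ := by ring
      simp only [zero_mul, sub_zero]
      exact (abs_sub _ _).trans (add_le_add h3 h4)
  have hs := Summable.of_nonneg_of_le (fun x => abs_nonneg _) hle s
  refine (hs.tsum_le_tsum hle s).trans (e.trans_eq ?_)
  ring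

/-! ### The full operator and its continuity -/

/-- Difference of two right-hand sides, in terms of the fluxes. -/
theorem damped_sub_bound {A B : ℕ+ × ℕ+ → ℝ} (hA : Summable A) (hB : Summable B) {δ cd : ℝ}
    (hcd : 0 ≤ cd) {f g : ℕ+ → ℝ} (hu : WSummable δ (f - g)) :
    Summable (fun i : ℕ+ => |(transfer A i - cd * (i : ℝ) ^ δ * f i)
        - (transfer B i - cd * (i : ℝ) ^ δ * g i)|) ∧
      ∑' i : ℕ+, |(transfer A i - cd * (i : ℝ) ^ δ * f i)
        - (transfer B i - cd * (i : ℝ) ^ δ * g i)|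
        ≤ 3 * ∑' x, |A x - B x| + cd * wnorm δ (f - g) := by
  obtain ⟨s, e⟩ := hasSum_abs_transfer (hA.sub hB)
  have hle : ∀ i : ℕ+, |(transfer A i - cd * (i : ℝ) ^ δ * f i)
        - (transfer B i - cd * (i : ℝ) ^ δ * g i)|
      ≤ |transfer (fun x => A x - B x) i| + cd * (|(f - g) i| * (i : ℝ) ^ δ) := fun i => by
    have e : (transfer A i - cd * (i : ℝ) ^ δ * f i) - (transfer B i - cd * (i : ℝ) ^ δ * g i)
        = transfer (fun x => A x - B x) i - cd * ((f - g) i * (i : ℝ) ^ δ) := by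
      rw [← transfer_sub hA hB, Pi.sub_apply]; ring
    rw [e]
    refine (abs_sub _ _).trans_eq ?_
    rw [abs_mul, abs_mul, abs_of_nonneg hcd,
      abs_of_nonneg (by have := cast_pos i; positivity : 0 ≤ (i : ℝ) ^ δ)]
  have hs := Summable.of_nonneg_of_le (fun i => abs_nonneg _) hle (s.add (hu.mul_left cd))
  refine ⟨hs, (hs.tsum_le_tsum hle (s.add (hu.mul_left cd))).trans ?_⟩
  rw [s.tsum_add (hu.mul_left cd), tsum_mul_left]
  exact add_le_add e le_rfl

/-- One-sided version of the bound on the difference of two right-hand sides, in which the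
damping has a favourable sign. -/
theorem damped_sub_dissipative {A B : ℕ+ × ℕ+ → ℝ} (hA : Summable A) (hB : Summable B) {δ cd : ℝ}
    (hcd : 0 ≤ cd) {f g : ℕ+ → ℝ} (hu : WSummable δ (f - g)) :
      ∑' i : ℕ+, ((transfer A i - cd * (i : ℝ) ^ δ * f i)
        - (transfer B i - cd * (i : ℝ) ^ δ * g i)) * ((SignType.sign (f i - g i) : SignType) : ℝ)
        ≤ 3 * ∑' x, |A x - B x| - cd * wnorm δ (f - g) := by
  obtain ⟨s, e⟩ := hasSum_abs_transfer (hA.sub hB)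
  have hle : ∀ i : ℕ+, ((transfer A i - cd * (i : ℝ) ^ δ * f i)
        - (transfer B i - cd * (i : ℝ) ^ δ * g i)) * ((SignType.sign (f i - g i) : SignType) : ℝ)
      ≤ |transfer (fun x => A x - B x) i| - cd * (|(f - g) i| * (i : ℝ) ^ δ) := fun i => by
    have e : ((transfer A i - cd * (i : ℝ) ^ δ * f i) - (transfer B i - cd * (i : ℝ) ^ δ * g i))
          * ((SignType.sign (f i - g i) : SignType) : ℝ)
        = transfer (fun x => A x - B x) i * ((SignType.sign (f i - g i) : SignType) : ℝ)
          - cd * (((f - g) i * ((SignType.sign ((f - g) i) : SignType) : ℝ)) * (i : ℝ) ^ δ) := by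
      rw [← transfer_sub hA hB, Pi.sub_apply]; ring
    rw [e, self_mul_sign]
    refine sub_le_sub_right ((le_abs_self _).trans ?_) _
    rw [abs_mul]
    exact mul_le_of_le_one_right (abs_nonneg _) (abs_sign_le_one _)
  have hs : Summable fun i : ℕ+ => ((transfer A i - cd * (i : ℝ) ^ δ * f i)
        - (transfer B i - cd * (i : ℝ) ^ δ * g i))
          * ((SignType.sign (f i - g i) : SignType) : ℝ) :=
    summable_mul_of_bounded (damped_sub_bound hA hB hcd hu).1.of_abs fun i => abs_sign_le_one _
  refine (hs.tsum_le_tsum hle (s.sub (hu.mul_left cd))).trans ?_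
  rw [s.tsum_sub (hu.mul_left cd), tsum_mul_left]
  exact sub_le_sub_right e _

/-! ### A priori bound from the size of the right-hand side -/

/-- The subadditive test function `min (i / N) 1`. -/
def cutoff (N : ℕ) (i : ℕ+) : ℝ := min ((i : ℝ) / N) 1

theorem cutoff_nonneg (N : ℕ) (i : ℕ+) : 0 ≤ cutoff N i :=
  le_min (by have := cast_pos i; positivity) zero_le_one

theorem cutoff_le_one (N : ℕ) (i : ℕ+) : cutoff N i ≤ 1 := min_le_right _ _

theorem abs_cutoff_le (N : ℕ) (i : ℕ+) : |cutoff N i| ≤ 1 := by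
  rw [abs_of_nonneg (cutoff_nonneg N i)]; exact cutoff_le_one N i

theorem cutoff_of_le {N : ℕ} (hN : 0 < N) {i : ℕ+} (h : (i : ℕ) ≤ N) : cutoff N i = (i : ℝ) / N :=
  min_eq_left (by
    have : (0 : ℝ) < N := by exact_mod_cast hN
    rw [div_le_one this]; exact_mod_cast h)

theorem cutoff_of_ge {N : ℕ} (hN : 0 < N) {i : ℕ+} (h : N ≤ (i : ℕ)) : cutoff N i = 1 :=
  min_eq_right (by
    have : (0 : ℝ) < N := by exact_mod_cast hN
    rw [one_le_div this]; exact_mod_cast h)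

theorem cutoff_add_le (N : ℕ) (i j : ℕ+) : cutoff N (i + j) ≤ cutoff N i + cutoff N j := by
  have h1 := cutoff_nonneg N i
  have h2 := cutoff_nonneg N j
  have e : ((i + j : ℕ+) : ℝ) / N = (i : ℝ) / N + (j : ℝ) / N := by
    rw [PNat.add_coe]; push_cast; ring
  unfold cutoff at *
  rw [e]
  rcases le_total ((i : ℝ) / N) 1 with hi | hi
  · rcases le_total ((j : ℝ) / N) 1 with hj | hj
    · rw [min_eq_left hi, min_eq_left hj]; exact min_le_left _ _
    · rw [min_eq_right hj]; exact (min_le_right _ _).trans (by linarith)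
  · rw [min_eq_right hi]; exact (min_le_right _ _).trans (by linarith)

theorem tsum_cutoff_tendsto {D : ℕ+ → ℝ} (hD : Summable D) :
    Filter.Tendsto (fun N : ℕ => ∑' i, cutoff N i * D i) Filter.atTop (nhds 0) := by
  have : Filter.Tendsto (fun N : ℕ => ∑' i, cutoff N i * D i) Filter.atTop
      (nhds (∑' _ : ℕ+, (0 : ℝ))) := by
    refine tendsto_tsum_of_dominated_convergence hD.abs (fun i => ?_)
      (Filter.Eventually.of_forall fun N i => ?_)
    · have h1 : Filter.Tendsto (fun N : ℕ => (i : ℝ) / N) Filter.atTop (nhds 0) :=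
        tendsto_const_nhds.div_atTop tendsto_natCast_atTop_atTop
      have h2 : Filter.Tendsto (fun N : ℕ => cutoff N i) Filter.atTop (nhds (min 0 1)) :=
        h1.min tendsto_const_nhds
      simpa using h2.mul_const (D i)
    · rw [Real.norm_eq_abs, abs_mul]
      exact mul_le_of_le_one_left (abs_nonneg _) (abs_cutoff_le N i)
  simpa using this

/-- Testing with `cutoff N`: coagulation contributes a loss because the test function is
subadditive, and only clusters larger than `N` contribute to the splitting term. -/
theorem cutoff_inequality {c p δ cd C : ℝ} (hpδ : p < δ) (hcd : 0 < cd)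
    {k₁ k₂ : ℕ+ → ℕ+ → ℝ} (hk : KernelBound c p k₁ k₂) {f : ℕ+ → ℝ} (hf : ∀ i, 0 ≤ f i)
    (hfp : WSummable p f) (hfδ : WSummable δ f)
    (hO : Summable fun i : ℕ+ => |transfer (flux k₁ k₂ f) i - cd * (i : ℝ) ^ δ * f i|)
    (hOC : ∑' i : ℕ+, |transfer (flux k₁ k₂ f) i - cd * (i : ℝ) ^ δ * f i| ≤ C)
    {N : ℕ} (hN : 0 < N) :
    ∑' i, cutoff N i * (cd * (i : ℝ) ^ δ * f i) ≤ C + c / cd ^ 2 * (N : ℝ) ^ (p - δ)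
      * (∑' i, cutoff (N + 1) i * (cd * (i : ℝ) ^ δ * f i))
      * ∑' i, cutoff N i * (cd * (i : ℝ) ^ δ * f i) := by
  set D : ℕ+ → ℝ := fun i => cd * (i : ℝ) ^ δ * f i with hD
  have hD0 : ∀ i, 0 ≤ D i := fun i => by
    have := cast_pos i; have := hf i; simp only [hD]; positivity
  have hDs : Summable D := by
    have := hfδ.mul_left cd
    refine this.congr fun i => ?_
    simp only [hD]; rw [abs_of_nonneg (hf i)]; ring
  have hcut : ∀ M, Summable fun i => cutoff M i * D i := fun M =>
    Summable.of_nonneg_of_le (fun i => mul_nonneg (cutoff_nonneg M i) (hD0 i))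
      (fun i => mul_le_of_le_one_left (hD0 i) (cutoff_le_one M i)) hDs
  have hc := hk.const_nonneg
  have hN' : (0 : ℝ) < N := by exact_mod_cast hN
  have hflux := summable_flux hk hfp
  have hw := hasSum_mul_transfer_of_bounded hflux (abs_cutoff_le N)
  let a : ℕ+ → ℝ := fun m => if N < (m : ℕ) then f m * (m : ℝ) ^ p else 0
  let b : ℕ+ → ℝ := fun j => cutoff N j * (f j * (j : ℝ) ^ p)
  have ha0 : ∀ m, 0 ≤ a m := fun m => by
    have := cast_pos m; have := hf m; simp only [a]; split_ifs <;> positivity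
  have hb0 : ∀ m, 0 ≤ b m := fun m => by
    have := cast_pos m; have := hf m; have := cutoff_nonneg N m; simp only [b]; positivity
  have ha : ∀ m, a m ≤ (N : ℝ) ^ (p - δ) / cd * (cutoff (N + 1) m * D m) := fun m => by
    have hm := cast_pos m
    have h0 := hf m
    have h1 := cutoff_nonneg (N + 1) m
    simp only [a]
    split_ifs with h
    · rw [cutoff_of_ge (Nat.succ_pos N) h]
      have hNm : (N : ℝ) ≤ m := by exact_mod_cast h.le
      have h2 : (m : ℝ) ^ (p - δ) ≤ (N : ℝ) ^ (p - δ) :=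
        Real.rpow_le_rpow_of_nonpos hN' hNm (by linarith)
      have h3 : (m : ℝ) ^ p = (m : ℝ) ^ (p - δ) * (m : ℝ) ^ δ := by
        rw [← Real.rpow_add hm]; ring_nf
      have e : (N : ℝ) ^ (p - δ) / cd * (1 * D m) = f m * ((N : ℝ) ^ (p - δ) * (m : ℝ) ^ δ) := by
        simp only [hD]; field_simp
      rw [e, h3]
      gcongr
    · have := hD0 m; positivity
  have hb : ∀ m, b m ≤ 1 / cd * (cutoff N m * D m) := fun m => by
    have hm := cast_pos m
    have h0 := hf m
    have h1 := cutoff_nonneg N m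
    have e : 1 / cd * (cutoff N m * D m) = cutoff N m * (f m * (m : ℝ) ^ δ) := by
      simp only [hD]; field_simp
    rw [e]
    have := Real.rpow_le_rpow_of_exponent_le (one_le_cast m) hpδ.le
    simp only [b]
    gcongr
  have has : Summable a := Summable.of_nonneg_of_le ha0 ha ((hcut _).mul_left _)
  have hbs : Summable b := Summable.of_nonneg_of_le hb0 hb ((hcut _).mul_left _)
  have hA : ∑' m, a m ≤ (N : ℝ) ^ (p - δ) / cd * ∑' i, cutoff (N + 1) i * D i := by
    rw [← tsum_mul_left]; exact has.tsum_le_tsum ha ((hcut _).mul_left _)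
  have hB : ∑' m, b m ≤ 1 / cd * ∑' i, cutoff N i * D i := by
    rw [← tsum_mul_left]; exact hbs.tsum_le_tsum hb ((hcut _).mul_left _)
  obtain ⟨sab, eab⟩ := summable_shift_mul has hbs ha0 hb0
  have hpt : ∀ x : ℕ+ × ℕ+, flux k₁ k₂ f x
      * (cutoff N (x.1 + x.2) - cutoff N x.1 - cutoff N x.2) ≤ c * (a (x.1 + x.2) * b x.2) := by
    rintro ⟨i, j⟩
    have hfi := hf i
    have hfj := hf j
    have hfij := hf (i + j)
    have hci := cutoff_nonneg N i
    have hcj := cutoff_nonneg N j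
    have hij := cast_pos (i + j)
    have hj := cast_pos j
    have hsub := cutoff_add_le N i j
    have h1 : 0 ≤ k₁ i j * f i * f j := by have := hk.nonneg₁ i j; positivity
    have h2 : 0 ≤ k₂ i j * f (i + j) * f j := by have := hk.nonneg₂ i j; positivity
    simp only [flux]
    have h3 := mul_nonneg h1 (sub_nonneg.2 hsub)
    suffices h4 : k₂ i j * f (i + j) * f j * (cutoff N i + cutoff N j - cutoff N (i + j))
        ≤ c * (a (i + j) * b j) by linarith
    by_cases h : N < ((i + j : ℕ+) : ℕ)
    · have e1 : cutoff N (i + j) = 1 := cutoff_of_ge hN h.le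
      have h5 : cutoff N i + cutoff N j - cutoff N (i + j) ≤ cutoff N j := by
        linarith [cutoff_le_one N i]
      have h6 := mul_le_mul_of_nonneg_left h5 h2
      refine h6.trans ?_
      simp only [a, b, if_pos h]
      have h7 := mul_le_mul_of_nonneg_right (hk.le₂ i j)
        (by positivity : 0 ≤ f (i + j) * f j * cutoff N j)
      calc k₂ i j * f (i + j) * f j * cutoff N j = k₂ i j * (f (i + j) * f j * cutoff N j) := by
            ring
        _ ≤ _ := h7
        _ = _ := by ring
    · have h' : ((i + j : ℕ+) : ℕ) ≤ N := not_lt.1 h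
      have hle := h'
      rw [PNat.add_coe] at hle
      have e : cutoff N i + cutoff N j - cutoff N (i + j) = 0 := by
        rw [cutoff_of_le hN h', cutoff_of_le hN (by omega : (i : ℕ) ≤ N),
          cutoff_of_le hN (by omega : (j : ℕ) ≤ N), PNat.add_coe]
        push_cast; ring
      rw [e, mul_zero]
      have := mul_nonneg (ha0 (i + j)) (hb0 j)
      positivity
  have hT : ∑' i, cutoff N i * transfer (flux k₁ k₂ f) i
      ≤ c * ((∑' m, a m) * ∑' m, b m) := by
    rw [hw.tsum_eq]
    have hs : Summable fun x : ℕ+ × ℕ+ => flux k₁ k₂ f x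
        * (cutoff N (x.1 + x.2) - cutoff N x.1 - cutoff N x.2) :=
      summable_mul_of_bounded (b := 3) hflux fun x => by
        have h1 := abs_le.1 (abs_cutoff_le N (x.1 + x.2))
        have h2 := abs_le.1 (abs_cutoff_le N x.1)
        have h3 := abs_le.1 (abs_cutoff_le N x.2)
        rw [abs_le]; constructor <;> linarith
    refine (hs.tsum_le_tsum hpt (sab.mul_left c)).trans ?_
    rw [tsum_mul_left]
    exact mul_le_mul_of_nonneg_left eab hc
  have hsO : Summable fun i => cutoff N i * (transfer (flux k₁ k₂ f) i - D i) := by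
    refine (summable_mul_of_bounded hO.of_abs (abs_cutoff_le N)).congr fun i => mul_comm _ _
  have hOb : -∑' i, cutoff N i * (transfer (flux k₁ k₂ f) i - D i) ≤ C := by
    rw [← tsum_neg]
    refine (hsO.neg.tsum_le_tsum (fun i => ?_) hO).trans hOC
    refine (neg_le_abs _).trans ?_
    rw [abs_mul]
    exact mul_le_of_le_one_left (abs_nonneg _) (abs_cutoff_le N i)
  have hsplit : ∑' i, cutoff N i * D i = ∑' i, cutoff N i * transfer (flux k₁ k₂ f) i
      - ∑' i, cutoff N i * (transfer (flux k₁ k₂ f) i - D i) := by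
    rw [← hw.summable.tsum_sub hsO]
    exact tsum_congr fun i => by ring
  have hH0 : 0 ≤ ∑' i, cutoff (N + 1) i * D i :=
    tsum_nonneg fun i => mul_nonneg (cutoff_nonneg _ i) (hD0 i)
  have hAB := mul_le_mul hA hB (tsum_nonneg hb0) (by positivity)
  have hAB' := mul_le_mul_of_nonneg_left hAB hc
  have e : c * ((N : ℝ) ^ (p - δ) / cd * (∑' i, cutoff (N + 1) i * D i)
      * (1 / cd * ∑' i, cutoff N i * D i)) = c / cd ^ 2 * (N : ℝ) ^ (p - δ)
      * (∑' i, cutoff (N + 1) i * D i) * ∑' i, cutoff N i * D i := by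
    field_simp
  rw [e] at hAB'
  linarith

/-- A nonnegative sequence with a finite weighted norm of lower order, at which the right-hand
side is bounded by `C` in `ℓ¹`, has a weighted norm of the order of the damping bounded in terms of
`C`. This rules out mass entering from infinitely large clusters. -/
theorem exists_wnorm_bound {c p δ cd C : ℝ} (hpδ : p < δ) (hcd : 0 < cd) (hC : 0 < C)
    {k₁ k₂ : ℕ+ → ℕ+ → ℝ} (hk : KernelBound c p k₁ k₂) :
    ∃ B, ∀ f : ℕ+ → ℝ, (∀ i, 0 ≤ f i) → WSummable p f →
      (Summable fun i : ℕ+ => |transfer (flux k₁ k₂ f) i - cd * (i : ℝ) ^ δ * f i|) →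
      ∑' i : ℕ+, |transfer (flux k₁ k₂ f) i - cd * (i : ℝ) ^ δ * f i| ≤ C →
      WSummable δ f ∧ wnorm δ f ≤ B := by
  have hc := hk.const_nonneg
  have hlim : Filter.Tendsto (fun N : ℕ => c / cd ^ 2 * (N : ℝ) ^ (p - δ) * (2 * C)) Filter.atTop
      (nhds 0) := by
    have h1 := (tendsto_rpow_neg_atTop (sub_pos.2 hpδ)).comp (tendsto_natCast_atTop_atTop (R := ℝ))
    have h2 := (h1.const_mul (c / cd ^ 2)).mul_const (2 * C)
    simpa using h2
  obtain ⟨N₀, hN₀⟩ := Filter.eventually_atTop.1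
    (hlim.eventually (gt_mem_nhds (by norm_num : (0 : ℝ) < 1 / 2)))
  refine ⟨(N₀ + 1 : ℕ) * (2 * C) / cd, fun f hf hfp hO hOC => ?_⟩
  have hfδ : WSummable δ f := by
    have hT := (hasSum_abs_transfer (summable_flux hk hfp)).1.of_abs
    have := (hT.sub hO.of_abs).mul_left cd⁻¹
    refine this.congr fun i => ?_
    rw [abs_of_nonneg (hf i)]
    field_simp
    ring
  refine ⟨hfδ, ?_⟩
  set D : ℕ+ → ℝ := fun i => cd * (i : ℝ) ^ δ * f i with hD
  have hD0 : ∀ i, 0 ≤ D i := fun i => by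
    have := cast_pos i; have := hf i; simp only [hD]; positivity
  have hDs : Summable D := by
    have := hfδ.mul_left cd
    refine this.congr fun i => ?_
    simp only [hD]; rw [abs_of_nonneg (hf i)]; ring
  set H : ℕ → ℝ := fun N => ∑' i, cutoff N i * D i with hH
  have hH0 : ∀ N, 0 ≤ H N := fun N => tsum_nonneg fun i => mul_nonneg (cutoff_nonneg _ i) (hD0 i)
  obtain ⟨N₁, hN₁⟩ := Filter.eventually_atTop.1
    ((tsum_cutoff_tendsto hDs).eventually (gt_mem_nhds (by linarith : (0 : ℝ) < 2 * C)))
  -- downward induction: the bound `2 C` holds for large `N` and passes from `N + 1` to `N ≥ N₀`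
  have hind : ∀ n : ℕ, ∀ N, N₀ + 1 ≤ N → N₁ ≤ N + n → H N ≤ 2 * C := by
    intro n
    induction n with
    | zero => exact fun N _ h => (hN₁ N h).le
    | succ n ih =>
      intro N hN h
      have h1 := ih (N + 1) (by omega) (by omega)
      have h2 := cutoff_inequality hpδ hcd hk hf hfp hfδ hO hOC (by omega : 0 < N)
      have h3 := hN₀ N (by omega)
      change H N ≤ C + c / cd ^ 2 * (N : ℝ) ^ (p - δ) * H (N + 1) * H N at h2
      have h4 : c / cd ^ 2 * (N : ℝ) ^ (p - δ) * H (N + 1) ≤ 1 / 2 :=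
        (mul_le_mul_of_nonneg_left h1 (by positivity)).trans h3.le
      have h5 := mul_le_mul_of_nonneg_right h4 (hH0 N)
      linarith
  have hfin := hind N₁ (N₀ + 1) le_rfl (by omega)
  have hN : (0 : ℝ) < (N₀ + 1 : ℕ) := by positivity
  have hcut : Summable fun i => cutoff (N₀ + 1) i * D i :=
    Summable.of_nonneg_of_le (fun i => mul_nonneg (cutoff_nonneg _ i) (hD0 i))
      (fun i => mul_le_of_le_one_left (hD0 i) (cutoff_le_one _ i)) hDs
  have hle : cd * wnorm δ f ≤ (N₀ + 1 : ℕ) * H (N₀ + 1) := by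
    simp only [wnorm, hH]
    rw [← tsum_mul_left, ← tsum_mul_left]
    refine (hfδ.mul_left cd).tsum_le_tsum (fun i => ?_) (hcut.mul_left _)
    have h1 : 1 / ((N₀ + 1 : ℕ) : ℝ) ≤ cutoff (N₀ + 1) i := by
      refine le_min (div_le_div_of_nonneg_right (one_le_cast i) hN.le) ?_
      rw [div_le_one hN]; exact_mod_cast Nat.succ_le_succ (Nat.zero_le _)
    rw [div_le_iff₀ hN] at h1
    have h2 := mul_le_mul_of_nonneg_right h1 (hD0 i)
    have e : cd * (|f i| * (i : ℝ) ^ δ) = 1 * D i := by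
      simp only [hD]; rw [abs_of_nonneg (hf i)]; ring
    rw [e]
    linarith
  rw [le_div_iff₀ hcd]
  have := mul_le_mul_of_nonneg_left hfin hN.le
  linarith

/-! ### The growth of superlinear weights under coagulation -/

theorem hasDerivAt_rpow_one_add_sub {k : ℝ} (hk : 1 ≤ k) (x : ℝ) :
    HasDerivAt (fun x : ℝ => (1 + x) ^ k - x ^ k)
      (k * (1 + x) ^ (k - 1) - k * x ^ (k - 1)) x := by
  have h1 := ((hasDerivAt_id x).const_add 1).rpow_const (p := k) (Or.inr hk)
  have h2 := (hasDerivAt_id x).rpow_const (p := k) (Or.inr hk)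
  have h3 := h1.sub h2
  simp only [id_eq, one_mul] at h3
  exact h3

theorem monotoneOn_rpow_one_add_sub {k : ℝ} (hk : 1 ≤ k) :
    MonotoneOn (fun x : ℝ => (1 + x) ^ k - x ^ k) (Set.Ici 0) := by
  have hd := hasDerivAt_rpow_one_add_sub hk
  refine monotoneOn_of_deriv_nonneg (convex_Ici 0)
    (fun x _ => (hd x).continuousAt.continuousWithinAt)
    (fun x _ => (hd x).differentiableAt.differentiableWithinAt) fun x hx => ?_
  rw [interior_Ici, Set.mem_Ioi] at hx
  rw [(hd x).deriv, ← mul_sub]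
  have := Real.rpow_le_rpow hx.le (by linarith : x ≤ 1 + x) (by linarith : 0 ≤ k - 1)
  exact mul_nonneg (by linarith) (by linarith)

theorem rpow_one_add_sub_le_const {k : ℝ} (hk : 1 ≤ k) {x : ℝ} (hx : 0 ≤ x) (hx1 : x ≤ 1) :
    (1 + x) ^ k - 1 - x ^ k ≤ 2 ^ k - 2 := by
  have := monotoneOn_rpow_one_add_sub hk (Set.mem_Ici.2 hx) (Set.mem_Ici.2 zero_le_one) hx1
  simp only [Real.one_rpow] at this
  rw [show (1 : ℝ) + 1 = 2 by norm_num] at this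
  linarith

theorem rpow_one_add_sub_nonneg {k : ℝ} (hk : 1 ≤ k) {x : ℝ} (hx : 0 ≤ x) :
    0 ≤ (1 + x) ^ k - 1 - x ^ k := by
  have := Real.add_rpow_le_rpow_add zero_le_one hx hk
  rw [Real.one_rpow] at this
  linarith

theorem rpow_one_add_sub_le_linear {k : ℝ} (hk : 1 ≤ k) (hk2 : k ≤ 2) {x : ℝ} (hx : 0 ≤ x) :
    (1 + x) ^ k - 1 - x ^ k ≤ k * x := by
  have hd : ∀ x : ℝ, HasDerivAt (fun x : ℝ => k * x - ((1 + x) ^ k - x ^ k))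
      (k - (k * (1 + x) ^ (k - 1) - k * x ^ (k - 1))) x := fun x => by
    have := ((hasDerivAt_id x).const_mul k).sub (hasDerivAt_rpow_one_add_sub hk x)
    rw [mul_one] at this
    exact this
  have hm : MonotoneOn (fun x : ℝ => k * x - ((1 + x) ^ k - x ^ k)) (Set.Ici 0) := by
    refine monotoneOn_of_deriv_nonneg (convex_Ici 0)
      (fun x _ => (hd x).continuousAt.continuousWithinAt)
      (fun x _ => (hd x).differentiableAt.differentiableWithinAt) fun x hx => ?_
    rw [interior_Ici, Set.mem_Ioi] at hx
    rw [(hd x).deriv]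
    have := Real.rpow_add_le_add_rpow zero_le_one hx.le (by linarith : 0 ≤ k - 1) (by linarith)
    rw [Real.one_rpow] at this
    nlinarith
  have := hm (Set.self_mem_Ici (a := (0 : ℝ))) hx hx
  simp only [mul_zero, add_zero, Real.one_rpow] at this
  rw [Real.zero_rpow (by linarith)] at this
  linarith

theorem rpow_one_add_sub_le_chord {k : ℝ} (hk : 2 ≤ k) {x : ℝ} (hx : 0 ≤ x) (hx1 : x ≤ 1) :
    (1 + x) ^ k - 1 - x ^ k ≤ (2 ^ k - 2) * x := by
  have hk1 : 1 ≤ k := by linarith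
  have hd := hasDerivAt_rpow_one_add_sub hk1
  have hconv : ConvexOn ℝ (Set.Ici 0) (fun x : ℝ => (1 + x) ^ k - x ^ k) := by
    refine MonotoneOn.convexOn_of_deriv (convex_Ici 0)
      (fun x _ => (hd x).continuousAt.continuousWithinAt)
      (fun x _ => (hd x).differentiableAt.differentiableWithinAt) ?_
    have e : deriv (fun x : ℝ => (1 + x) ^ k - x ^ k)
        = fun x => k * ((1 + x) ^ (k - 1) - x ^ (k - 1)) := by
      funext x; rw [(hd x).deriv]; ring
    rw [e, interior_Ici]
    intro x hx y hy hxy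
    exact mul_le_mul_of_nonneg_left (monotoneOn_rpow_one_add_sub (by linarith : 1 ≤ k - 1)
      (Set.mem_Ici.2 (le_of_lt hx)) (Set.mem_Ici.2 (le_of_lt hy)) hxy) (by linarith)
  have := hconv.2 (Set.self_mem_Ici (a := (0 : ℝ))) (zero_le_one : (0 : ℝ) ≤ 1)
    (sub_nonneg.2 hx1) hx (by ring)
  simp only [smul_eq_mul, mul_zero, mul_one, zero_add, add_zero, Real.one_rpow] at this
  rw [Real.zero_rpow (by linarith), show (1 : ℝ) + 1 = 2 by norm_num] at this
  linarith

/-- A constant `A` with `x ^ a ((1 + x) ^ k - 1 - x ^ k) ≤ A x` on `[0, 1]`. The value `2 ^ k - 2`,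
which is sharp at `x = 1`, is too small near `x = 0` if `k < 2` and `a` is small. -/
def gainConst (a k : ℝ) : ℝ :=
  if 2 ≤ k ∨ 1 ≤ a then 2 ^ k - 2 else (2 ^ k - 2) ^ a * k ^ (1 - a)

theorem two_rpow_sub_two_pos {k : ℝ} (hk : 1 < k) : (0 : ℝ) < 2 ^ k - 2 := by
  have := Real.rpow_lt_rpow_of_exponent_lt (by norm_num : (1 : ℝ) < 2) hk
  rw [Real.rpow_one] at this
  linarith

theorem gainConst_nonneg {a k : ℝ} (hk : 1 < k) : 0 ≤ gainConst a k := by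
  have := two_rpow_sub_two_pos hk
  unfold gainConst
  split_ifs <;> positivity

theorem rpow_mul_sub_le_gainConst {a k : ℝ} (ha : 0 ≤ a) (hk : 1 < k) {x : ℝ} (hx : 0 < x)
    (hx1 : x ≤ 1) : x ^ a * ((1 + x) ^ k - 1 - x ^ k) ≤ gainConst a k * x := by
  have hg0 := rpow_one_add_sub_nonneg hk.le hx.le
  have hg1 := rpow_one_add_sub_le_const hk.le hx.le hx1
  have h2 := two_rpow_sub_two_pos hk
  unfold gainConst
  split_ifs with h
  · rcases h with h | h
    · calc x ^ a * ((1 + x) ^ k - 1 - x ^ k) ≤ 1 * ((1 + x) ^ k - 1 - x ^ k) :=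
            mul_le_mul_of_nonneg_right (Real.rpow_le_one hx.le hx1 ha) hg0
        _ ≤ _ := by rw [one_mul]; exact rpow_one_add_sub_le_chord h hx.le hx1
    · have h3 : x ^ a ≤ x := by
        have := Real.rpow_le_rpow_of_exponent_ge hx hx1 h
        rwa [Real.rpow_one] at this
      calc x ^ a * ((1 + x) ^ k - 1 - x ^ k) ≤ x * (2 ^ k - 2) :=
            mul_le_mul h3 hg1 hg0 hx.le
        _ = _ := mul_comm _ _
  · push Not at h
    -- geometric interpolation between the bounds `2 ^ k - 2` and `k x`
    have hl := rpow_one_add_sub_le_linear hk.le h.1.le hx.le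
    set g := (1 + x) ^ k - 1 - x ^ k
    have e : g = g ^ a * g ^ (1 - a) := by
      rcases hg0.eq_or_lt with h0 | h0
      · rw [← h0]
        rw [Real.zero_rpow (by linarith [h.2] : 1 - a ≠ 0), mul_zero]
      · rw [← Real.rpow_add h0]; simp
    have h3 : g ≤ (2 ^ k - 2) ^ a * (k * x) ^ (1 - a) := by
      rw [e]
      exact mul_le_mul (Real.rpow_le_rpow hg0 hg1 ha)
        (Real.rpow_le_rpow hg0 hl (by linarith [h.2])) (by positivity) (by positivity)
    calc x ^ a * g ≤ x ^ a * ((2 ^ k - 2) ^ a * (k * x) ^ (1 - a)) :=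
          mul_le_mul_of_nonneg_left h3 (by positivity)
      _ = (2 ^ k - 2) ^ a * k ^ (1 - a) * (x ^ a * x ^ (1 - a)) := by
          rw [Real.mul_rpow (by linarith) hx.le]; ring
      _ = _ := by rw [← Real.rpow_add hx]; simp

/-- The gain of the weight `s ↦ s ^ k` when `s` and `t` merge. -/
theorem kernel_gain_le {a b k : ℝ} (ha : 0 ≤ a) (hb : 0 ≤ b) (hk : 1 < k) {s t : ℝ} (hs : 0 < s)
    (ht : 0 < t) :
    s ^ a * t ^ a * (s + t) ^ b * ((s + t) ^ k - s ^ k - t ^ k) ≤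
      2 ^ b * gainConst a k * (s ^ (2 * a + b + k - 1) * t + s * t ^ (2 * a + b + k - 1)) := by
  wlog hts : t ≤ s generalizing s t with H
  · have := H ht hs (le_of_not_ge hts)
    rw [add_comm t s] at this
    linarith
  obtain ⟨x, hx, rfl⟩ : ∃ x : ℝ, 0 < x ∧ t = s * x :=
    ⟨t / s, div_pos ht hs, by field_simp⟩
  have hx1 : x ≤ 1 := by
    by_contra h
    push Not at h
    nlinarith
  have e1 : s + s * x = s * (1 + x) := by ring
  have hx' : (0 : ℝ) < 1 + x := by linarith
  have hg0 := rpow_one_add_sub_nonneg hk.le hx.le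
  have h1 := rpow_mul_sub_le_gainConst ha hk hx hx1
  have h2 : (1 + x) ^ b ≤ 2 ^ b := Real.rpow_le_rpow hx'.le (by linarith) hb
  have h3 : (1 + x) ^ b * (x ^ a * ((1 + x) ^ k - 1 - x ^ k)) ≤ 2 ^ b * (gainConst a k * x) :=
    mul_le_mul h2 h1 (by positivity) (by positivity)
  have h4 := mul_le_mul_of_nonneg_left h3 (by positivity : 0 ≤ s ^ (2 * a + b + k))
  have es : s ^ (2 * a + b + k) = s ^ a * s ^ a * s ^ b * s ^ k := by
    rw [← Real.rpow_add hs, ← Real.rpow_add hs, ← Real.rpow_add hs]; ring_nf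
  have es' : s ^ (2 * a + b + k) = s ^ (2 * a + b + k - 1) * s := by
    nth_rewrite 3 [← Real.rpow_one s]
    rw [← Real.rpow_add hs]; ring_nf
  have hG := gainConst_nonneg (a := a) hk
  calc s ^ a * (s * x) ^ a * (s + s * x) ^ b * ((s + s * x) ^ k - s ^ k - (s * x) ^ k)
      = s ^ (2 * a + b + k) * ((1 + x) ^ b * (x ^ a * ((1 + x) ^ k - 1 - x ^ k))) := by
        rw [e1, Real.mul_rpow hs.le hx.le, Real.mul_rpow hs.le hx'.le, Real.mul_rpow hs.le hx'.le,
          Real.mul_rpow hs.le hx.le, es]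
        ring
    _ ≤ _ := h4
    _ = 2 ^ b * gainConst a k * (s ^ (2 * a + b + k - 1) * (s * x)) := by rw [es']; ring
    _ ≤ _ := by
        refine mul_le_mul_of_nonneg_left ?_ (by positivity)
        have : 0 ≤ s * (s * x) ^ (2 * a + b + k - 1) := by positivity
        linarith

/-! ### The differential inequality for the moment -/

/-- If `gainConst` differs from `2 ^ k - 2`, it exceeds it at most by the factor
`2 ^ (D / (k - 1))`, which `gain_le_damping` recovers from the threshold `2 ℬ_k` in place of `ℬ_k`.
There `D = δ - 2 a - b + 1`, and `1 - a < D` amounts to `a + b < δ`. -/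
theorem gainConst_le {a k D : ℝ} (hk : 1 < k) (hD : 0 < D) (haD : 1 - a < D) :
    gainConst a k ≤ 2 ^ (D / (k - 1)) * (2 ^ k - 2) := by
  have h2 := two_rpow_sub_two_pos hk
  have hk1 : 0 < k - 1 := by linarith
  unfold gainConst
  split_ifs with h
  · have : (1 : ℝ) ≤ 2 ^ (D / (k - 1)) :=
      Real.one_le_rpow (by norm_num) (by positivity)
    nlinarith
  · push Not at h
    have h3 : k ≤ 2 ^ (1 / (k - 1)) * (2 ^ k - 2) := by
      have h4 : 1 + 1 / (k - 1) ≤ (2 : ℝ) ^ (1 / (k - 1)) := by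
        have := one_add_mul_self_le_rpow_one_add (by norm_num : (-1 : ℝ) ≤ 1)
          (p := 1 / (k - 1)) (by rw [le_div_iff₀ hk1]; linarith)
        rw [show (1 : ℝ) + 1 = 2 by norm_num] at this
        linarith
      have h5 : k - 1 ≤ (2 : ℝ) ^ k - 2 := by
        have e : (2 : ℝ) ^ k = 2 * 2 ^ (k - 1) := by
          rw [Real.rpow_sub_one (by norm_num)]; ring
        have h6 : Real.log 2 * (k - 1) + 1 ≤ (2 : ℝ) ^ (k - 1) := by
          rw [Real.rpow_def_of_pos (by norm_num)]
          exact Real.add_one_le_exp _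
        have := Real.log_two_gt_d9
        rw [e]
        nlinarith
      calc k = (1 + 1 / (k - 1)) * (k - 1) := by field_simp; ring
        _ ≤ _ := mul_le_mul h4 h5 hk1.le (by positivity)
    have h1a : 0 < 1 - a := by linarith [h.2]
    calc (2 ^ k - 2) ^ a * k ^ (1 - a)
        ≤ (2 ^ k - 2) ^ a * (2 ^ (1 / (k - 1)) * (2 ^ k - 2)) ^ (1 - a) := by
          refine mul_le_mul_of_nonneg_left ?_ (by positivity)
          exact Real.rpow_le_rpow (by linarith) h3 h1a.le
      _ = 2 ^ ((1 - a) / (k - 1)) * ((2 ^ k - 2) ^ a * (2 ^ k - 2) ^ (1 - a)) := by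
          rw [Real.mul_rpow (by positivity) h2.le, ← Real.rpow_mul (by norm_num)]
          ring_nf
      _ = 2 ^ ((1 - a) / (k - 1)) * (2 ^ k - 2) := by
          rw [← Real.rpow_add h2]; simp
      _ ≤ _ := by
          refine mul_le_mul_of_nonneg_right ?_ h2.le
          refine Real.rpow_le_rpow_of_exponent_le (by norm_num) ?_
          exact div_le_div_of_nonneg_right haD.le hk1.le

/-- The binary entropy is at most `log 2`, in exponential form. -/
theorem half_le_rpow_mul_rpow {θ : ℝ} (h0 : 0 < θ) (h1 : θ < 1) :
    1 / 2 ≤ (1 - θ) ^ (1 - θ) * θ ^ θ := by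
  have h1' : 0 < 1 - θ := by linarith
  have h := Real.geom_mean_le_arith_mean2_weighted h1'.le h0.le
    (inv_nonneg.2 h1'.le) (inv_nonneg.2 h0.le) (by ring)
  rw [mul_inv_cancel₀ h1'.ne', mul_inv_cancel₀ h0.ne', Real.inv_rpow h1'.le, Real.inv_rpow h0.le,
    ← mul_inv] at h
  have hp : 0 < (1 - θ) ^ (1 - θ) * θ ^ θ := by positivity
  rw [div_le_iff₀ (by norm_num)]
  have := mul_le_mul_of_nonneg_left h hp.le
  rw [mul_inv_cancel₀ hp.ne'] at this
  linarith

/-- If the `k`-th moment exceeds `2 ℬ_k(X)`, then the damping dominates the gain by coagulation.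
Here `X` bounds the first moment, `y` stands for the moment of order `δ + k`, and the bounds for
the `k`-th moment and the moment of order `2 a + b + k - 1` are those given by interpolation. -/
theorem gain_le_damping {a b δ k : ℝ} (ha : 0 ≤ a) (hb : 0 ≤ b) (hδ : a + b < δ)
    (hδ₁ : 2 * a + b - 1 < δ) (hk : 1 < k) (hkab : 2 - a - b < k) {X y : ℝ} (hX : 0 ≤ X)
    (hy : 0 ≤ y)
    (hm : 2 * boundB a b δ k X < X ^ (δ / (δ + k - 1)) * y ^ ((k - 1) / (δ + k - 1))) :
    2 ^ (b + 1) * gainConst a k * (X * (X ^ ((δ - 2 * a - b + 1) / (δ + k - 1))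
      * y ^ ((2 * a + b + k - 2) / (δ + k - 1)))) ≤ y := by
  have hk1 : 0 < k - 1 := by linarith
  have hD : 0 < δ - 2 * a - b + 1 := by linarith
  have hE : 0 < 2 * a + b + k - 2 := by linarith
  have hs : 0 < δ + k - 1 := by linarith
  have hδ0 : 0 < δ := by linarith
  have hA2 := two_rpow_sub_two_pos hk
  have hG := gainConst_nonneg (a := a) hk
  have hle := gainConst_le hk hD (by linarith : 1 - a < δ - 2 * a - b + 1)
  set D := δ - 2 * a - b + 1 with hDdef
  set E := 2 * a + b + k - 2 with hEdef
  set s := δ + k - 1 with hsdef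
  have hDE : D + E = s := by simp only [hDdef, hEdef, hsdef]; ring
  set θ := E / s with hθ
  have hθ0 : 0 < θ := div_pos hE hs
  have h1θ : D / s = 1 - θ := by rw [hθ, eq_sub_iff_add_eq, ← add_div, hDE, div_self hs.ne']
  have hθ1 : θ < 1 := by have := div_pos hD hs; linarith
  set A : ℝ := 2 ^ (b + 1) * (2 ^ k - 2) with hA
  have hApos : 0 < A := by positivity
  have hCeq : constC a b δ k = (1 - θ) * A ^ (s / D) * (2 * θ) ^ (E / D) := by
    unfold constC
    rw [← hDdef, ← hEdef, ← hsdef, h1θ, hθ]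
    congr 2
    ring
  set C := constC a b δ k with hC
  have hCpos : 0 < C := by
    rw [hCeq]
    have : 0 < 1 - θ := by linarith
    positivity
  have hBnn : 0 ≤ boundB a b δ k X := by unfold boundB; positivity
  rcases hX.eq_or_lt with rfl | hXpos
  · simp only [zero_mul, mul_zero]; exact hy
  have hy' : 0 < y := by
    rcases hy.eq_or_lt with rfl | h
    · rw [Real.zero_rpow (by positivity), mul_zero] at hm
      linarith
    · exact h
  -- solve the assumption for `y`
  have hy1 : 2 ^ (s / (k - 1)) * (2 * C) * X ^ (1 + s / D) ≤ y := by
    have h1 := Real.rpow_le_rpow (by positivity) hm.le (by positivity : 0 ≤ s / (k - 1))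
    have hL : (2 * boundB a b δ k X) ^ (s / (k - 1))
        = 2 ^ (s / (k - 1)) * (2 * C) * X ^ (1 + s / D) * X ^ (δ / (k - 1)) := by
      rw [Real.mul_rpow (by norm_num) hBnn]
      unfold boundB
      rw [← hDdef, ← hsdef, ← hC, ← Real.rpow_mul (by positivity),
        show (k - 1) / s * (s / (k - 1)) = 1 by field_simp, Real.rpow_one,
        Real.rpow_add hXpos (1 + s / D)]
      ring
    have hR : (X ^ (δ / s) * y ^ ((k - 1) / s)) ^ (s / (k - 1)) = X ^ (δ / (k - 1)) * y := by
      rw [Real.mul_rpow (by positivity) (by positivity), ← Real.rpow_mul hX, ← Real.rpow_mul hy,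
        show (k - 1) / s * (s / (k - 1)) = 1 by field_simp, Real.rpow_one,
        show δ / s * (s / (k - 1)) = δ / (k - 1) by field_simp]
    rw [hL, hR, mul_comm (X ^ (δ / (k - 1))) y] at h1
    exact le_of_mul_le_mul_right h1 (by positivity)
  have hy2 := Real.rpow_le_rpow (by positivity) hy1 (by linarith : 0 ≤ 1 - θ)
  have e2 : (2 ^ (s / (k - 1)) * (2 * C) * X ^ (1 + s / D)) ^ (1 - θ)
      = 2 ^ (D / (k - 1)) * (2 * ((1 - θ) ^ (1 - θ) * θ ^ θ) * A) * (X * X ^ (1 - θ)) := by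
    have p1 : 0 < 1 - θ := by linarith
    have c1 : s / (k - 1) * (1 - θ) = D / (k - 1) := by rw [← h1θ]; field_simp
    have c2 : s / D * (1 - θ) = 1 := by rw [← h1θ]; field_simp
    have c3 : E / D * (1 - θ) = θ := by rw [← h1θ, hθ]; field_simp
    have c4 : (1 + s / D) * (1 - θ) = 1 + (1 - θ) := by rw [add_mul, c2]; ring
    rw [Real.mul_rpow (by positivity) (by positivity),
      Real.mul_rpow (by positivity) (by positivity), ← Real.rpow_mul (by norm_num), c1,
      ← Real.rpow_mul hX, c4, Real.rpow_add hXpos, Real.rpow_one, hCeq,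
      Real.mul_rpow (by norm_num) (by positivity), Real.mul_rpow (by positivity) (by positivity),
      Real.mul_rpow (by positivity) (by positivity), ← Real.rpow_mul (by positivity), c2,
      Real.rpow_one, ← Real.rpow_mul (by positivity), c3, Real.mul_rpow (by norm_num) hθ0.le]
    have c5 : (2 : ℝ) ^ (1 - θ) * 2 ^ θ = 2 := by
      rw [← Real.rpow_add (by norm_num)]; simp
    calc 2 ^ (D / (k - 1)) * (2 ^ (1 - θ) * ((1 - θ) ^ (1 - θ) * A * (2 ^ θ * θ ^ θ)))
          * (X * X ^ (1 - θ))
        = 2 ^ (D / (k - 1)) * ((2 ^ (1 - θ) * 2 ^ θ) * ((1 - θ) ^ (1 - θ) * θ ^ θ) * A)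
          * (X * X ^ (1 - θ)) := by ring
      _ = _ := by rw [c5]
  rw [e2] at hy2
  have hhalf := half_le_rpow_mul_rpow hθ0 hθ1
  have h5 : 2 ^ (b + 1) * gainConst a k * (X * X ^ (1 - θ)) ≤ y ^ (1 - θ) := by
    refine le_trans ?_ hy2
    refine mul_le_mul_of_nonneg_right ?_ (by positivity)
    calc 2 ^ (b + 1) * gainConst a k ≤ 2 ^ (b + 1) * (2 ^ (D / (k - 1)) * (2 ^ k - 2)) :=
          mul_le_mul_of_nonneg_left hle (by positivity)
      _ = 2 ^ (D / (k - 1)) * (1 * A) := by rw [hA]; ring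
      _ ≤ _ := by
          refine mul_le_mul_of_nonneg_left ?_ (by positivity)
          refine mul_le_mul_of_nonneg_right ?_ hApos.le
          linarith
  have h6 := mul_le_mul_of_nonneg_right h5 (by positivity : 0 ≤ y ^ θ)
  rw [← Real.rpow_add hy', sub_add_cancel, Real.rpow_one] at h6
  rw [h1θ]
  refine le_trans (le_of_eq ?_) h6
  ring

/-! ### Truncated systems -/

theorem finite_le (N : ℕ) : {i : ℕ+ | (i : ℕ) ≤ N}.Finite :=
  (Set.finite_Iic N).preimage PNat.coe_injective.injOn

/-- The projection onto sequences supported in `{1, …, N}` with values in `[0, R]`. -/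
def clamp (N : ℕ) (R : ℝ) (f : ℕ+ → ℝ) (i : ℕ+) : ℝ :=
  if (i : ℕ) ≤ N then max 0 (min (f i) R) else 0

theorem clamp_nonneg (N : ℕ) (R : ℝ) (f : ℕ+ → ℝ) (i : ℕ+) : 0 ≤ clamp N R f i := by
  unfold clamp; split_ifs
  exacts [le_max_left _ _, le_rfl]

theorem abs_clamp_sub_le (N : ℕ) (R : ℝ) (f g : ℕ+ → ℝ) (i : ℕ+) :
    |(clamp N R f - clamp N R g) i| ≤ |f i - g i| := by
  rw [Pi.sub_apply]
  unfold clamp; split_ifs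
  · refine (abs_max_sub_max_le_max _ _ _ _).trans ?_
    rw [sub_self, abs_zero]
    refine max_le (abs_nonneg _) ((abs_min_sub_min_le_max _ _ _ _).trans ?_)
    rw [sub_self, abs_zero]
    exact max_le le_rfl (abs_nonneg _)
  · simp

theorem wsummable_of_support {N : ℕ} {f : ℕ+ → ℝ} (hf : ∀ i : ℕ+, N < (i : ℕ) → f i = 0) (q : ℝ) :
    WSummable q f := by
  refine summable_of_hasFiniteSupport ((finite_le N).subset fun i hi => ?_)
  by_contra h
  rw [Set.mem_ofPred_eq, not_le] at h
  rw [Function.mem_support, hf i h] at hi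
  simp at hi

theorem clamp_support (N : ℕ) (R : ℝ) (f : ℕ+ → ℝ) (i : ℕ+) (hi : N < (i : ℕ)) :
    clamp N R f i = 0 := if_neg (not_le.2 hi)

/-- A bound for weighted norms of differences of clamped sequences. -/
theorem wnorm_clamp_sub_le {N : ℕ} {δ : ℝ} (hδ : 0 ≤ δ) (R : ℝ) (f g : ℕ+ → ℝ) :
    wnorm δ (clamp N R f - clamp N R g) ≤ (N : ℝ) ^ δ * wnorm 0 (clamp N R f - clamp N R g) := by
  have hs : ∀ q, WSummable q (clamp N R f - clamp N R g) := fun q =>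
    (wsummable_of_support (clamp_support N R f) q).sub (wsummable_of_support (clamp_support N R g) q)
  unfold wnorm
  rw [← tsum_mul_left]
  refine (hs δ).tsum_le_tsum (fun i => ?_) ((hs 0).mul_left _)
  rw [Real.rpow_zero, mul_one, mul_comm]
  rcases le_or_gt (i : ℕ) N with h | h
  · exact mul_le_mul_of_nonneg_right
      (Real.rpow_le_rpow (cast_pos i).le (by exact_mod_cast h) hδ) (abs_nonneg _)
  · rw [Pi.sub_apply, clamp_support N R f i h, clamp_support N R g i h]; simp

theorem wnorm_clamp_sub_le_norm (N : ℕ) (R : ℝ) (f g : Ell1) :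
    wnorm 0 (clamp N R f - clamp N R g) ≤ ‖f - g‖ := by
  rw [← Ell1.wnorm_zero]
  refine Summable.tsum_le_tsum (fun i => ?_)
    ((wsummable_of_support (clamp_support N R f) 0).sub
      (wsummable_of_support (clamp_support N R g) 0)) (Ell1.wsummable_zero _)
  rw [Real.rpow_zero, mul_one, mul_one]
  simpa using abs_clamp_sub_le N R f g i

theorem wnorm_clamp_le (N : ℕ) {R : ℝ} (hR : 0 ≤ R) (f : ℕ+ → ℝ) :
    wnorm 0 (clamp N R f) ≤ ∑' i : ℕ+, if (i : ℕ) ≤ N then R else 0 := by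
  refine Summable.tsum_le_tsum (fun i => ?_) (wsummable_of_support (clamp_support N R f) 0) ?_
  · rw [Real.rpow_zero, mul_one, abs_of_nonneg (clamp_nonneg N R f i)]
    unfold clamp
    split_ifs
    · exact max_le hR (min_le_right _ _)
    · exact le_rfl
  · refine summable_of_hasFiniteSupport ((finite_le N).subset fun i hi => ?_)
    by_contra h
    rw [Set.mem_ofPred_eq] at h
    simp [h] at hi

theorem damped_summable {c p δ cd : ℝ} {k₁ k₂ : ℕ+ → ℕ+ → ℝ} (hk : KernelBound c p k₁ k₂)
    (hcd : 0 ≤ cd) {f : ℕ+ → ℝ} (hfp : WSummable p f) (hfδ : WSummable δ f) :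
    Summable fun i : ℕ+ => |transfer (flux k₁ k₂ f) i - cd * (i : ℝ) ^ δ * f i| := by
  have h0 : Summable (fun _ : ℕ+ × ℕ+ => (0 : ℝ)) := summable_zero
  have := (damped_sub_bound (summable_flux hk hfp) h0 hcd (f := f) (g := 0) (by simpa using hfδ)).1
  simpa [transfer] using this

/-- The right-hand side of the damped system with the kernels `k₁`, `k₂`, as an element of `ℓ¹`. -/
def dampedOp {c p δ cd : ℝ} {k₁ k₂ : ℕ+ → ℕ+ → ℝ} (hk : KernelBound c p k₁ k₂)
    (hcd : 0 ≤ cd) (f : ℕ+ → ℝ) (hfp : WSummable p f) (hfδ : WSummable δ f) : Ell1 :=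
  Ell1.mk (fun i : ℕ+ => transfer (flux k₁ k₂ f) i - cd * (i : ℝ) ^ δ * f i)
    (damped_summable hk hcd hfp hfδ)

theorem norm_dampedOp_sub_le {c p δ cd : ℝ} {k₁ k₂ : ℕ+ → ℕ+ → ℝ} (hk : KernelBound c p k₁ k₂)
    (hcd : 0 ≤ cd) {f g : ℕ+ → ℝ} (hfp : WSummable p f) (hfδ : WSummable δ f) (hgp : WSummable p g)
    (hgδ : WSummable δ g) :
    ‖dampedOp hk hcd f hfp hfδ - dampedOp hk hcd g hgp hgδ‖
      ≤ 6 * c * (wnorm p f + wnorm p g) * wnorm p (f - g) + cd * wnorm δ (f - g) := by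
  rw [Ell1.norm_eq]
  refine (damped_sub_bound (summable_flux hk hfp) (summable_flux hk hgp) hcd
    (hfδ.sub hgδ)).2.trans ?_
  have := (flux_sub_bound hk hfp hgp).2
  linarith

/-- The truncated system has a solution on every interval if its right-hand side is evaluated at
the clamped sequence, which makes it bounded and Lipschitz continuous. -/
theorem exists_clamped_solution {c p δ cd : ℝ} (hp : 0 ≤ p) (hδ : 0 ≤ δ) (hcd : 0 ≤ cd)
    {k₁ k₂ : ℕ+ → ℕ+ → ℝ} (hk : KernelBound c p k₁ k₂) (x₀ : Ell1) (N : ℕ) {R : ℝ} (hR : 0 ≤ R)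
    {T : ℝ} (hT : 0 ≤ T) :
    ∃ u u' : ℝ → Ell1, u 0 = x₀ ∧
      (∀ t ∈ Set.Icc 0 T, HasDerivWithinAt u (u' t) (Set.Icc 0 T) t) ∧
      ∀ t i, u' t i = transfer (flux (trunc N k₁) (trunc N k₂) (clamp N R (u t))) i
        - cd * (i : ℝ) ^ δ * clamp N R (u t) i := by
  have hk0 := hk.trunc_zero hp N
  set c₀ := c * ((N : ℝ) ^ p * (N : ℝ) ^ p)
  have hc₀ : 0 ≤ c₀ := hk0.const_nonneg
  have hs : ∀ (f : ℕ+ → ℝ) q, WSummable q (clamp N R f) := fun f q =>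
    wsummable_of_support (clamp_support N R f) q
  let V : Ell1 → Ell1 := fun f => dampedOp hk0 hcd (clamp N R f) (hs f 0) (hs f δ)
  set M : ℝ := ∑' i : ℕ+, if (i : ℕ) ≤ N then R else 0
  have hM : ∀ f, wnorm 0 (clamp N R f) ≤ M := wnorm_clamp_le N hR
  have hM0 : 0 ≤ M := (wnorm_nonneg _ _).trans (hM 0)
  set K : ℝ := 6 * c₀ * (M + M) + cd * (N : ℝ) ^ δ
  have hK : 0 ≤ K := by positivity
  have hV : ∀ f g, ‖V f - V g‖ ≤ K * wnorm 0 (clamp N R f - clamp N R g) := fun f g => by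
    refine (norm_dampedOp_sub_le hk0 hcd _ _ _ _).trans ?_
    have h1 := mul_le_mul_of_nonneg_left (wnorm_clamp_sub_le (N := N) hδ R f g) hcd
    have h2 : 6 * c₀ * (wnorm 0 (clamp N R f) + wnorm 0 (clamp N R g))
        ≤ 6 * c₀ * (M + M) := by gcongr <;> exact hM _
    have h3 := mul_le_mul_of_nonneg_right h2 (wnorm_nonneg 0 (clamp N R f - clamp N R g))
    linarith
  have hlip : LipschitzWith K.toNNReal V := LipschitzWith.of_dist_le_mul fun f g => by
    rw [dist_eq_norm, dist_eq_norm, Real.coe_toNNReal _ hK]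
    exact (hV f g).trans (mul_le_mul_of_nonneg_left (wnorm_clamp_sub_le_norm N R f g) hK)
  set L : ℝ := ‖V 0‖ + K * (M + M)
  have hL : 0 ≤ L := by positivity
  have hbd : ∀ f, ‖V f‖ ≤ L := fun f => by
    have h1 : ‖V f‖ ≤ ‖V 0‖ + ‖V f - V 0‖ := norm_le_norm_add_norm_sub' _ _
    have h2 := (hV f 0).trans (mul_le_mul_of_nonneg_left
      ((wnorm_sub_le (hs f 0) (hs (0 : Ell1) 0)).trans (add_le_add (hM f) (hM _))) hK)
    linarith
  have hpl : IsPicardLindelof (fun _ => V) (⟨0, le_rfl, hT⟩ : Set.Icc (0 : ℝ) T) x₀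
      (L * T).toNNReal 0 L.toNNReal K.toNNReal :=
    { lipschitzOnWith := fun t _ => hlip.lipschitzOnWith
      continuousOn := fun x _ => continuousOn_const
      norm_le := fun t _ x _ => by rw [Real.coe_toNNReal _ hL]; exact hbd x
      mul_max_le := by
        rw [Real.coe_toNNReal _ hL, Real.coe_toNNReal _ (by positivity)]
        simp [hT] }
  obtain ⟨u, hu0, hu⟩ := hpl.exists_eq_forall_mem_Icc_hasDerivWithinAt₀
  exact ⟨u, fun t => V (u t), hu0, hu, fun t i => rfl⟩

theorem transfer_trunc_of_lt {N : ℕ} (k₁ k₂ : ℕ+ → ℕ+ → ℝ) (f : ℕ+ → ℝ) {i : ℕ+}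
    (hi : N < (i : ℕ)) : transfer (flux (trunc N k₁) (trunc N k₂) f) i = 0 := by
  have h : ∀ a b : ℕ+, N < ((a + b : ℕ+) : ℕ) →
      flux (trunc N k₁) (trunc N k₂) f (a, b) = 0 := fun a b hab => by
    simp only [flux, trunc]
    rw [if_neg (not_le.2 hab), if_neg (not_le.2 hab)]; ring
  have h1 : ∀ j, flux (trunc N k₁) (trunc N k₂) f (i, j) = 0 := fun j =>
    h i j (by rw [PNat.add_coe]; omega)
  have h2 : ∀ j, flux (trunc N k₁) (trunc N k₂) f (j, i) = 0 := fun j =>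
    h j i (by rw [PNat.add_coe]; omega)
  have h3 : ∀ j ∈ Finset.Iio i, flux (trunc N k₁) (trunc N k₂) f (j, i - j) = 0 := fun j hj =>
    h j (i - j) (by rw [PNat.add_sub_of_lt (Finset.mem_Iio.1 hj)]; exact hi)
  simp [transfer, h1, h2, Finset.sum_eq_zero h3]

/-- Where a nonnegative sequence vanishes, the interaction rates point inwards. -/
theorem transfer_nonneg_of_eq_zero {c p : ℝ} {k₁ k₂ : ℕ+ → ℕ+ → ℝ} (hk : KernelBound c p k₁ k₂)
    {f : ℕ+ → ℝ} (hf : ∀ i, 0 ≤ f i) {i : ℕ+} (hi : f i = 0) :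
    0 ≤ transfer (flux k₁ k₂ f) i := by
  have h1 : 0 ≤ ∑ j ∈ Finset.Iio i, flux k₁ k₂ f (j, i - j) := Finset.sum_nonneg fun j hj => by
    have e := PNat.add_sub_of_lt (Finset.mem_Iio.1 hj)
    simp only [flux]
    rw [e, hi]
    have := mul_nonneg (mul_nonneg (hk.nonneg₁ j (i - j)) (hf j)) (hf (i - j))
    linarith
  have h2 : ∑' j, flux k₁ k₂ f (i, j) ≤ 0 := tsum_nonpos fun j => by
    simp only [flux]
    rw [hi]
    have := mul_nonneg (mul_nonneg (hk.nonneg₂ i j) (hf (i + j))) (hf j)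
    linarith
  have h3 : ∑' j, flux k₁ k₂ f (j, i) ≤ 0 := tsum_nonpos fun j => by
    simp only [flux]
    rw [hi]; simp
  unfold transfer
  linarith

theorem hasDerivWithinAt_pairing {u u' : ℝ → Ell1} {s : Set ℝ} {t : ℝ}
    (hu : HasDerivWithinAt u (u' t) s t) {φ : ℕ+ → ℝ} {b : ℝ} (hφ : ∀ i, |φ i| ≤ b) :
    HasDerivWithinAt (fun t => ∑' i, u t i * φ i) (∑' i, u' t i * φ i) s t :=
  (pairing φ b hφ).hasFDerivAt.comp_hasDerivWithinAt t hu

theorem hasDerivWithinAt_apply {u u' : ℝ → Ell1} {s : Set ℝ} {t : ℝ}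
    (hu : HasDerivWithinAt u (u' t) s t) (i : ℕ+) :
    HasDerivWithinAt (fun t => u t i) (u' t i) s t :=
  (evalCLM i).hasFDerivAt.comp_hasDerivWithinAt t hu

/-- Nonnegative solution `u` on `[0, T]`, with time derivative `u'`, of the system with damping
`cd i ^ δ` in which the kernels and the initial data are cut off to sizes at most `N`. -/
structure IsTruncatedSolution (δ cd : ℝ) (k₁ k₂ : ℕ+ → ℕ+ → ℝ) (f₀ : ℕ+ → ℝ) (N : ℕ) (T : ℝ)
    (u u' : ℝ → Ell1) : Prop where
  initial : ∀ i : ℕ+, u 0 i = if (i : ℕ) ≤ N then f₀ i else 0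
  nonneg : ∀ t ∈ Set.Icc 0 T, ∀ i, 0 ≤ u t i
  support : ∀ t ∈ Set.Icc 0 T, ∀ i : ℕ+, N < (i : ℕ) → u t i = 0
  hasDeriv : ∀ t ∈ Set.Icc 0 T, HasDerivWithinAt u (u' t) (Set.Icc 0 T) t
  deriv_apply : ∀ t ∈ Set.Icc 0 T, ∀ i : ℕ+,
    u' t i = transfer (flux (trunc N k₁) (trunc N k₂) (u t)) i - cd * (i : ℝ) ^ δ * u t i

/-- The solution of the clamped system stays nonnegative and its mass does not increase, so it never
leaves the region on which `clamp` is the identity. -/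
theorem exists_truncated_solution {c p δ cd : ℝ} (hp : 0 ≤ p) (hδ : 0 ≤ δ) (hcd : 0 ≤ cd)
    {k₁ k₂ : ℕ+ → ℕ+ → ℝ} (hk : KernelBound c p k₁ k₂) {f₀ : ℕ+ → ℝ} (hf₀ : ∀ i, 0 ≤ f₀ i)
    {N : ℕ} (hN : 0 < N) {T : ℝ} (hT : 0 ≤ T) :
    ∃ u u' : ℝ → Ell1, IsTruncatedSolution δ cd k₁ k₂ f₀ N T u u' := by
  have hkN := hk.trunc N
  let x₀ : ℕ+ → ℝ := fun i => if (i : ℕ) ≤ N then f₀ i else 0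
  have hx₀s : ∀ i : ℕ+, N < (i : ℕ) → x₀ i = 0 := fun i hi => if_neg (not_le.2 hi)
  have hx₀ : Summable fun i => |x₀ i| := by
    simpa [WSummable] using wsummable_of_support hx₀s 0
  have hx₀n : ∀ i, 0 ≤ x₀ i := fun i => by
    simp only [x₀]; split_ifs; exacts [hf₀ i, le_rfl]
  set m₀ : ℝ := ∑' i, x₀ i * cutoff N i
  have hm₀ : 0 ≤ m₀ := tsum_nonneg fun i => mul_nonneg (hx₀n i) (cutoff_nonneg N i)
  have hN' : (0 : ℝ) < N := by exact_mod_cast hN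
  -- `cutoff N` is at least `1 / N`, so a tested mass of at most `m₀` forces `u i ≤ N * m₀`
  set R : ℝ := N * m₀
  have hR : 0 ≤ R := by positivity
  obtain ⟨u, u', hu0, hu, hu'⟩ :=
    exists_clamped_solution hp hδ hcd hk (Ell1.mk x₀ hx₀) N hR hT
  have hu0' : ∀ i, u 0 i = x₀ i := fun i => by rw [hu0]; rfl
  have hzero : (0 : ℝ) ∈ Set.Icc 0 T := ⟨le_rfl, hT⟩
  have hcomp : ∀ i, ∀ t ∈ Set.Icc 0 T,
      HasDerivWithinAt (fun t => u t i) (u' t i) (Set.Icc 0 T) t := fun i t ht =>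
    hasDerivWithinAt_apply (hu t ht) i
  have hnonneg : ∀ t ∈ Set.Icc 0 T, ∀ i, 0 ≤ u t i := by
    intro t ht i
    have := le_of_deriv_nonpos_above (m := fun t => -u t i) (m' := fun t => -u' t i) (c := 0)
      (fun t ht => (hcomp i t ht).neg) (by simpa [hu0'] using hx₀n i) (fun t ht hneg => ?_) t ht
    · linarith
    · have hc : clamp N R (u t) i = 0 := by
        unfold clamp
        split_ifs
        · exact max_eq_left ((min_le_left _ _).trans (by linarith))
        · rfl
      have := transfer_nonneg_of_eq_zero hkN (clamp_nonneg N R (u t)) hc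
      rw [hu' t i, hc]
      linarith
  have hsupp : ∀ t ∈ Set.Icc 0 T, ∀ i : ℕ+, N < (i : ℕ) → u t i = 0 := by
    intro t ht i hi
    have hd : ∀ t, u' t i = 0 := fun t => by
      rw [hu' t i, transfer_trunc_of_lt _ _ _ hi, clamp_support N R _ i hi]; ring
    have := le_of_deriv_nonpos_above (m := fun t => u t i) (m' := fun t => u' t i) (c := 0)
      (fun t ht => hcomp i t ht) (by simp [hu0', hx₀s i hi]) (fun t _ _ => (hd t).le) t ht
    exact le_antisymm this (hnonneg t ht i)
  -- the test function `cutoff N` is additive on pairs of total size at most `N`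
  have hmass : ∀ t ∈ Set.Icc 0 T, ∑' i, u t i * cutoff N i ≤ m₀ := by
    refine le_of_deriv_nonpos_above
      (fun t ht => hasDerivWithinAt_pairing (hu t ht) (abs_cutoff_le N))
      (by simp only [hu0']; exact le_rfl) (fun t ht _ => ?_)
    have hcs : ∀ q, WSummable q (clamp N R (u t)) := fun q =>
      wsummable_of_support (clamp_support N R (u t)) q
    have hw := hasSum_mul_transfer_of_bounded (summable_flux hkN (hcs p)) (abs_cutoff_le N)
    have hz : ∀ x : ℕ+ × ℕ+, flux (trunc N k₁) (trunc N k₂) (clamp N R (u t)) x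
        * (cutoff N (x.1 + x.2) - cutoff N x.1 - cutoff N x.2) = 0 := by
      rintro ⟨i, j⟩
      by_cases h : ((i + j : ℕ+) : ℕ) ≤ N
      · have hle := h
        rw [PNat.add_coe] at hle
        rw [cutoff_of_le hN h, cutoff_of_le hN (by omega : (i : ℕ) ≤ N),
          cutoff_of_le hN (by omega : (j : ℕ) ≤ N), PNat.add_coe]
        push_cast; ring
      · simp only [flux, trunc, if_neg h]; ring
    simp only [hz, tsum_zero] at hw
    have hle : ∀ i, u' t i * cutoff N i
        ≤ cutoff N i * transfer (flux (trunc N k₁) (trunc N k₂) (clamp N R (u t))) i := fun i => by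
      rw [hu' t i]
      have h1 := clamp_nonneg N R (u t) i
      have h2 := cutoff_nonneg N i
      have h3 := cast_pos i
      have : 0 ≤ cd * (i : ℝ) ^ δ * clamp N R (u t) i * cutoff N i := by positivity
      linarith
    have := (summable_mul_of_bounded (u' t).summable_abs.of_abs (abs_cutoff_le N)).tsum_le_tsum hle
      hw.summable
    rwa [hw.tsum_eq] at this
  have hclamp : ∀ t ∈ Set.Icc 0 T, clamp N R (u t) = u t := by
    intro t ht
    funext i
    by_cases hi : (i : ℕ) ≤ N
    · have h1 : u t i * cutoff N i ≤ m₀ := by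
        refine le_trans ?_ (hmass t ht)
        exact (summable_mul_of_bounded (u t).summable_abs.of_abs (abs_cutoff_le N)).le_tsum i
          fun j _ => mul_nonneg (hnonneg t ht j) (cutoff_nonneg N j)
      have h2 : u t i ≤ R := by
        rw [cutoff_of_le hN hi, ← mul_div_assoc, div_le_iff₀ hN'] at h1
        have h3 := hnonneg t ht i
        have h4 := one_le_cast i
        nlinarith
      unfold clamp
      rw [if_pos hi, min_eq_left h2, max_eq_right (hnonneg t ht i)]
    · rw [clamp_support N R (u t) i (not_le.1 hi), hsupp t ht i (not_le.1 hi)]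
  refine ⟨u, u', hu0', hnonneg, hsupp, hu, fun t ht i => ?_⟩
  rw [hu' t i, hclamp t ht]

/-- Evolution of the moment with an arbitrary weight `ψ` along the truncated system. -/
theorem IsTruncatedSolution.hasDerivWithinAt_moment {c p δ cd : ℝ} {k₁ k₂ : ℕ+ → ℕ+ → ℝ}
    (hk : KernelBound c p k₁ k₂) {f₀ : ℕ+ → ℝ} {N : ℕ} {T : ℝ} {u u' : ℝ → Ell1}
    (h : IsTruncatedSolution δ cd k₁ k₂ f₀ N T u u') (ψ : ℕ+ → ℝ) {t : ℝ}
    (ht : t ∈ Set.Icc 0 T) :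
    HasDerivWithinAt (fun t => ∑' i : ℕ+, if (i : ℕ) ≤ N then u t i * ψ i else 0)
      (∑' x : ℕ+ × ℕ+, flux (trunc N k₁) (trunc N k₂) (u t) x * (ψ (x.1 + x.2) - ψ x.1 - ψ x.2)
        - ∑' i : ℕ+, cd * (i : ℝ) ^ δ * u t i * ψ i) (Set.Icc 0 T) t := by
  set φ : ℕ+ → ℝ := fun i => if (i : ℕ) ≤ N then ψ i else 0 with hφ
  obtain ⟨b, hb⟩ : ∃ b, ∀ i, |φ i| ≤ b := by
    obtain ⟨b, hb⟩ := ((finite_le N).image fun i => |ψ i|).bddAbove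
    refine ⟨max b 0, fun i => ?_⟩
    simp only [hφ]
    split_ifs with hi
    · exact le_max_of_le_left (hb ⟨i, hi, rfl⟩)
    · simp
  have hder := hasDerivWithinAt_pairing (h.hasDeriv t ht) hb
  have e1 : ∀ s, ∑' i, u s i * φ i = ∑' i : ℕ+, if (i : ℕ) ≤ N then u s i * ψ i else 0 :=
    fun s => tsum_congr fun i => by simp only [hφ]; split_ifs <;> simp
  simp only [e1] at hder
  convert hder using 1
  have hs := wsummable_of_support (h.support t ht)
  have hw := hasSum_mul_transfer_of_bounded (summable_flux (hk.trunc N) (hs p)) hb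
  have hd : Summable fun i : ℕ+ => cd * (i : ℝ) ^ δ * u t i * ψ i := by
    refine summable_of_hasFiniteSupport ((finite_le N).subset fun i hi => ?_)
    by_contra hi'
    rw [Set.mem_ofPred_eq, not_le] at hi'
    rw [Function.mem_support, h.support t ht i hi'] at hi
    simp at hi
  have e2 : ∑' i, u' t i * φ i = ∑' i, (φ i * transfer (flux (trunc N k₁) (trunc N k₂) (u t)) i
      - cd * (i : ℝ) ^ δ * u t i * ψ i) := tsum_congr fun i => by
    rw [h.deriv_apply t ht i]
    by_cases hi : (i : ℕ) ≤ N
    · simp only [hφ, if_pos hi]; ring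
    · rw [h.support t ht i (not_le.1 hi)]; simp [hφ, hi]
  rw [e2, hw.summable.tsum_sub hd, hw.tsum_eq]
  congr 1
  refine tsum_congr fun x => ?_
  by_cases hx : ((x.1 + x.2 : ℕ+) : ℕ) ≤ N
  · have hle := hx
    rw [PNat.add_coe] at hle
    simp only [hφ, if_pos hx, if_pos (by omega : (x.1 : ℕ) ≤ N), if_pos (by omega : (x.2 : ℕ) ≤ N)]
  · simp only [flux, trunc, if_neg hx]; ring

/-! ### Moment bounds for truncated systems -/

theorem loc_pos {h : ℝ} (hh : 0 < h) (i : ℕ+) : 0 < loc h i := mul_pos (cast_pos i) hh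

theorem loc_add (h : ℝ) (i j : ℕ+) : loc h (i + j) = loc h i + loc h j := by
  unfold loc; rw [PNat.add_coe]; push_cast; ring

theorem loc_rpow {h : ℝ} (hh : 0 < h) (q : ℝ) (i : ℕ+) :
    loc h i ^ q = h ^ q * (i : ℝ) ^ q := by
  unfold loc; rw [Real.mul_rpow (cast_pos i).le hh.le, mul_comm]

theorem finiteMoment_iff {h : ℝ} (hh : 0 < h) {q : ℝ} {f : ℕ+ → ℝ} (hf : ∀ i, 0 ≤ f i) :
    FiniteMoment h q f ↔ WSummable q f := by
  have hq : h ^ q ≠ 0 := (Real.rpow_pos_of_pos hh q).ne'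
  unfold FiniteMoment WSummable
  rw [← summable_mul_left_iff (f := fun i : ℕ+ => |f i| * (i : ℝ) ^ q) hq]
  refine summable_congr fun i => ?_
  rw [loc_rpow hh, abs_of_nonneg (hf i)]; ring

theorem moment_eq {h : ℝ} (hh : 0 < h) {q : ℝ} {f : ℕ+ → ℝ} (hf : ∀ i, 0 ≤ f i) :
    moment h q f = h ^ q * wnorm q f := by
  unfold moment wnorm
  rw [← tsum_mul_left]
  refine tsum_congr fun i => ?_
  rw [loc_rpow hh, abs_of_nonneg (hf i)]; ring

theorem moment_nonneg {h : ℝ} (hh : 0 < h) {q : ℝ} {f : ℕ+ → ℝ} (hf : ∀ i, 0 ≤ f i) :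
    0 ≤ moment h q f :=
  tsum_nonneg fun i => mul_nonneg (hf i) (Real.rpow_nonneg (loc_pos hh i).le q)

/-- Moments are logarithmically convex in the order. -/
theorem moment_interpolation {h : ℝ} (hh : 0 < h) {q₀ q₁ q lam : ℝ} (h0 : 0 < lam) (h1 : lam < 1)
    (hq : q = (1 - lam) * q₀ + lam * q₁) {f : ℕ+ → ℝ} (hf : ∀ i, 0 ≤ f i)
    (hf₀ : FiniteMoment h q₀ f) (hf₁ : FiniteMoment h q₁ f) :
    moment h q f ≤ moment h q₀ f ^ (1 - lam) * moment h q₁ f ^ lam := by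
  have h1' : 0 < 1 - lam := by linarith
  have hn : ∀ (r : ℝ) i, 0 ≤ f i * loc h i ^ r := fun r i =>
    mul_nonneg (hf i) (Real.rpow_nonneg (loc_pos hh i).le r)
  have e0 : ∀ i, ((f i * loc h i ^ q₀) ^ (1 - lam)) ^ (1 - lam)⁻¹ = f i * loc h i ^ q₀ := fun i => by
    rw [← Real.rpow_mul (hn q₀ i), mul_inv_cancel₀ h1'.ne', Real.rpow_one]
  have e1 : ∀ i, ((f i * loc h i ^ q₁) ^ lam) ^ lam⁻¹ = f i * loc h i ^ q₁ := fun i => by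
    rw [← Real.rpow_mul (hn q₁ i), mul_inv_cancel₀ h0.ne', Real.rpow_one]
  have key := Real.inner_le_Lp_mul_Lq_tsum_of_nonneg
    (Real.HolderConjugate.one_sub_inv_inv h0 h1)
    (f := fun i => (f i * loc h i ^ q₀) ^ (1 - lam)) (g := fun i => (f i * loc h i ^ q₁) ^ lam)
    (fun i => Real.rpow_nonneg (hn q₀ i) _) (fun i => Real.rpow_nonneg (hn q₁ i) _)
    (by simp only [e0]; exact hf₀) (by simp only [e1]; exact hf₁)
  simp only [e0, e1, one_div, inv_inv] at key
  refine le_trans (le_of_eq (tsum_congr fun i => ?_)) key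
  have hl := loc_pos hh i
  rw [Real.mul_rpow (hf i) (by positivity), Real.mul_rpow (hf i) (by positivity),
    ← Real.rpow_mul hl.le, ← Real.rpow_mul hl.le]
  have e2 : f i ^ (1 - lam) * f i ^ lam = f i := by
    rcases (hf i).eq_or_lt with h | h
    · rw [← h, Real.zero_rpow h0.ne', mul_zero]
    · rw [← Real.rpow_add h]; simp
  calc f i * loc h i ^ q = (f i ^ (1 - lam) * f i ^ lam)
        * (loc h i ^ (q₀ * (1 - lam)) * loc h i ^ (q₁ * lam)) := by
        rw [e2, ← Real.rpow_add hl, hq]; ring_nf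
    _ = _ := by ring

section
variable {c p δ h : ℝ} {k₁ k₂ : ℕ+ → ℕ+ → ℝ} {f₀ : ℕ+ → ℝ} {N : ℕ} {T : ℝ} {u u' : ℝ → Ell1}

theorem IsTruncatedSolution.moment_eq_sum (hu : IsTruncatedSolution δ (h ^ δ) k₁ k₂ f₀ N T u u')
    (q : ℝ) {t : ℝ} (ht : t ∈ Set.Icc 0 T) :
    (∑' i : ℕ+, if (i : ℕ) ≤ N then u t i * loc h i ^ q else 0) = moment h q (u t) :=
  tsum_congr fun i => by
    split_ifs with hi
    · rfl
    · rw [hu.support t ht i (not_le.1 hi), zero_mul]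

theorem IsTruncatedSolution.finiteMoment
    (hu : IsTruncatedSolution δ (h ^ δ) k₁ k₂ f₀ N T u u') (hh : 0 < h) (q : ℝ) {t : ℝ}
    (ht : t ∈ Set.Icc 0 T) : FiniteMoment h q (u t) :=
  (finiteMoment_iff hh (hu.nonneg t ht)).2 (wsummable_of_support (hu.support t ht) q)

theorem IsTruncatedSolution.moment_initial_le
    (hu : IsTruncatedSolution δ (h ^ δ) k₁ k₂ f₀ N T u u') (hh : 0 < h) (hT : 0 ≤ T)
    (hf₀ : ∀ i, 0 ≤ f₀ i) {q : ℝ} (hm : FiniteMoment h q f₀) :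
    moment h q (u 0) ≤ moment h q f₀ := by
  refine (hu.finiteMoment hh q ⟨le_rfl, hT⟩).tsum_le_tsum (fun i => ?_) hm
  have := Real.rpow_nonneg (loc_pos hh i).le q
  refine mul_le_mul_of_nonneg_right ?_ this
  rw [hu.initial i]
  split_ifs
  exacts [le_rfl, hf₀ i]

theorem tsum_damping_eq_moment (hh : 0 < h) (q : ℝ) (f : ℕ+ → ℝ) :
    ∑' i : ℕ+, h ^ δ * (i : ℝ) ^ δ * f i * loc h i ^ q = moment h (δ + q) f :=
  tsum_congr fun i => by
    rw [Real.rpow_add (loc_pos hh i), loc_rpow hh δ]; ring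

/-- Merging and splitting preserve the first moment, and damping decreases it. -/
theorem IsTruncatedSolution.moment_one_le (hk : KernelBound c p k₁ k₂)
    (hu : IsTruncatedSolution δ (h ^ δ) k₁ k₂ f₀ N T u u') (hh : 0 < h) (hf₀ : ∀ i, 0 ≤ f₀ i)
    (hm : FiniteMoment h 1 f₀) : ∀ t ∈ Set.Icc 0 T, moment h 1 (u t) ≤ moment h 1 f₀ := by
  intro t ht
  rw [← hu.moment_eq_sum 1 ht]
  refine le_of_deriv_nonpos_above
    (fun t ht => hu.hasDerivWithinAt_moment hk (fun i => loc h i ^ (1 : ℝ)) ht) ?_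
    (fun t ht _ => ?_) t ht
  · rw [hu.moment_eq_sum 1 ⟨le_rfl, ht.1.trans ht.2⟩]
    exact hu.moment_initial_le hh (ht.1.trans ht.2) hf₀ hm
  · have e : ∀ x : ℕ+ × ℕ+, loc h (x.1 + x.2) ^ (1 : ℝ) - loc h x.1 ^ (1 : ℝ)
        - loc h x.2 ^ (1 : ℝ) = 0 := fun x => by
      simp only [Real.rpow_one, loc_add]; ring
    simp only [e, mul_zero, tsum_zero, zero_sub]
    rw [tsum_damping_eq_moment hh]
    exact neg_nonpos.2 (moment_nonneg hh (hu.nonneg t ht))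

/-- The gain of the `κ`-th moment by coagulation; splitting only decreases it. -/
theorem tsum_flux_mul_le {a b κ : ℝ} (ha : 0 ≤ a) (hb : 0 ≤ b) (hκ : 1 < κ) (hh : 0 < h)
    (hk : KernelBound c p (kernel h a b) k₂) (N : ℕ) {f : ℕ+ → ℝ} (hf : ∀ i, 0 ≤ f i)
    (hm : ∀ q, FiniteMoment h q f) :
    ∑' x : ℕ+ × ℕ+, flux (trunc N (kernel h a b)) (trunc N k₂) f x
        * (loc h (x.1 + x.2) ^ κ - loc h x.1 ^ κ - loc h x.2 ^ κ)
      ≤ 2 ^ (b + 1) * gainConst a κ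
        * (moment h 1 f * moment h (2 * a + b + κ - 1) f) := by
  set r := 2 * a + b + κ - 1
  have hn : ∀ (q : ℝ) i, 0 ≤ f i * loc h i ^ q := fun q i =>
    mul_nonneg (hf i) (Real.rpow_nonneg (loc_pos hh i).le q)
  obtain ⟨s1, e1⟩ := summable_prod_mul (hm r) (hm 1) (hn r) (hn 1)
  obtain ⟨s2, e2⟩ := summable_prod_mul (hm 1) (hm r) (hn 1) (hn r)
  have hG := gainConst_nonneg (a := a) hκ
  have hpt : ∀ x : ℕ+ × ℕ+, flux (trunc N (kernel h a b)) (trunc N k₂) f x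
        * (loc h (x.1 + x.2) ^ κ - loc h x.1 ^ κ - loc h x.2 ^ κ)
      ≤ 2 ^ b * gainConst a κ * ((f x.1 * loc h x.1 ^ r) * (f x.2 * loc h x.2 ^ (1 : ℝ))
        + (f x.1 * loc h x.1 ^ (1 : ℝ)) * (f x.2 * loc h x.2 ^ r)) := by
    rintro ⟨i, j⟩
    have hi := loc_pos hh i
    have hj := loc_pos hh j
    have hfi := hf i
    have hfj := hf j
    have hΔ : 0 ≤ loc h (i + j) ^ κ - loc h i ^ κ - loc h j ^ κ := by
      rw [loc_add]
      linarith [Real.add_rpow_le_rpow_add hi.le hj.le hκ.le]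
    have hgain := kernel_gain_le ha hb hκ hi hj
    have h2 : 0 ≤ trunc N k₂ i j * f (i + j) * f j :=
      mul_nonneg (mul_nonneg ((hk.trunc N).nonneg₂ i j) (hf _)) hfj
    have h1 : trunc N (kernel h a b) i j ≤ kernel h a b i j := by
      unfold trunc; split_ifs
      exacts [le_rfl, hk.nonneg₁ i j]
    simp only [flux, Real.rpow_one]
    have h3 := mul_le_mul_of_nonneg_right h1 (mul_nonneg (mul_nonneg hfi hfj) hΔ)
    have h4 := mul_nonneg h2 hΔ
    have h5 : kernel h a b i j * (f i * f j * (loc h (i + j) ^ κ - loc h i ^ κ - loc h j ^ κ))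
        ≤ 2 ^ b * gainConst a κ * ((f i * loc h i ^ r) * (f j * loc h j)
          + (f i * loc h i) * (f j * loc h j ^ r)) := by
      have := mul_le_mul_of_nonneg_left hgain (mul_nonneg hfi hfj)
      rw [loc_add]
      unfold kernel
      refine le_trans (le_of_eq ?_) (this.trans (le_of_eq ?_)) <;> ring
    linarith
  have hfin : Summable fun x : ℕ+ × ℕ+ => flux (trunc N (kernel h a b)) (trunc N k₂) f x
        * (loc h (x.1 + x.2) ^ κ - loc h x.1 ^ κ - loc h x.2 ^ κ) := by
    refine summable_of_hasFiniteSupport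
      (((finite_le N).prod (finite_le N)).subset fun x hx => ?_)
    by_contra hx'
    rw [Function.mem_support] at hx
    refine hx ?_
    have : ¬ ((x.1 + x.2 : ℕ+) : ℕ) ≤ N := fun hle => hx' (by
      rw [PNat.add_coe] at hle
      exact ⟨show (x.1 : ℕ) ≤ N by omega, show (x.2 : ℕ) ≤ N by omega⟩)
    simp only [flux, trunc, if_neg this]
    ring
  refine (hfin.tsum_le_tsum hpt ((s1.add s2).mul_left _)).trans (le_of_eq ?_)
  rw [tsum_mul_left, s1.tsum_add s2, e1, e2, Real.rpow_add_one (by norm_num)]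
  unfold moment
  ring

/-- The moment of order `κ` cannot grow while it exceeds `2 ℬ_κ`, since then the damping term, which
is the moment of order `δ + κ`, dominates the gain. -/
theorem IsTruncatedSolution.moment_le {a b κ : ℝ} (ha : 0 ≤ a) (hb : 0 ≤ b) (hδ : a + b < δ)
    (hδ₁ : 2 * a + b - 1 < δ) (hκ : 1 < κ) (hκab : 2 - a - b < κ) (hh : 0 < h)
    (hk : KernelBound c p (kernel h a b) k₂)
    (hu : IsTruncatedSolution δ (h ^ δ) (kernel h a b) k₂ f₀ N T u u') (hf₀ : ∀ i, 0 ≤ f₀ i)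
    (hm1 : FiniteMoment h 1 f₀) (hm : FiniteMoment h κ f₀) :
    ∀ t ∈ Set.Icc 0 T, moment h κ (u t) ≤
      max (moment h κ f₀) (2 * boundB a b δ κ (moment h 1 f₀)) := by
  intro t ht
  rw [← hu.moment_eq_sum κ ht]
  refine le_of_deriv_nonpos_above
    (fun t ht => hu.hasDerivWithinAt_moment hk (fun i => loc h i ^ κ) ht) ?_
    (fun t ht hlt => ?_) t ht
  · rw [hu.moment_eq_sum κ ⟨le_rfl, ht.1.trans ht.2⟩]
    exact le_max_of_le_left (hu.moment_initial_le hh (ht.1.trans ht.2) hf₀ hm)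
  · rw [hu.moment_eq_sum κ ht] at hlt
    replace hlt := (le_max_right _ _).trans_lt hlt
    have hn := hu.nonneg t ht
    have hfm := fun q => hu.finiteMoment hh q ht
    have h1 := hu.moment_one_le hk hh hf₀ hm1 t ht
    have hgain := tsum_flux_mul_le ha hb hκ hh hk N hn hfm
    rw [tsum_damping_eq_moment hh]
    set X := moment h 1 f₀
    set y := moment h (δ + κ) (u t)
    have hX : 0 ≤ X := moment_nonneg hh hf₀
    have hy : 0 ≤ y := moment_nonneg hh hn
    have hm0 : ∀ q, 0 ≤ moment h q (u t) := fun q => moment_nonneg hh hn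
    have hδ0 : 0 < δ := by linarith
    have hs : 0 < δ + κ - 1 := by linarith
    -- interpolation of both moments between the orders `1` and `δ + κ`
    have hi1 : moment h κ (u t) ≤ X ^ (δ / (δ + κ - 1)) * y ^ ((κ - 1) / (δ + κ - 1)) := by
      have hc : 1 - (κ - 1) / (δ + κ - 1) = δ / (δ + κ - 1) := by field_simp; ring
      have := moment_interpolation hh (q₀ := 1) (q₁ := δ + κ) (q := κ)
        (lam := (κ - 1) / (δ + κ - 1)) (div_pos (by linarith) hs)
        ((div_lt_one hs).2 (by linarith)) (by field_simp; ring) hn (hfm _) (hfm _)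
      rw [hc] at this
      refine this.trans (mul_le_mul_of_nonneg_right ?_ (by positivity))
      exact Real.rpow_le_rpow (hm0 1) h1 (by positivity)
    have hi2 : moment h (2 * a + b + κ - 1) (u t) ≤ X ^ ((δ - 2 * a - b + 1) / (δ + κ - 1))
        * y ^ ((2 * a + b + κ - 2) / (δ + κ - 1)) := by
      have hc : 1 - (2 * a + b + κ - 2) / (δ + κ - 1)
          = (δ - 2 * a - b + 1) / (δ + κ - 1) := by field_simp; ring
      have := moment_interpolation hh (q₀ := 1) (q₁ := δ + κ) (q := 2 * a + b + κ - 1)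
        (lam := (2 * a + b + κ - 2) / (δ + κ - 1)) (div_pos (by linarith) hs)
        ((div_lt_one hs).2 (by linarith)) (by field_simp; ring) hn (hfm _) (hfm _)
      rw [hc] at this
      refine this.trans (mul_le_mul_of_nonneg_right ?_ (by positivity))
      exact Real.rpow_le_rpow (hm0 1) h1 (div_nonneg (by linarith) hs.le)
    have hd := gain_le_damping ha hb hδ hδ₁ hκ hκab hX hy (hlt.trans_le hi1)
    have hG := gainConst_nonneg (a := a) hκ
    have h3 := mul_le_mul_of_nonneg_left (mul_le_mul h1 hi2 (hm0 _) hX)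
      (by positivity : 0 ≤ 2 ^ (b + 1) * gainConst a κ)
    linarith

end

/-! ### Stability and passage to the limit -/

/-- Continuous dependence on the initial data and on the kernels. The growth rate depends only on
a bound for the weighted norms of order `p`, which is below the order `δ` of the damping. -/
theorem exists_stability {c p δ cd M : ℝ} (hp : 0 ≤ p) (hpδ : p < δ) (hcd : 0 < cd) (hM : 0 ≤ M)
    (hc : 0 ≤ c) :
    ∃ C > 0, ∀ (k₁ k₂ l₁ l₂ : ℕ+ → ℕ+ → ℝ), KernelBound c p k₁ k₂ → KernelBound c p l₁ l₂ →
      ∀ (f f' g g' : ℝ → Ell1) (T η : ℝ),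
      (∀ t ∈ Set.Icc 0 T, HasDerivWithinAt f (f' t) (Set.Icc 0 T) t) →
      (∀ t ∈ Set.Icc 0 T, HasDerivWithinAt g (g' t) (Set.Icc 0 T) t) →
      (∀ t ∈ Set.Icc 0 T, ∀ i : ℕ+,
        f' t i = transfer (flux k₁ k₂ (f t)) i - cd * (i : ℝ) ^ δ * f t i) →
      (∀ t ∈ Set.Icc 0 T, ∀ i : ℕ+,
        g' t i = transfer (flux l₁ l₂ (g t)) i - cd * (i : ℝ) ^ δ * g t i) →
      (∀ t ∈ Set.Icc 0 T, WSummable δ (f t) ∧ wnorm p (f t) ≤ M) →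
      (∀ t ∈ Set.Icc 0 T, WSummable δ (g t) ∧ wnorm p (g t) ≤ M) →
      (∀ t ∈ Set.Icc 0 T, ∑' x, |flux k₁ k₂ (g t) x - flux l₁ l₂ (g t) x| ≤ η) →
      ∀ t ∈ Set.Icc 0 T, ‖f t - g t‖ ≤ Real.exp (C * t) * (‖f 0 - g 0‖ + 3 * η / C) := by
  obtain ⟨C, hC, habs⟩ := exists_absorption hp hpδ hcd (by positivity : 0 ≤ 12 * c * M)
  refine ⟨C, hC, fun k₁ k₂ l₁ l₂ hk hl f f' g g' T η hf hg hf' hg' hfM hgM hη t ht => ?_⟩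
  have hη0 : 0 ≤ η := (tsum_nonneg fun _ => abs_nonneg _).trans (hη t ht)
  have key := Ell1.norm_le_of_dissipative (u := fun t => f t - g t) (u' := fun t => f' t - g' t)
    (T := T) (C := C) (ε := 3 * η) hC (fun t ht => (hf t ht).sub (hg t ht)) ?_ t ht
  · have : 0 ≤ 3 * η / C := by positivity
    linarith
  intro s hs
  obtain ⟨hfs, hfb⟩ := hfM s hs
  obtain ⟨hgs, hgb⟩ := hgM s hs
  have hfp := hfs.mono hpδ.le
  have hgp := hgs.mono hpδ.le
  have hd := damped_sub_dissipative (summable_flux hk hfp) (summable_flux hl hgp) hcd.le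
    (hfs.sub hgs)
  have hb1 := flux_sub_bound hk hfp hgp
  have hs2 : Summable fun x => |flux k₁ k₂ (g s) x - flux l₁ l₂ (g s) x| :=
    ((summable_flux hk hgp).sub (summable_flux hl hgp)).abs
  have hs3 : Summable fun x => |flux k₁ k₂ (f s) x - flux l₁ l₂ (g s) x| :=
    ((summable_flux hk hfp).sub (summable_flux hl hgp)).abs
  have htri : ∑' x, |flux k₁ k₂ (f s) x - flux l₁ l₂ (g s) x|
      ≤ 2 * c * (wnorm p (f s) + wnorm p (g s)) * wnorm p (f s - g s : ℕ+ → ℝ) + η := by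
    refine (hs3.tsum_le_tsum (fun x => abs_sub_le _ (flux k₁ k₂ (g s) x) _)
      (hb1.1.add hs2)).trans ?_
    rw [hb1.1.tsum_add hs2]
    exact add_le_add hb1.2 (hη s hs)
  have hK : 2 * c * (wnorm p (f s) + wnorm p (g s)) * wnorm p (f s - g s : ℕ+ → ℝ)
      ≤ 4 * c * M * wnorm p (f s - g s : ℕ+ → ℝ) := by
    refine mul_le_mul_of_nonneg_right ?_ (wnorm_nonneg _ _)
    have := mul_le_mul_of_nonneg_left (add_le_add hfb hgb) (by positivity : 0 ≤ 2 * c)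
    linarith
  have ha := habs _ (hfs.sub hgs)
  have e0 : wnorm 0 ((f s : ℕ+ → ℝ) - g s) = ‖f s - g s‖ := by
    rw [← Ell1.wnorm_zero]; rfl
  rw [e0] at ha
  have e1 : ∑' i, (f' s - g' s) i * ((SignType.sign ((f s - g s) i) : SignType) : ℝ)
      = ∑' i : ℕ+, ((transfer (flux k₁ k₂ (f s)) i - cd * (i : ℝ) ^ δ * f s i)
        - (transfer (flux l₁ l₂ (g s)) i - cd * (i : ℝ) ^ δ * g s i))
          * ((SignType.sign (f s i - g s i) : SignType) : ℝ) := tsum_congr fun i => by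
    rw [← hf' s hs i, ← hg' s hs i]; simp
  simp only
  rw [e1]
  linarith

theorem trunc_trunc {N N' : ℕ} (h : N ≤ N') (k : ℕ+ → ℕ+ → ℝ) :
    trunc N (trunc N' k) = trunc N k := by
  funext i j
  unfold trunc
  split_ifs with h1 h2
  · rfl
  · omega
  · rfl

theorem IsTruncatedSolution.mono {δ cd : ℝ} {k₁ k₂ : ℕ+ → ℕ+ → ℝ} {f₀ : ℕ+ → ℝ} {N : ℕ}
    {T T' : ℝ} {u u' : ℝ → Ell1} (h : IsTruncatedSolution δ cd k₁ k₂ f₀ N T u u') (hT : T' ≤ T) :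
    IsTruncatedSolution δ cd k₁ k₂ f₀ N T' u u' :=
  have hs : Set.Icc 0 T' ⊆ Set.Icc 0 T := Set.Icc_subset_Icc_right hT
  { initial := h.initial
    nonneg := fun t ht => h.nonneg t (hs ht)
    support := fun t ht => h.support t (hs ht)
    hasDeriv := fun t ht => (h.hasDeriv t (hs ht)).mono hs
    deriv_apply := fun t ht => h.deriv_apply t (hs ht) }

theorem norm_truncated_initial_sub_le {δ cd κ : ℝ} {k₁ k₂ : ℕ+ → ℕ+ → ℝ} (hκ : 0 ≤ κ)
    {f₀ : ℕ+ → ℝ} (hκf : WSummable κ f₀) {N N' : ℕ} (hN : 0 < N) (hNN : N ≤ N')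
    {T T' : ℝ} {u u' v v' : ℝ → Ell1} (hu : IsTruncatedSolution δ cd k₁ k₂ f₀ N T u u')
    (hv : IsTruncatedSolution δ cd k₁ k₂ f₀ N' T' v v') :
    ‖v 0 - u 0‖ ≤ (N : ℝ) ^ (-κ) * wnorm κ f₀ := by
  have hN' : (0 : ℝ) < N := by exact_mod_cast hN
  rw [Ell1.norm_eq]
  unfold wnorm
  rw [← tsum_mul_left]
  refine (Ell1.summable_abs _).tsum_le_tsum (fun i => ?_) (hκf.mul_left _)
  have hi := cast_pos i
  have e : (v 0 - u 0) i = v 0 i - u 0 i := rfl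
  rw [e, hu.initial, hv.initial]
  have h0 : 0 ≤ (N : ℝ) ^ (-κ) * (|f₀ i| * (i : ℝ) ^ κ) := by positivity
  split_ifs with h1 h2 h3
  · simpa using h0
  · have h4 : (N : ℝ) ≤ i := by exact_mod_cast (not_le.1 h2).le
    have h5 : 1 ≤ (N : ℝ) ^ (-κ) * (i : ℝ) ^ κ := by
      have := Real.rpow_le_rpow hN'.le h4 hκ
      rw [Real.rpow_neg hN'.le, inv_mul_eq_div, one_le_div (by positivity)]
      exact this
    rw [sub_zero]
    have := mul_le_mul_of_nonneg_left h5 (abs_nonneg (f₀ i))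
    linarith
  · omega
  · simpa using h0

/-- A family of truncated solutions with a uniform bound on a weighted norm of order `κ`. The
solution with cut-off size `N` lives on the time interval `[0, N]`. -/
structure IsTruncatedFamily (δ cd κ M : ℝ) (k₁ k₂ : ℕ+ → ℕ+ → ℝ) (f₀ : ℕ+ → ℝ)
    (u u' : ℕ → ℝ → Ell1) : Prop where
  sol : ∀ N : ℕ, 0 < N → IsTruncatedSolution δ cd k₁ k₂ f₀ N N (u N) (u' N)
  bound : ∀ N : ℕ, 0 < N → ∀ t ∈ Set.Icc (0 : ℝ) N, wnorm κ (u N t) ≤ M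

section

variable {c p δ cd κ M : ℝ} {k₁ k₂ : ℕ+ → ℕ+ → ℝ} {f₀ : ℕ+ → ℝ} {u u' : ℕ → ℝ → Ell1}

theorem IsTruncatedFamily.wsummable (hu : IsTruncatedFamily δ cd κ M k₁ k₂ f₀ u u')
    {N : ℕ} (hN : 0 < N) {t : ℝ} (ht : t ∈ Set.Icc (0 : ℝ) N) (q : ℝ) : WSummable q (u N t) :=
  wsummable_of_support ((hu.sol N hN).support t ht) q

/-- Truncated solutions form a uniform Cauchy sequence on `[0, T]`: by `exists_stability`, their
distance is controlled by the tail of the initial data and the error in the kernels. -/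
theorem IsTruncatedFamily.exists_dist_le (hu : IsTruncatedFamily δ cd κ M k₁ k₂ f₀ u u')
    (hp : 0 ≤ p) (hpδ : p < δ) (hδκ : δ < κ) (hcd : 0 < cd) (hM : 0 ≤ M)
    (hk : KernelBound c p k₁ k₂) (hκf : WSummable κ f₀) (T : ℝ) :
    ∃ b : ℕ → ℝ, Filter.Tendsto b Filter.atTop (nhds 0) ∧
      ∀ N N' : ℕ, 0 < N → N ≤ N' → T ≤ N → ∀ t ∈ Set.Icc 0 T, ‖u N' t - u N t‖ ≤ b N := by
  obtain ⟨C, hC, hst⟩ := exists_stability hp hpδ hcd hM hk.const_nonneg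
  have hκ : 0 < κ := by linarith
  have hc := hk.const_nonneg
  refine ⟨fun N => Real.exp (C * T) * ((N : ℝ) ^ (-κ) * wnorm κ f₀
    + 3 * (2 * c * (2 / N) ^ (δ - p) * M ^ 2) / C), ?_, fun N N' hN hNN hT t ht => ?_⟩
  · have h1 : Filter.Tendsto (fun N : ℕ => (N : ℝ) ^ (-κ)) Filter.atTop (nhds 0) :=
      (tendsto_rpow_neg_atTop hκ).comp tendsto_natCast_atTop_atTop
    have h2 : Filter.Tendsto (fun N : ℕ => (2 / N : ℝ) ^ (δ - p)) Filter.atTop (nhds 0) := by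
      have h3 : Filter.Tendsto (fun N : ℕ => (2 / N : ℝ)) Filter.atTop (nhds 0) :=
        tendsto_const_nhds.div_atTop tendsto_natCast_atTop_atTop
      have := h3.rpow_const (p := δ - p) (Or.inr (by linarith))
      rwa [Real.zero_rpow (by linarith)] at this
    have := ((h1.mul_const (wnorm κ f₀)).add
      ((((h2.const_mul (2 * c)).mul_const (M ^ 2)).const_mul 3).div_const C)).const_mul
        (Real.exp (C * T))
    simpa using this
  · have hTN : T ≤ (N' : ℝ) := hT.trans (by exact_mod_cast hNN)
    have hN' : 0 < N' := hN.trans_le hNN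
    have hvN := (hu.sol N' hN').mono hTN
    have huN := (hu.sol N hN).mono hT
    have hsub : ∀ {t}, t ∈ Set.Icc 0 T → t ∈ Set.Icc (0 : ℝ) N := fun ht => ⟨ht.1, ht.2.trans hT⟩
    have hsub' : ∀ {t}, t ∈ Set.Icc 0 T → t ∈ Set.Icc (0 : ℝ) N' :=
      fun ht => ⟨ht.1, ht.2.trans hTN⟩
    have hpκ : p ≤ κ := by linarith
    have h1 := hst (trunc N' k₁) (trunc N' k₂) (trunc N k₁) (trunc N k₂) (hk.trunc N') (hk.trunc N)
      (u N') (u' N') (u N) (u' N) T (2 * c * (2 / N) ^ (δ - p) * M ^ 2)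
      hvN.hasDeriv huN.hasDeriv hvN.deriv_apply huN.deriv_apply
      (fun t ht => ⟨hu.wsummable hN' (hsub' ht) δ,
        (wnorm_mono (hu.wsummable hN' (hsub' ht) κ) hpκ).trans (hu.bound N' hN' t (hsub' ht))⟩)
      (fun t ht => ⟨hu.wsummable hN (hsub ht) δ,
        (wnorm_mono (hu.wsummable hN (hsub ht) κ) hpκ).trans (hu.bound N hN t (hsub ht))⟩)
      (fun t ht => by
        have h2 := flux_trunc_bound (hk.trunc N') hpδ.le (hu.wsummable hN (hsub ht) δ) hN
        rw [trunc_trunc hNN, trunc_trunc hNN] at h2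
        refine h2.trans (mul_le_mul_of_nonneg_left ?_ (by positivity))
        exact pow_le_pow_left₀ (wnorm_nonneg _ _)
          ((wnorm_mono (hu.wsummable hN (hsub ht) κ) hδκ.le).trans (hu.bound N hN t (hsub ht))) 2)
      t ht
    refine h1.trans (mul_le_mul ?_ ?_ (by positivity) (by positivity))
    · exact Real.exp_le_exp.2 (mul_le_mul_of_nonneg_left ht.2 hC.le)
    · exact add_le_add_left (norm_truncated_initial_sub_le hκ.le hκf hN hNN huN hvN) _

/-- Fatou's lemma for weighted sums along a sequence that converges in `ℓ¹`. -/
theorem le_of_tendsto_wnorm {v : ℕ → Ell1} {w : Ell1}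
    (hv : Filter.Tendsto v Filter.atTop (nhds w)) {L : ℝ} {a : ℕ+ → ℝ} (ha : ∀ i, 0 ≤ a i)
    (hL : ∀ᶠ N in Filter.atTop, (Summable fun i => |v N i| * a i) ∧ ∑' i, |v N i| * a i ≤ L) :
    (Summable fun i => |w i| * a i) ∧ ∑' i, |w i| * a i ≤ L := by
  have hfin : ∀ s : Finset ℕ+, ∑ i ∈ s, |w i| * a i ≤ L := fun s => by
    have hlim : Filter.Tendsto (fun N => ∑ i ∈ s, |v N i| * a i) Filter.atTop
        (nhds (∑ i ∈ s, |w i| * a i)) :=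
      tendsto_finsetSum s fun i _ =>
        ((((evalCLM i).continuous.tendsto w).comp hv).abs).mul_const (a i)
    refine le_of_tendsto hlim (hL.mono fun N hN => ?_)
    exact (hN.1.sum_le_tsum s fun i _ => mul_nonneg (abs_nonneg _) (ha i)).trans hN.2
  have hn : ∀ i, 0 ≤ |w i| * a i := fun i => mul_nonneg (abs_nonneg _) (ha i)
  exact ⟨summable_of_sum_le hn hfin, Real.tsum_le_of_sum_le hn hfin⟩

/-- The `ℓ¹` modulus of continuity of the right-hand side on sets that are bounded in the weighted
norm of order `κ`. -/
theorem exists_modulus (hp : 0 ≤ p) (hpδ : p < δ) (hδκ : δ < κ) (hcd : 0 < cd) (hM : 0 ≤ M)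
    (hc : 0 ≤ c) {ε : ℝ} (hε : 0 < ε) :
    ∃ d > 0, ∀ f g : ℕ+ → ℝ, WSummable κ f → WSummable κ g → wnorm κ f ≤ M → wnorm κ g ≤ M →
      wnorm 0 (f - g) ≤ d →
      6 * c * (wnorm p f + wnorm p g) * wnorm p (f - g) + cd * wnorm δ (f - g) ≤ ε := by
  set K : ℝ := 12 * c * M + cd
  have hK : 0 < K := by positivity
  obtain ⟨R, hR0, hR⟩ : ∃ R : ℝ, 0 < R ∧ K * (R ^ (δ - κ) * (2 * M)) ≤ ε / 2 := by
    have h1 : Filter.Tendsto (fun R : ℝ => K * (R ^ (-(κ - δ)) * (2 * M))) Filter.atTop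
        (nhds 0) := by
      have := ((tendsto_rpow_neg_atTop (sub_pos.2 hδκ)).mul_const (2 * M)).const_mul K
      simpa using this
    obtain ⟨R, hR, hR'⟩ := ((h1.eventually (gt_mem_nhds (half_pos hε))).and
      (Filter.eventually_gt_atTop 0)).exists
    rw [neg_sub] at hR
    exact ⟨R, hR', hR.le⟩
  refine ⟨ε / 2 / (K * R ^ δ), by positivity, fun f g hf hg hfM hgM hd => ?_⟩
  have hu := hf.sub hg
  have huδ : WSummable δ (f - g) := hu.mono hδκ.le
  have h1 := wnorm_interpolation (by linarith : 0 ≤ δ) hδκ.le hR0 hu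
  have h2 : wnorm κ (f - g) ≤ 2 * M := (wnorm_sub_le hf hg).trans (by linarith)
  have h3 : wnorm p (f - g) ≤ wnorm δ (f - g) := wnorm_mono huδ hpδ.le
  have hfp := (wnorm_mono hf (by linarith : p ≤ κ)).trans hfM
  have hgp := (wnorm_mono hg (by linarith : p ≤ κ)).trans hgM
  have h4 : 6 * c * (wnorm p f + wnorm p g) * wnorm p (f - g)
      ≤ 12 * c * M * wnorm δ (f - g) := by
    refine mul_le_mul ?_ h3 (wnorm_nonneg _ _) (by positivity)
    have := mul_le_mul_of_nonneg_left (add_le_add hfp hgp) (by positivity : 0 ≤ 6 * c)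
    linarith
  have h5 : R ^ δ * wnorm 0 (f - g) ≤ ε / 2 / K := by
    have := mul_le_mul_of_nonneg_left hd (by positivity : 0 ≤ R ^ δ)
    refine this.trans (le_of_eq ?_)
    field_simp
  have h6 : R ^ (δ - κ) * wnorm κ (f - g) ≤ R ^ (δ - κ) * (2 * M) :=
    mul_le_mul_of_nonneg_left h2 (by positivity)
  have h7 : K * wnorm δ (f - g) ≤ K * (ε / 2 / K + R ^ (δ - κ) * (2 * M)) :=
    mul_le_mul_of_nonneg_left (h1.trans (add_le_add h5 h6)) hK.le
  have h8 : K * (ε / 2 / K) = ε / 2 := by field_simp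
  rw [mul_add, h8] at h7
  have e : K * wnorm δ (f - g) = 12 * c * M * wnorm δ (f - g) + cd * wnorm δ (f - g) := by
    simp only [K]; ring
  linarith

/-- Truncated solutions converge in `ℓ¹`, locally uniformly in time, to a solution of the full
system. -/
theorem IsTruncatedFamily.exists_limit (hu : IsTruncatedFamily δ cd κ M k₁ k₂ f₀ u u')
    (hp : 0 ≤ p) (hpδ : p < δ) (hδκ : δ < κ) (hcd : 0 < cd) (hM : 0 ≤ M)
    (hk : KernelBound c p k₁ k₂) (hκf : WSummable κ f₀) :
    ∃ f f' : ℝ → Ell1, Continuous f' ∧ (∀ t, HasDerivAt f (f' t) t) ∧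
      (∀ t, 0 ≤ t → Filter.Tendsto (fun N => u N t) Filter.atTop (nhds (f t))) ∧
      (∀ t, 0 ≤ t → WSummable κ (f t) ∧ wnorm κ (f t) ≤ M) ∧
      ∀ t, 0 ≤ t → ∀ i : ℕ+,
        f' t i = transfer (flux k₁ k₂ (f t)) i - cd * (i : ℝ) ^ δ * f t i := by
  have hc := hk.const_nonneg
  have hdist := hu.exists_dist_le hp hpδ hδκ hcd hM hk hκf
  -- pointwise limit
  have hlim : ∀ t : ℝ, 0 ≤ t → ∃ w, Filter.Tendsto (fun N => u N t) Filter.atTop (nhds w) := by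
    intro t ht
    obtain ⟨b, hb, hub⟩ := hdist t
    refine cauchySeq_tendsto_of_complete (Metric.cauchySeq_iff'.2 fun ε hε => ?_)
    obtain ⟨N, ⟨hN1, hN2⟩, hN3⟩ := (((hb.eventually (gt_mem_nhds hε)).and
      (Filter.eventually_gt_atTop 0)).and
      (tendsto_natCast_atTop_atTop.eventually (Filter.eventually_ge_atTop t))).exists
    refine ⟨N, fun n hn => ?_⟩
    rw [dist_eq_norm]
    exact (hub N n hN2 hn hN3 t ⟨ht, le_rfl⟩).trans_lt hN1
  choose! F₀ hF₀ using hlim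
  set F : ℝ → Ell1 := fun t => F₀ (max t 0)
  have hF : ∀ t, Filter.Tendsto (fun N => u N (max t 0)) Filter.atTop (nhds (F t)) := fun t =>
    hF₀ _ (le_max_right _ _)
  have hF' : ∀ t, 0 ≤ t → Filter.Tendsto (fun N => u N t) Filter.atTop (nhds (F t)) :=
    fun t ht => by simpa [max_eq_left ht] using hF t
  have hevN : ∀ t : ℝ, ∀ᶠ N : ℕ in Filter.atTop, 0 < N ∧ t ≤ N := fun t =>
    (Filter.eventually_gt_atTop 0).and
      (tendsto_natCast_atTop_atTop.eventually (Filter.eventually_ge_atTop t))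
  have hFκ : ∀ t, WSummable κ (F t) ∧ wnorm κ (F t) ≤ M := fun t => by
    refine le_of_tendsto_wnorm (hF t)
      (fun i => by have := cast_pos i; positivity) ((hevN (max t 0)).mono fun N hN => ?_)
    have ht : max t 0 ∈ Set.Icc (0 : ℝ) N := ⟨le_max_right _ _, hN.2⟩
    exact ⟨hu.wsummable hN.1 ht κ, hu.bound N hN.1 _ ht⟩
  -- locally uniform convergence
  have hunif : ∀ T : ℝ, TendstoUniformlyOn u F Filter.atTop (Set.Icc 0 T) := fun T => by
    obtain ⟨b, hb, hub⟩ := hdist T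
    rw [Metric.tendstoUniformlyOn_iff]
    intro ε hε
    filter_upwards [hb.eventually (gt_mem_nhds hε), hevN T] with N hN1 hN2 t ht
    refine lt_of_le_of_lt ?_ hN1
    rw [dist_eq_norm]
    refine le_of_tendsto (((hF' t ht.1).sub_const (u N t)).norm) ?_
    filter_upwards [Filter.eventually_ge_atTop N] with n hn
    exact hub N n hN2.1 hn hN2.2 t ht
  have hFcontOn : ∀ T : ℝ, ContinuousOn F (Set.Icc 0 T) := fun T => by
    refine (hunif T).continuousOn ((hevN T).frequently.mono fun N hN t ht => ?_)
    exact (((hu.sol N hN.1).mono hN.2).hasDeriv t ht).continuousWithinAt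
  have hFcont : Continuous F := by
    have h1 : ContinuousOn F (Set.Ici 0) := by
      intro t ht
      have ht0 : 0 ≤ t := ht
      refine (hFcontOn (t + 1) t ⟨ht0, by linarith⟩).mono_of_mem_nhdsWithin ?_
      exact inter_mem_nhdsWithin _ (Iic_mem_nhds (lt_add_one t))
    have e : F = fun t => F (max t 0) := by
      funext t; simp only [F]; rw [max_eq_left (le_max_right t 0)]
    rw [e]
    exact h1.comp_continuous (by fun_prop) fun t => Set.mem_Ici.2 (le_max_right t 0)
  have hFp : ∀ t, WSummable p (F t) := fun t => (hFκ t).1.mono (by linarith)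
  have hFδ : ∀ t, WSummable δ (F t) := fun t => (hFκ t).1.mono hδκ.le
  let G : ℝ → Ell1 := fun t => dampedOp hk hcd.le (F t) (hFp t) (hFδ t)
  have hGcont : Continuous G := by
    rw [Metric.continuous_iff]
    intro s ε hε
    obtain ⟨d, hd, hmod⟩ := exists_modulus hp hpδ hδκ hcd hM hc (half_pos hε)
    obtain ⟨r, hr, hrd⟩ := Metric.continuous_iff.1 hFcont s d hd
    refine ⟨r, hr, fun t ht => ?_⟩
    rw [dist_eq_norm]
    refine (norm_dampedOp_sub_le hk hcd.le _ _ _ _).trans_lt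
      ((hmod _ _ (hFκ t).1 (hFκ s).1 (hFκ t).2 (hFκ s).2 ?_).trans_lt (half_lt_self hε))
    have h1 := (hrd t ht).le
    rw [dist_eq_norm, ← Ell1.wnorm_zero] at h1
    exact h1
  -- convergence of the derivatives
  have hder : ∀ T : ℝ, ∀ ε > 0, ∀ᶠ N : ℕ in Filter.atTop, ∀ t ∈ Set.Icc 0 T,
      ‖u' N t - G t‖ ≤ ε := by
    intro T ε hε
    obtain ⟨d, hd, hmod⟩ := exists_modulus hp hpδ hδκ hcd hM hc (half_pos hε)
    have herr : Filter.Tendsto (fun N : ℕ => 3 * (2 * c * (2 / N : ℝ) ^ (δ - p) * M ^ 2))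
        Filter.atTop (nhds 0) := by
      have h3 : Filter.Tendsto (fun N : ℕ => (2 / N : ℝ)) Filter.atTop (nhds 0) :=
        tendsto_const_nhds.div_atTop tendsto_natCast_atTop_atTop
      have h4 := h3.rpow_const (p := δ - p) (Or.inr (by linarith))
      rw [Real.zero_rpow (by linarith)] at h4
      have := ((h4.const_mul (2 * c)).mul_const (M ^ 2)).const_mul 3
      simpa using this
    filter_upwards [Metric.tendstoUniformlyOn_iff.1 (hunif T) d hd, hevN T,
      herr.eventually (gt_mem_nhds (half_pos hε))] with N hN1 hN2 hN3 t ht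
    have htN : t ∈ Set.Icc (0 : ℝ) N := ⟨ht.1, ht.2.trans hN2.2⟩
    have hs := hu.wsummable hN2.1 htN
    have hb := hu.bound N hN2.1 t htN
    have h1 := hmod (u N t) (F t) (hs κ) (hFκ t).1 hb (hFκ t).2 (by
      have h2 := (hN1 t ht).le
      rw [dist_comm, dist_eq_norm, ← Ell1.wnorm_zero] at h2
      exact h2)
    have hA := summable_flux (hk.trunc N) (hs p)
    have hA' := summable_flux hk (hs p)
    have hB := summable_flux hk (hFp t)
    have h2 := (damped_sub_bound hA hB hcd.le ((hs δ).sub (hFδ t))).2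
    have h3 : ∑' x, |flux (trunc N k₁) (trunc N k₂) (u N t) x - flux k₁ k₂ (F t) x|
        ≤ 2 * c * (2 / N : ℝ) ^ (δ - p) * M ^ 2
          + 2 * c * (wnorm p (u N t) + wnorm p (F t)) * wnorm p ((u N t : ℕ+ → ℝ) - F t) := by
      have h4 := flux_trunc_bound hk hpδ.le (hs δ) hN2.1
      have h5 := (flux_sub_bound hk (hs p) (hFp t)).2
      have h6 := (hA'.sub hA).abs
      have h7 := (hA'.sub hB).abs
      refine ((hA.sub hB).abs.tsum_le_tsum (fun x => ?_) (h6.add h7)).trans ?_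
      · have := abs_sub_le (flux (trunc N k₁) (trunc N k₂) (u N t) x) (flux k₁ k₂ (u N t) x)
          (flux k₁ k₂ (F t) x)
        rwa [abs_sub_comm (flux (trunc N k₁) (trunc N k₂) (u N t) x)
          (flux k₁ k₂ (u N t) x)] at this
      · rw [h6.tsum_add h7]
        refine add_le_add (h4.trans (mul_le_mul_of_nonneg_left ?_ (by positivity))) h5
        exact pow_le_pow_left₀ (wnorm_nonneg _ _) ((wnorm_mono (hs κ) hδκ.le).trans hb) 2
    have e : ‖u' N t - G t‖ = ∑' i : ℕ+,
        |(transfer (flux (trunc N k₁) (trunc N k₂) (u N t)) i - cd * (i : ℝ) ^ δ * u N t i)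
          - (transfer (flux k₁ k₂ (F t)) i - cd * (i : ℝ) ^ δ * F t i)| := by
      rw [Ell1.norm_eq]
      refine tsum_congr fun i => ?_
      rw [← (hu.sol N hN2.1).deriv_apply t htN i]
      rfl
    rw [e]
    linarith
  let Φ : ℝ → Ell1 := fun t => F 0 + ∫ s in (0 : ℝ)..t, G s
  have hΦ : ∀ t, HasDerivAt Φ (G t) t := fun t =>
    (intervalIntegral.integral_hasDerivAt_right (hGcont.intervalIntegrable _ _)
      (hGcont.stronglyMeasurableAtFilter _ _) hGcont.continuousAt).const_add _
  have hΦ0 : Φ 0 = F 0 := by simp [Φ]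
  have hΦF : ∀ t, 0 ≤ t → Φ t = F t := by
    intro t ht
    have hle : ∀ ε > 0, ‖(F t - Φ t) - (F 0 - Φ 0)‖ ≤ ε * t := by
      intro ε hε
      refine le_of_tendsto ((((hF' t ht).sub_const (Φ t)).sub
        ((hF' 0 le_rfl).sub_const (Φ 0))).norm) ?_
      filter_upwards [hder t ε hε, hevN t] with N hN1 hN2
      have := (convex_Icc (0 : ℝ) t).norm_image_sub_le_of_norm_hasDerivWithin_le
        (f := fun s => u N s - Φ s) (f' := fun s => u' N s - G s) (C := ε)
        (fun s hs => (((hu.sol N hN2.1).mono hN2.2).hasDeriv s hs).sub (hΦ s).hasDerivWithinAt)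
        hN1 ⟨le_rfl, ht⟩ ⟨ht, le_rfl⟩
      simpa [abs_of_nonneg ht] using this
    rw [hΦ0, sub_self, sub_zero] at hle
    have h0 : ‖F t - Φ t‖ ≤ 0 := by
      refine le_of_forall_pos_le_add fun ε hε => ?_
      rw [zero_add]
      refine (hle (ε / (t + 1)) (by positivity)).trans ?_
      rw [div_mul_eq_mul_div, div_le_iff₀ (by positivity)]
      nlinarith
    exact (sub_eq_zero.1 (norm_le_zero_iff.1 h0)).symm
  refine ⟨Φ, G, hGcont, hΦ, fun t ht => ?_, fun t ht => ?_, fun t ht i => ?_⟩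
  · rw [hΦF t ht]; exact hF' t ht
  · rw [hΦF t ht]; exact hFκ t
  · rw [hΦF t ht]; rfl

end

/-! ### The kernels of the coagulation–fragmentation system -/

theorem kernel_nonneg {h : ℝ} (hh : 0 < h) (a b : ℝ) (i j : ℕ+) : 0 ≤ kernel h a b i j := by
  have := loc_pos hh i
  have := loc_pos hh j
  unfold kernel
  positivity

theorem kernel_comm (h a b : ℝ) (i j : ℕ+) : kernel h a b i j = kernel h a b j i := by
  unfold kernel
  rw [add_comm (loc h i), mul_comm (loc h i ^ a)]

theorem cast_add_eq (i j : ℕ+) : ((i + j : ℕ+) : ℝ) = (i : ℝ) + j := by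
  rw [PNat.add_coe]; push_cast; rfl

theorem kernel_eq {h : ℝ} (hh : 0 < h) (a b : ℝ) (i j : ℕ+) :
    kernel h a b i j = h ^ (2 * a + b) * ((i : ℝ) ^ a * (j : ℝ) ^ a * ((i + j : ℕ+) : ℝ) ^ b) := by
  unfold kernel
  rw [← loc_add, loc_rpow hh, loc_rpow hh, loc_rpow hh]
  have : h ^ (2 * a + b) = h ^ a * h ^ a * h ^ b := by
    rw [← Real.rpow_add hh, ← Real.rpow_add hh]; ring_nf
  rw [this]; ring

theorem kernel_le₁ {h a b p : ℝ} (hh : 0 < h) (hb : 0 ≤ b) (hp : a + b ≤ p)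
    (i j : ℕ+) :
    kernel h a b i j ≤ h ^ (2 * a + b) * 2 ^ b * ((i : ℝ) ^ p * (j : ℝ) ^ p) := by
  have hi := one_le_cast i
  have hj := one_le_cast j
  have hi0 := cast_pos i
  have hj0 := cast_pos j
  rw [kernel_eq hh, mul_assoc (h ^ _)]
  refine mul_le_mul_of_nonneg_left ?_ (by positivity)
  have h1 : ((i + j : ℕ+) : ℝ) ^ b ≤ 2 ^ b * ((i : ℝ) ^ b * (j : ℝ) ^ b) := by
    rw [← Real.mul_rpow hi0.le hj0.le, ← Real.mul_rpow (by norm_num) (by positivity), cast_add_eq]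
    exact Real.rpow_le_rpow (by positivity) (by nlinarith) hb
  have h2 : (i : ℝ) ^ (a + b) ≤ (i : ℝ) ^ p := Real.rpow_le_rpow_of_exponent_le hi hp
  have h3 : (j : ℝ) ^ (a + b) ≤ (j : ℝ) ^ p := Real.rpow_le_rpow_of_exponent_le hj hp
  calc (i : ℝ) ^ a * (j : ℝ) ^ a * ((i + j : ℕ+) : ℝ) ^ b
      ≤ (i : ℝ) ^ a * (j : ℝ) ^ a * (2 ^ b * ((i : ℝ) ^ b * (j : ℝ) ^ b)) :=
        mul_le_mul_of_nonneg_left h1 (by positivity)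
    _ = 2 ^ b * ((i : ℝ) ^ (a + b) * (j : ℝ) ^ (a + b)) := by
        rw [Real.rpow_add hi0, Real.rpow_add hj0]; ring
    _ ≤ _ := mul_le_mul_of_nonneg_left (mul_le_mul h2 h3 (by positivity) (by positivity))
        (by positivity)

theorem kernel_le₂ {h a b p : ℝ} (hh : 0 < h) (ha : 0 ≤ a) (hb : 0 ≤ b) (hp : a + b ≤ p)
    (i j : ℕ+) :
    kernel h a b i j
      ≤ h ^ (2 * a + b) * 2 ^ b * (((i + j : ℕ+) : ℝ) ^ p * (j : ℝ) ^ p) := by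
  have hj := one_le_cast j
  have hi0 := cast_pos i
  have hj0 := cast_pos j
  have hij0 := cast_pos (i + j)
  have hij := one_le_cast (i + j)
  rw [kernel_eq hh, mul_assoc (h ^ _)]
  refine mul_le_mul_of_nonneg_left ?_ (by positivity)
  have h1 : (i : ℝ) ^ a ≤ ((i + j : ℕ+) : ℝ) ^ a :=
    Real.rpow_le_rpow hi0.le (by rw [cast_add_eq]; linarith) ha
  have h2 : (j : ℝ) ^ a ≤ (j : ℝ) ^ p := Real.rpow_le_rpow_of_exponent_le hj (by linarith)
  have h3 : ((i + j : ℕ+) : ℝ) ^ (a + b) ≤ ((i + j : ℕ+) : ℝ) ^ p :=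
    Real.rpow_le_rpow_of_exponent_le hij hp
  have h4 : (1 : ℝ) ≤ 2 ^ b := Real.one_le_rpow (by norm_num) hb
  calc (i : ℝ) ^ a * (j : ℝ) ^ a * ((i + j : ℕ+) : ℝ) ^ b
      ≤ ((i + j : ℕ+) : ℝ) ^ a * (j : ℝ) ^ p * ((i + j : ℕ+) : ℝ) ^ b := by gcongr
    _ = ((i + j : ℕ+) : ℝ) ^ (a + b) * (j : ℝ) ^ p := by rw [Real.rpow_add hij0]; ring
    _ ≤ ((i + j : ℕ+) : ℝ) ^ p * (j : ℝ) ^ p := mul_le_mul_of_nonneg_right h3 (by positivity)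
    _ ≤ _ := le_mul_of_one_le_left (by positivity) h4

theorem kernelBound_coag {h a b p : ℝ} (hh : 0 < h) (hb : 0 ≤ b) (hp : a + b ≤ p) :
    KernelBound (h ^ (2 * a + b) * 2 ^ b) p (kernel h a b) 0 where
  nonneg₁ := kernel_nonneg hh a b
  nonneg₂ _ _ := le_rfl
  le₁ := kernel_le₁ hh hb hp
  le₂ i j := by
    have := cast_pos j
    have := cast_pos (i + j)
    simp only [Pi.zero_apply]; positivity

theorem kernelBound_frag {h a b p : ℝ} (hh : 0 < h) (ha : 0 ≤ a) (hb : 0 ≤ b) (hp : a + b ≤ p) :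
    KernelBound (h ^ (2 * a + b) * 2 ^ b) p 0 (kernel h a b) where
  nonneg₁ _ _ := le_rfl
  nonneg₂ := kernel_nonneg hh a b
  le₁ i j := by
    have := cast_pos i
    have := cast_pos j
    simp only [Pi.zero_apply]; positivity
  le₂ := kernel_le₂ hh ha hb hp

/-- The largest homogeneity `αₙ + βₙ` of the growth of the kernels in one variable. -/
def maxOrder (α β : Fin 3 → ℝ) : ℝ := max (α 0 + β 0) (max (α 1 + β 1) (α 2 + β 2))

theorem le_maxOrder (α β : Fin 3 → ℝ) (n : Fin 3) : α n + β n ≤ maxOrder α β := by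
  unfold maxOrder
  fin_cases n
  · exact le_max_left _ _
  · exact le_max_of_le_right (le_max_left _ _)
  · exact le_max_of_le_right (le_max_right _ _)

theorem exists_maxOrder_eq (α β : Fin 3 → ℝ) : ∃ n, maxOrder α β = α n + β n := by
  unfold maxOrder
  rcases max_choice (α 0 + β 0) (max (α 1 + β 1) (α 2 + β 2)) with h | h
  · exact ⟨0, h⟩
  · rcases max_choice (α 1 + β 1) (α 2 + β 2) with h' | h'
    · exact ⟨1, h.trans h'⟩
    · exact ⟨2, h.trans h'⟩

/-- The sum of the two splitting kernels. -/
def fragKernel (h : ℝ) (α β : Fin 3 → ℝ) (i j : ℕ+) : ℝ :=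
  kernel h (α 1) (β 1) i j + kernel h (α 2) (β 2) i j

section

variable {h : ℝ} {α β : Fin 3 → ℝ}

theorem exists_kernelBound (hh : 0 < h) (hα : ∀ n, 0 ≤ α n) (hβ : ∀ n, 0 ≤ β n) :
    ∃ c, KernelBound c (maxOrder α β) (kernel h (α 0) (β 0)) (fragKernel h α β) := by
  let C : Fin 3 → ℝ := fun n => h ^ (2 * α n + β n) * 2 ^ β n
  have hC : ∀ n, 0 ≤ C n := fun n => by simp only [C]; positivity
  refine ⟨C 0 + (C 1 + C 2), kernel_nonneg hh _ _,
    fun i j => add_nonneg (kernel_nonneg hh _ _ i j) (kernel_nonneg hh _ _ i j),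
    fun i j => ?_, fun i j => ?_⟩
  · have hi := cast_pos i
    have hj := cast_pos j
    refine (kernel_le₁ hh (hβ 0) (le_maxOrder α β 0) i j).trans
      (mul_le_mul_of_nonneg_right ?_ (by positivity))
    linarith [hC 1, hC 2]
  · have hj := cast_pos j
    have hij := cast_pos (i + j)
    have h1 := kernel_le₂ hh (hα 1) (hβ 1) (le_maxOrder α β 1) i j
    have h2 := kernel_le₂ hh (hα 2) (hβ 2) (le_maxOrder α β 2) i j
    have h3 : 0 ≤ C 0 * (((i + j : ℕ+) : ℝ) ^ maxOrder α β * (j : ℝ) ^ maxOrder α β) :=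
      mul_nonneg (hC 0) (by positivity)
    unfold fragKernel
    simp only [C] at *
    linarith

theorem seriesConverge_of_wsummable (hh : 0 < h) (hα : ∀ n, 0 ≤ α n) (hβ : ∀ n, 0 ≤ β n)
    {f : ℕ+ → ℝ} (hf : WSummable (maxOrder α β) f) : SeriesConverge h α β f := by
  have hfl : ∀ n : Fin 3, Summable fun x : ℕ+ × ℕ+ =>
      kernel h (α n) (β n) x.1 x.2 * f (x.1 + x.2) * f x.2 := fun n => by
    have := (summable_flux (kernelBound_frag hh (hα n) (hβ n) (le_maxOrder α β n)) hf).neg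
    refine this.congr fun x => ?_
    simp [flux]
  refine ⟨fun i => ?_, fun n _ i => ?_, fun n _ i => ?_⟩
  · have := (summable_flux (kernelBound_coag hh (hβ 0) (le_maxOrder α β 0)) hf).prod_factor i
    refine this.congr fun j => ?_
    simp [flux]
  · refine ((hfl n).prod_symm.prod_factor i).congr fun l => ?_
    simp only [Prod.swap_prod_mk]
    rw [add_comm l i]; ring
  · exact (hfl n).prod_factor i

theorem sum_Iio_reflect (i : ℕ+) (F : ℕ+ → ℕ+ → ℝ) :
    ∑ j ∈ Finset.Iio i, F (i - j) j = ∑ j ∈ Finset.Iio i, F j (i - j) := by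
  have hlt : ∀ j ∈ Finset.Iio i, i - j ∈ Finset.Iio i := fun j hj => by
    have := PNat.add_sub_of_lt (Finset.mem_Iio.1 hj)
    rw [Finset.mem_Iio]
    calc i - j < j + (i - j) := PNat.lt_add_left _ _
      _ = i := this
  have hinv : ∀ j ∈ Finset.Iio i, i - (i - j) = j := fun j hj => by
    have h1 := PNat.add_sub_of_lt (Finset.mem_Iio.1 hj)
    have h2 := PNat.add_sub_of_lt (Finset.mem_Iio.1 (hlt j hj))
    have h3 : (i - j) + (i - (i - j)) = (i - j) + j := by rw [h2, add_comm, h1]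
    exact add_left_cancel h3
  refine Finset.sum_nbij' (fun j => i - j) (fun j => i - j) hlt hlt hinv hinv fun j hj => ?_
  rw [hinv j hj]

/-- The operator `O` is the transfer operator applied to the net merging rates, minus damping. The
symmetry of the kernel turns the loss term `2 ∑ K f_i f_j` into the two sums of `transfer`, and the
convergence of the series allows the infinite sums to be combined. -/
theorem fullOp_eq (hh : 0 < h) (δ : ℝ) {f : ℕ+ → ℝ} (hs : SeriesConverge h α β f) (i : ℕ+) :
    fullOp h α β δ f i = transfer (flux (kernel h (α 0) (β 0)) (fragKernel h α β) f) i
      - h ^ δ * (i : ℝ) ^ δ * f i := by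
  have hn1 : (1 : Fin 3) ≠ 0 := by decide
  have hn2 : (2 : Fin 3) ≠ 0 := by decide
  have c0 := hs.coag_loss i
  have l1 := hs.frag_gain_left 1 hn1 i
  have l2 := hs.frag_gain_left 2 hn2 i
  have r1 := hs.frag_gain_right 1 hn1 i
  have r2 := hs.frag_gain_right 2 hn2 i
  have e1 : ∑' j, flux (kernel h (α 0) (β 0)) (fragKernel h α β) f (i, j)
      = ∑' j, kernel h (α 0) (β 0) i j * f i * f j
        - (∑' l, kernel h (α 1) (β 1) i l * f (i + l) * f l
          + ∑' l, kernel h (α 2) (β 2) i l * f (i + l) * f l) := by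
    rw [← r1.tsum_add r2, ← c0.tsum_sub (r1.add r2)]
    exact tsum_congr fun j => by simp only [flux, fragKernel]; ring
  have e2 : ∑' j, flux (kernel h (α 0) (β 0)) (fragKernel h α β) f (j, i)
      = ∑' j, kernel h (α 0) (β 0) i j * f i * f j
        - (∑' l, kernel h (α 1) (β 1) l i * f i * f (i + l)
          + ∑' l, kernel h (α 2) (β 2) l i * f i * f (i + l)) := by
    rw [← l1.tsum_add l2, ← c0.tsum_sub (l1.add l2)]
    refine tsum_congr fun j => ?_
    simp only [flux, fragKernel]
    rw [kernel_comm h (α 0) (β 0) j i, add_comm j i]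
    ring
  have e3 : ∑ j ∈ Finset.Iio i, flux (kernel h (α 0) (β 0)) (fragKernel h α β) f (j, i - j)
      = ∑ j ∈ Finset.Iio i, kernel h (α 0) (β 0) j (i - j) * f j * f (i - j)
        - (∑ j ∈ Finset.Iio i, kernel h (α 1) (β 1) (i - j) j * f i * f j
          + ∑ j ∈ Finset.Iio i, kernel h (α 2) (β 2) (i - j) j * f i * f j) := by
    rw [sum_Iio_reflect i fun x y => kernel h (α 1) (β 1) x y * f i * f y,
      sum_Iio_reflect i fun x y => kernel h (α 2) (β 2) x y * f i * f y,
      ← Finset.sum_add_distrib, ← Finset.sum_sub_distrib]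
    refine Finset.sum_congr rfl fun j hj => ?_
    simp only [flux, fragKernel]
    rw [PNat.add_sub_of_lt (Finset.mem_Iio.1 hj)]
    ring
  unfold fullOp coag frag transfer
  rw [e1, e2, e3, loc_rpow hh]
  ring

theorem summable_of_summable_add {F : ℕ+ → ℝ} (i : ℕ+) (hF : Summable fun l => F (i + l)) :
    Summable F := by
  have hinj : Function.Injective fun l : ℕ+ => i + l := add_right_injective i
  have hfin : (Set.range fun l : ℕ+ => i + l)ᶜ.Finite := by
    refine (finite_le i).subset fun j hj => ?_
    by_contra hij
    rw [Set.mem_ofPred_eq, not_le] at hij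
    exact hj ⟨j - i, PNat.add_sub_of_lt hij⟩
  rw [← hfin.summable_compl_iff, compl_compl]
  exact (Equiv.ofInjective _ hinj).summable_iff.1 hF

/-- If all series in the equation converge at a nonnegative sequence, then its weighted norm of
order `maxOrder` is finite: a single nonzero entry `f i` makes the series in the `i`-th equation
comparable to `∑ f_j j ^ (αₙ + βₙ)`. -/
theorem wsummable_of_seriesConverge (hh : 0 < h) (hα : ∀ n, 0 ≤ α n) (hβ : ∀ n, 0 ≤ β n)
    {f : ℕ+ → ℝ} (hf : ∀ i, 0 ≤ f i) (hs : SeriesConverge h α β f) :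
    WSummable (maxOrder α β) f := by
  by_cases h0 : ∀ i, f i = 0
  · simp [WSummable, h0]
  push Not at h0
  obtain ⟨i, hi⟩ := h0
  have hfi : 0 < f i := lt_of_le_of_ne (hf i) (Ne.symm hi)
  have hli := loc_pos hh i
  obtain ⟨n, hn⟩ := exists_maxOrder_eq α β
  rw [hn, ← finiteMoment_iff hh hf]
  unfold FiniteMoment
  by_cases hn0 : n = 0
  · subst hn0
    have h1 := (hs.coag_loss i).mul_left ((loc h i ^ α 0)⁻¹ * (f i)⁻¹)
    refine Summable.of_nonneg_of_le (fun j => mul_nonneg (hf j)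
      (Real.rpow_nonneg (loc_pos hh j).le _)) (fun j => ?_) h1
    have hlj := loc_pos hh j
    have hfj := hf j
    have h2 : loc h j ^ β 0 ≤ (loc h i + loc h j) ^ β 0 :=
      Real.rpow_le_rpow hlj.le (by linarith) (hβ 0)
    have e : (loc h i ^ α 0)⁻¹ * (f i)⁻¹ * (kernel h (α 0) (β 0) i j * f i * f j)
        = f j * (loc h j ^ α 0 * (loc h i + loc h j) ^ β 0) := by
      unfold kernel; field_simp
    rw [e, Real.rpow_add hlj]
    gcongr
  · refine summable_of_summable_add i ?_
    have h1 := (hs.frag_gain_left n hn0 i).mul_left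
      ((1 + (i : ℝ)) ^ α n * ((loc h i ^ α n)⁻¹ * (f i)⁻¹))
    refine Summable.of_nonneg_of_le (fun l => mul_nonneg (hf _)
      (Real.rpow_nonneg (loc_pos hh _).le _)) (fun l => ?_) h1
    have hll := loc_pos hh l
    have hlil := loc_pos hh (i + l)
    have hfl := hf (i + l)
    have hi0 := cast_pos i
    -- `i + l ≤ (1 + i) l`
    have h2 : loc h (i + l) ^ α n ≤ (1 + (i : ℝ)) ^ α n * loc h l ^ α n := by
      rw [← Real.mul_rpow (by positivity) hll.le]
      refine Real.rpow_le_rpow hlil.le ?_ (hα n)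
      rw [loc_add]
      unfold loc
      have := mul_le_mul_of_nonneg_left (one_le_cast l) (mul_pos hi0 hh).le
      linarith
    have e : (1 + (i : ℝ)) ^ α n * ((loc h i ^ α n)⁻¹ * (f i)⁻¹)
        * (kernel h (α n) (β n) l i * f i * f (i + l))
        = f (i + l) * ((1 + (i : ℝ)) ^ α n * loc h l ^ α n * loc h (i + l) ^ β n) := by
      unfold kernel; rw [loc_add, add_comm (loc h l)]; field_simp
    rw [e, Real.rpow_add hlil]
    gcongr

end

/-! ### Existence and uniqueness -/

section

variable {h : ℝ} {α β : Fin 3 → ℝ} {δ κ : ℝ} {f₀ : ℕ+ → ℝ}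

theorem wnorm_le_of_moment_le (hh : 0 < h) {q L : ℝ} {f : ℕ+ → ℝ} (hf : ∀ i, 0 ≤ f i)
    (hL : moment h q f ≤ L) : wnorm q f ≤ h ^ (-q) * L := by
  rw [moment_eq hh hf] at hL
  have hq : 0 < h ^ q := by positivity
  rw [Real.rpow_neg hh.le, inv_mul_eq_div, le_div_iff₀ hq]
  linarith

/-- Solutions are unique. No moment bound is assumed: on a compact time interval the time
derivative is bounded in `ℓ¹`, which already bounds the weighted norm of order `δ`. -/
theorem IsSolution.unique (hh : 0 < h) (hα : ∀ n, 0 ≤ α n) (hβ : ∀ n, 0 ≤ β n)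
    (hδ : ∀ n, α n + β n < δ) {f g : ℝ → Ell1} (hf : IsSolution h α β δ f₀ f)
    (hg : IsSolution h α β δ f₀ g) {T : ℝ} (hT : 0 ≤ T) : g T = f T := by
  set p := maxOrder α β
  have hp : 0 ≤ p := (add_nonneg (hα 0) (hβ 0)).trans (le_maxOrder α β 0)
  have hpδ : p < δ := by
    obtain ⟨n, hn⟩ := exists_maxOrder_eq α β
    exact hn.trans_lt (hδ n)
  have hcd : 0 < h ^ δ := by positivity
  obtain ⟨c, hk⟩ := exists_kernelBound (α := α) (β := β) hh hα hβ
  have hsub : Set.Icc 0 T ⊆ Set.Ici (0 : ℝ) := Set.Icc_subset_Ici_self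
  have hgen : ∀ w : ℝ → Ell1, IsSolution h α β δ f₀ w →
      (∀ t ∈ Set.Icc 0 T, HasDerivWithinAt w (derivWithin w (Set.Ici 0) t) (Set.Icc 0 T) t) ∧
      (∀ t ∈ Set.Icc 0 T, ∀ i : ℕ+, derivWithin w (Set.Ici 0) t i
        = transfer (flux (kernel h (α 0) (β 0)) (fragKernel h α β) (w t)) i
          - h ^ δ * (i : ℝ) ^ δ * w t i) ∧
      ∃ B, ∀ t ∈ Set.Icc 0 T, WSummable δ (w t) ∧ wnorm p (w t) ≤ B := by
    intro w hw
    have hdiff := hw.contDiffOn.differentiableOn (by norm_num)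
    have hcont : ContinuousOn (derivWithin w (Set.Ici 0)) (Set.Icc 0 T) :=
      (hw.contDiffOn.continuousOn_derivWithin (uniqueDiffOn_Ici 0) le_rfl).mono hsub
    have heq : ∀ t ∈ Set.Icc 0 T, ∀ i : ℕ+, derivWithin w (Set.Ici 0) t i
        = transfer (flux (kernel h (α 0) (β 0)) (fragKernel h α β) (w t)) i
          - h ^ δ * (i : ℝ) ^ δ * w t i := fun t ht i => by
      rw [hw.equation t ht.1 i, fullOp_eq hh δ (hw.converge t ht.1)]
    refine ⟨fun t ht => ((hdiff t ht.1).hasDerivWithinAt).mono hsub, heq, ?_⟩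
    obtain ⟨C, hC⟩ := isCompact_Icc.exists_bound_of_continuousOn hcont
    obtain ⟨B, hB⟩ := exists_wnorm_bound hpδ hcd (lt_max_of_lt_right one_pos : 0 < max C 1) hk
    refine ⟨B, fun t ht => ?_⟩
    have hwp := wsummable_of_seriesConverge hh hα hβ (hw.nonneg t ht.1) (hw.converge t ht.1)
    have e : (fun i : ℕ+ => |transfer (flux (kernel h (α 0) (β 0)) (fragKernel h α β) (w t)) i
        - h ^ δ * (i : ℝ) ^ δ * w t i|) = fun i => |derivWithin w (Set.Ici 0) t i| := by
      funext i; rw [heq t ht i]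
    have h1 := hB (w t) (hw.nonneg t ht.1) hwp
      (by rw [e]; exact Ell1.summable_abs _)
      (by rw [e, ← Ell1.norm_eq]; exact (hC t ht).trans (le_max_left _ _))
    exact ⟨h1.1, (wnorm_mono h1.1 hpδ.le).trans h1.2⟩
  obtain ⟨df, ef, Bf, hBf⟩ := hgen f hf
  obtain ⟨dg, eg, Bg, hBg⟩ := hgen g hg
  have hBf0 : 0 ≤ Bf := (wnorm_nonneg p _).trans (hBf 0 ⟨le_rfl, hT⟩).2
  obtain ⟨C, hC, hst⟩ := exists_stability hp hpδ hcd (le_max_of_le_left hBf0 : 0 ≤ max Bf Bg)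
    hk.const_nonneg
  have h1 := hst _ _ _ _ hk hk g _ f _ T 0 dg df eg ef
    (fun t ht => ⟨(hBg t ht).1, (hBg t ht).2.trans (le_max_right _ _)⟩)
    (fun t ht => ⟨(hBf t ht).1, (hBf t ht).2.trans (le_max_left _ _)⟩)
    (fun t _ => by simp) T ⟨hT, le_rfl⟩
  have h0 : g 0 = f 0 := lp.ext (funext fun i => by rw [hg.initial, hf.initial])
  rw [h0, sub_self, norm_zero, mul_zero, zero_div, add_zero, mul_zero] at h1
  exact sub_eq_zero.1 (norm_le_zero_iff.1 h1)

/-- Truncated solutions converge to a solution, and their moment bounds pass to the limit. -/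
theorem exists_solution (hh : 0 < h) (hα : ∀ n, 0 ≤ α n) (hβ : ∀ n, 0 ≤ β n)
    (hδ : ∀ n, α n + β n < δ) (hδ₁ : 2 * α 0 + β 0 - 1 < δ) (hδκ : δ < κ) (hκ1 : 1 < κ)
    (hκ2 : 2 - α 0 - β 0 < κ) (hf₀ : ∀ i, 0 ≤ f₀ i) (hm : FiniteMoment h κ f₀) :
    ∃ f : ℝ → Ell1, IsSolution h α β δ f₀ f ∧ ∀ t, 0 ≤ t →
        FiniteMoment h 1 (f t) ∧ moment h 1 (f t) ≤ moment h 1 f₀ ∧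
        FiniteMoment h κ (f t) ∧
        moment h κ (f t) ≤
          max (moment h κ f₀) (2 * boundB (α 0) (β 0) δ κ (moment h 1 f₀)) := by
  set p := maxOrder α β
  have hp : 0 ≤ p := (add_nonneg (hα 0) (hβ 0)).trans (le_maxOrder α β 0)
  have hpδ : p < δ := by
    obtain ⟨n, hn⟩ := exists_maxOrder_eq α β
    exact hn.trans_lt (hδ n)
  have hδ0 : 0 ≤ δ := by linarith
  have hcd : 0 < h ^ δ := by positivity
  obtain ⟨c, hk⟩ := exists_kernelBound (α := α) (β := β) hh hα hβ
  have hκf := (finiteMoment_iff hh hf₀).1 hm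
  have hm1 : FiniteMoment h 1 f₀ := (finiteMoment_iff hh hf₀).2 (hκf.mono hκ1.le)
  set L := max (moment h κ f₀) (2 * boundB (α 0) (β 0) δ κ (moment h 1 f₀))
  have hL0 : 0 ≤ L := le_max_of_le_left (moment_nonneg hh hf₀)
  have hex : ∀ N : ℕ, ∃ u u' : ℝ → Ell1, 0 < N → IsTruncatedSolution δ (h ^ δ)
      (kernel h (α 0) (β 0)) (fragKernel h α β) f₀ N N u u' := fun N => by
    rcases Nat.eq_zero_or_pos N with hN | hN
    · exact ⟨0, 0, fun h => absurd h (by omega)⟩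
    · obtain ⟨u, u', hu⟩ := exists_truncated_solution hp hδ0 hcd.le hk hf₀ hN
        (Nat.cast_nonneg (α := ℝ) N)
      exact ⟨u, u', fun _ => hu⟩
  choose u u' hu using hex
  have hmκ : ∀ N : ℕ, 0 < N → ∀ t ∈ Set.Icc (0 : ℝ) N, moment h κ (u N t) ≤ L :=
    fun N hN => (hu N hN).moment_le (hα 0) (hβ 0) (hδ 0) hδ₁ hκ1 hκ2 hh hk hf₀ hm1 hm
  have hm1' : ∀ N : ℕ, 0 < N → ∀ t ∈ Set.Icc (0 : ℝ) N, moment h 1 (u N t) ≤ moment h 1 f₀ :=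
    fun N hN => (hu N hN).moment_one_le hk hh hf₀ hm1
  have hfam : IsTruncatedFamily δ (h ^ δ) κ (h ^ (-κ) * L) (kernel h (α 0) (β 0))
      (fragKernel h α β) f₀ u u' :=
    ⟨hu, fun N hN t ht => wnorm_le_of_moment_le hh ((hu N hN).nonneg t ht) (hmκ N hN t ht)⟩
  obtain ⟨f, f', hf'c, hder, hlim, hbd, heq⟩ := hfam.exists_limit hp hpδ hδκ hcd
    (by positivity) hk hκf
  have hev : ∀ t : ℝ, 0 ≤ t → ∀ᶠ N : ℕ in Filter.atTop, 0 < N ∧ t ∈ Set.Icc (0 : ℝ) N :=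
    fun t ht => (Filter.eventually_gt_atTop 0).and
      ((tendsto_natCast_atTop_atTop.eventually (Filter.eventually_ge_atTop t)).mono
        fun N hN => ⟨ht, hN⟩)
  have happ : ∀ t, 0 ≤ t → ∀ i, Filter.Tendsto (fun N => u N t i) Filter.atTop (nhds (f t i)) :=
    fun t ht i => ((evalCLM i).continuous.tendsto (f t)).comp (hlim t ht)
  have hnn : ∀ t, 0 ≤ t → ∀ i, 0 ≤ f t i := fun t ht i =>
    ge_of_tendsto (happ t ht i) ((hev t ht).mono fun N hN => (hu N hN.1).nonneg t hN.2 i)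
  have hconv : ∀ t, 0 ≤ t → SeriesConverge h α β (f t) := fun t ht =>
    seriesConverge_of_wsummable hh hα hβ ((hbd t ht).1.mono (by linarith))
  have hmom : ∀ q L' : ℝ, (∀ N : ℕ, 0 < N → ∀ t ∈ Set.Icc (0 : ℝ) N, moment h q (u N t) ≤ L') →
      ∀ t, 0 ≤ t → FiniteMoment h q (f t) ∧ moment h q (f t) ≤ L' := by
    intro q L' hq t ht
    have h1 := le_of_tendsto_wnorm (hlim t ht) (a := fun i => loc h i ^ q) (L := L')
      (fun i => Real.rpow_nonneg (loc_pos hh i).le q) ((hev t ht).mono fun N hN => by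
        have h2 : ∀ i, |u N t i| = u N t i := fun i => abs_of_nonneg ((hu N hN.1).nonneg t hN.2 i)
        simp only [h2]
        exact ⟨(hu N hN.1).finiteMoment hh q hN.2, hq N hN.1 t hN.2⟩)
    have h2 : ∀ i, |f t i| = f t i := fun i => abs_of_nonneg (hnn t ht i)
    simp only [h2] at h1
    exact h1
  refine ⟨f, ⟨?_, hnn, fun i => ?_, hconv, fun t ht i => ?_⟩, fun t ht => ?_⟩
  · refine (contDiff_one_iff_deriv.2 ⟨fun t => (hder t).differentiableAt, ?_⟩).contDiffOn
    rw [show deriv f = f' from funext fun t => (hder t).deriv]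
    exact hf'c
  · refine tendsto_nhds_unique (happ 0 le_rfl i) (tendsto_const_nhds.congr' ?_)
    filter_upwards [Filter.eventually_ge_atTop (i : ℕ), Filter.eventually_gt_atTop 0] with N hN hN0
    rw [(hu N hN0).initial, if_pos hN]
  · rw [(hder t).hasDerivWithinAt.derivWithin (uniqueDiffOn_Ici 0 t ht), heq t ht,
      fullOp_eq hh δ (hconv t ht)]
  · obtain ⟨a1, a2⟩ := hmom 1 _ hm1' t ht
    obtain ⟨b1, b2⟩ := hmom κ _ hmκ t ht
    exact ⟨a1, a2, b1, b2⟩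

end

end CoagFrag

end

theorem theorem1
    (h : ℝ) (hh : 0 < h)
    (α β : Fin 3 → ℝ) (hα : ∀ n, 0 ≤ α n) (hβ : ∀ n, 0 ≤ β n)
    (δ : ℝ) (hδ : ∀ n, α n + β n < δ) (hδ₁ : 2 * α 0 + β 0 - 1 < δ)
    (κ : ℝ) (hκ : max δ (max 1 (2 - α 0 - β 0)) < κ)
    (f₀ : ℕ+ → ℝ) (hf₀ : ∀ i, 0 ≤ f₀ i) (hm : CoagFrag.FiniteMoment h κ f₀) :
    ∃ f : ℝ → CoagFrag.Ell1,
      CoagFrag.IsSolution h α β δ f₀ f ∧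
      (∀ g : ℝ → CoagFrag.Ell1, CoagFrag.IsSolution h α β δ f₀ g →
        ∀ t, 0 ≤ t → g t = f t) ∧
      (∀ t, 0 ≤ t →
        CoagFrag.FiniteMoment h 1 (f t) ∧
        CoagFrag.moment h 1 (f t) ≤ CoagFrag.moment h 1 f₀ ∧
        CoagFrag.FiniteMoment h κ (f t) ∧
        CoagFrag.moment h κ (f t) ≤
          max (CoagFrag.moment h κ f₀)
            (2 * CoagFrag.boundB (α 0) (β 0) δ κ (CoagFrag.moment h 1 f₀))) := by
  obtain ⟨hδκ, hκ'⟩ := max_lt_iff.1 hκ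
  obtain ⟨hκ1, hκ2⟩ := max_lt_iff.1 hκ'
  obtain ⟨f, hf, hmom⟩ :=
    CoagFrag.exists_solution hh hα hβ hδ hδ₁ hδκ hκ1 hκ2 hf₀ hm
  exact ⟨f, hf, fun g hg t ht => hf.unique hh hα hβ hδ hg ht, hmom⟩
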